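/- **Definitions.** Let $X$ be a Hausdorff space. An *orbifold chart* $(\tilde U,\Gamma,U,\pi)$ on $X$ consists of an open set $\tilde U\subset\mathbb R^d$, a finite group $\Gamma$ acting smoothly and faithfully on $\tilde U$, an open set $U\subset X$ and a continuous map $\pi:\tilde U\to U$ inducing a homeomorphism $\tilde U/\Gamma\to U$. Two charts are *compatible* if whenever $\pi_1(\tilde x_1)=\pi_2(\tilde x_2)$ there is a diffeomorphism $h$ from a neighborhood of $\tilde x_1$ onto a neighborhood of $\tilde x_2$ with $h(\tilde x_1)=\tilde x_2$ and $\pi_2\circ h=\pi_1$. An *orbifold structure* is a maximal atlas of pairwise compatible charts. Let $p:Y\to X$ be a continuous map of orbifolds and $V$ a finite-dimensional vector space over $\mathbb K=\mathbb R$ or $\mathbb C$. A *vector orbibundle chart* $(\tilde U,V,\Gamma,U,\Pi,\pi)$ consists of an orbifold chart $(\tilde U,\Gamma,U,\pi)$ of $X$ and an orbifold chart $(\tilde U\times V,\Gamma,p^{-1}(U),\Pi)$ of $Y$ such that $\Gamma$ acts on $\tilde U\times V\to\tilde U$ by $\mathbb K$-vector bundle isomorphisms and $p\circ\Pi=\pi\circ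 \mathrm{pr}_1$. Compatibility is defined as above, with local vector bundle diffeomorphisms $(H,h)$ satisfying $\pi_2\circ h=\pi_1$ and $\Pi_2\circ H=\Pi_1$. A *vector orbibundle structure* on $p$ consists of orbifold structures on $X$ and $Y$ and a maximal atlas of pairwise compatible vector orbibundle charts whose sets $U$ cover $X$. **Theorem.** Let $G$ be a compact Lie group of dimension $q$, $M$ a smooth (Hausdorff) $n$-manifold, and $E\to M$ a smooth real or complex vector bundle with fiber $V$. Let $G$ act smoothly on $E$ by vector bundle isomorphisms over a smooth action on $M$, such that every isotropy group $G_x$, $x\in M$, is finite. Assume moreover that the set of points $y\in M$ whose isotropy group $G_y$ acts trivially on the fiber $E_y$ is dense in $M$ (for instance, that the points with trivial isotropy group are dense). Then $\bar p:E/G\to M/G$ has a canonical vector orbibundle structure $\mathcal S$, with charts $\tilde U\subset\mathbb R^{n-q}$, in the following sense. 1. There is a vector orbibundle structure $\mathcal S$ on $\bar p$ whose charts are exactly those vector orbibundle charts $(\tilde U,V,\Gamma,U,\Pi,\pi)$ such that locally on $\tilde U$ the pair $(\Pi,\pi)$ lifts to a smooth vector bundle map $(H,h)$ into $E\to M$ that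 is isomorphic on fibers and for which $(a,z)\mapsto a\cdot h(z)$ is a local diffeomorphism from $G\times\tilde U$ to $M$. 2. Let any $G$-invariant Riemannian metric on $M$ and any $G$-invariant ($\mathbb K$-linear) smooth connection $\nabla$ in $E$ be given. Let $x\in M$, let $N_x\subset T_xM$ be the orthogonal complement of $T_x(Gx)$, and fix linear isomorphisms $\mathbb R^{n-q}\cong N_x$, $V\cong E_x$. Call a vector orbibundle chart $(\tilde U,V,\Gamma,U,\Pi,\pi)$ *exponential at $x$* if: $\tilde U\subset N_x$ is a $G_x$-invariant open neighborhood of $0$; $\Gamma$ is the image of $G_x$ in the transformation group of $\tilde U$, acting on $\tilde U$ and on $V\cong E_x$ through the linear isotropy representations of $G_x$; $\exp_x$ is defined on $\tilde U$ and $(a,u)\mapsto a\cdot\exp_x(u)$ induces a diffeomorphism from $G\times_{G_x}\tilde U$ onto an open subset of $M$; and $\pi(u)$ is the orbit of $\exp_x(u)$, while $\Pi(u,X)$ is the orbit of the $\nabla$-parallel transport of $X\in E_x$ along $t\mapsto\exp_x(tu)$, $t\in[0,1]$, this transport being smooth in $(u,X)\in\tilde U\times E_x$. Then for every $x\in M$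 and all such isomorphisms there are exponential charts at $x$ with arbitrarily small $\tilde U$, and $\mathcal S$ is the unique vector orbibundle structure on $\bar p$ that contains all exponential charts. In particular the structure generated by these charts does not depend on the choice of the metric and of the connection. -/

import Mathlib

open Set Topology Bundle Manifold
open scoped ContDiff

universe u

/-! ### Orbifolds -/

section Orbifold

/-- An orbifold chart `(Ũ, Γ, μ, U, π)` on `X`: `source` is `Ũ`, an open subset of the model space
`B`; `target` is the coordinate neighborhood `U`; `act` is the faithful smooth action `μ` of the
finite group `Γ` on `Ũ`; `proj` is `π`.  (Values of `act` and `proj` off `source` are irrelevant.)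
The last two fields say that `π : Ũ → U` factors through a homeomorphism `Ũ/Γ ≃ U`. -/
structure OrbifoldChart (Γ : Type u) [Group Γ] [Finite Γ]
    (B : Type*) [NormedAddCommGroup B] [NormedSpace ℝ B]
    (X : Type*) [TopologicalSpace X] where
  source : Set B
  target : Set X
  act : Γ → B → B
  proj : B → X
  isOpen_source : IsOpen source
  isOpen_target : IsOpen target
  act_mapsTo : ∀ γ, MapsTo (act γ) source source
  act_one : ∀ w ∈ source, act 1 w = w
  act_mul : ∀ γ γ', ∀ w ∈ source, act (γ * γ') w = act γ (act γ' w)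
  act_smooth : ∀ γ, ContDiffOn ℝ ∞ (act γ) source
  act_faithful : ∀ γ, (∀ w ∈ source, act γ w = w) → γ = 1
  proj_mapsTo : MapsTo proj source target
  proj_isQuotientMap : IsQuotientMap (proj_mapsTo.restrict proj source target)
  proj_eq_iff : ∀ w ∈ source, ∀ w' ∈ source, proj w = proj w' ↔ ∃ γ, act γ w = w'

/-- `h` is a diffeomorphism between open subsets `h.source ⊆ s` and `h.target ⊆ s'` of `B`. -/
def IsDiffeoWithin {B : Type*} [NormedAddCommGroup B] [NormedSpace ℝ B]
    (h : OpenPartialHomeomorph B B) (s s' : Set B) : Prop :=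
  h.source ⊆ s ∧ h.target ⊆ s' ∧ ContDiffOn ℝ ∞ h h.source ∧ ContDiffOn ℝ ∞ h.symm h.target

variable {B : Type*} [NormedAddCommGroup B] [NormedSpace ℝ B]
  {X : Type*} [TopologicalSpace X]

/-- Compatibility of orbifold charts. -/
def OrbifoldChart.Compatible {Γ Γ' : Type u} [Group Γ] [Finite Γ] [Group Γ'] [Finite Γ']
    (c : OrbifoldChart Γ B X) (c' : OrbifoldChart Γ' B X) : Prop :=
  ∀ w ∈ c.source, ∀ w' ∈ c'.source, c.proj w = c'.proj w' →
    ∃ h : OpenPartialHomeomorph B B, IsDiffeoWithin h c.source c'.source ∧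
      w ∈ h.source ∧ h w = w' ∧ ∀ z ∈ h.source, c'.proj (h z) = c.proj z

variable (B X) in
/-- An orbifold structure on the Hausdorff space `X`: a maximal orbifold atlas.  The atlas is given
as the predicate `IsChart` on all orbifold charts with model space `B`. -/
@[ext]
structure OrbifoldStructure where
  IsChart : ∀ (Γ : Type u) [Group Γ] [Finite Γ], OrbifoldChart Γ B X → Prop
  t2 : T2Space X
  compatible : ∀ (Γ Γ' : Type u) [Group Γ] [Finite Γ] [Group Γ'] [Finite Γ']
    (c : OrbifoldChart Γ B X) (c' : OrbifoldChart Γ' B X),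
    IsChart Γ c → IsChart Γ' c' → c.Compatible c'
  cover : ∀ x : X, ∃ (Γ : Type u) (_ : Group Γ) (_ : Finite Γ) (c : OrbifoldChart Γ B X),
    IsChart Γ c ∧ x ∈ c.target
  maximal : ∀ (Γ : Type u) [Group Γ] [Finite Γ] (c : OrbifoldChart Γ B X),
    (∀ (Γ' : Type u) [Group Γ'] [Finite Γ'] (c' : OrbifoldChart Γ' B X),
      IsChart Γ' c' → c.Compatible c' ∧ c'.Compatible c) → IsChart Γ c

end Orbifold

/-! ### Vector orbibundles -/

section Orbibundle

/-- A vector orbibundle chart `(Ũ, V, Γ, U, Π, π)` for `p : Y → X`, with `V = F`: an orbifold chart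
`base = (Ũ, Γ, U, π)` on `X` and an orbifold chart `total = (Ũ × V, Γ, p⁻¹(U), Π)` on `Y`, such
that `Γ` acts on the trivial bundle `Ũ × V → Ũ` by `𝕜`-vector bundle isomorphisms and
`p ∘ Π = π ∘ pr₁`. -/
structure VectorOrbibundleChart (𝕜 : Type*) [RCLike 𝕜] (Γ : Type u) [Group Γ] [Finite Γ]
    (B : Type*) [NormedAddCommGroup B] [NormedSpace ℝ B]
    (F : Type*) [NormedAddCommGroup F] [NormedSpace ℝ F] [Module 𝕜 F]
    {X Y : Type*} [TopologicalSpace X] [TopologicalSpace Y] (p : Y → X) where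
  base : OrbifoldChart Γ B X
  total : OrbifoldChart Γ (B × F) Y
  source_eq : total.source = base.source ×ˢ univ
  target_eq : total.target = p ⁻¹' base.target
  act_linear : ∀ γ, ∀ w ∈ base.source, ∃ L : F ≃ₗ[𝕜] F,
    ∀ v, total.act γ (w, v) = (base.act γ w, L v)
  proj_comm : ∀ w ∈ base.source, ∀ v, p (total.proj (w, v)) = base.proj w

variable {𝕜 : Type*} [RCLike 𝕜]
  {B : Type*} [NormedAddCommGroup B] [NormedSpace ℝ B]
  {F : Type*} [NormedAddCommGroup F] [NormedSpace ℝ F] [Module 𝕜 F]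
  {X Y : Type*} [TopologicalSpace X] [TopologicalSpace Y] {p : Y → X}

/-- Compatibility of vector orbibundle charts, realized by local vector bundle diffeomorphisms
`H (z, v) = (h z, L z v)`. -/
def VectorOrbibundleChart.Compatible {Γ Γ' : Type u} [Group Γ] [Finite Γ] [Group Γ'] [Finite Γ']
    (c : VectorOrbibundleChart 𝕜 Γ B F p) (c' : VectorOrbibundleChart 𝕜 Γ' B F p) : Prop :=
  ∀ w ∈ c.base.source, ∀ w' ∈ c'.base.source, c.base.proj w = c'.base.proj w' →
    ∃ (h : OpenPartialHomeomorph B B) (L : B → F ≃ₗ[𝕜] F),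
      IsDiffeoWithin h c.base.source c'.base.source ∧ w ∈ h.source ∧ h w = w' ∧
      ContDiffOn ℝ ∞ (fun z : B × F => L z.1 z.2) (h.source ×ˢ univ) ∧
      ContDiffOn ℝ ∞ (fun z : B × F => (L z.1).symm z.2) (h.source ×ˢ univ) ∧
      (∀ z ∈ h.source, c'.base.proj (h z) = c.base.proj z) ∧
      ∀ z ∈ h.source, ∀ v, c'.total.proj (h z, L z v) = c.total.proj (z, v)

variable (𝕜 B F p) in
/-- A structure of vector orbibundle on `p : Y → X`: `X` and `Y` are orbifolds, `p` is continuous,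
and a maximal vector orbibundle atlas (the predicate `IsChart`) is given, whose charts are made of
orbifold charts of `X` and `Y`. -/
@[ext]
structure VectorOrbibundleStructure where
  base : OrbifoldStructure.{u} B X
  total : OrbifoldStructure.{u} (B × F) Y
  IsChart : ∀ (Γ : Type u) [Group Γ] [Finite Γ], VectorOrbibundleChart 𝕜 Γ B F p → Prop
  continuous : Continuous p
  isChart_base : ∀ (Γ : Type u) [Group Γ] [Finite Γ] (c : VectorOrbibundleChart 𝕜 Γ B F p),
    IsChart Γ c → base.IsChart Γ c.base
  isChart_total : ∀ (Γ : Type u) [Group Γ] [Finite Γ] (c : VectorOrbibundleChart 𝕜 Γ B F p),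
    IsChart Γ c → total.IsChart Γ c.total
  compatible : ∀ (Γ Γ' : Type u) [Group Γ] [Finite Γ] [Group Γ'] [Finite Γ']
    (c : VectorOrbibundleChart 𝕜 Γ B F p) (c' : VectorOrbibundleChart 𝕜 Γ' B F p),
    IsChart Γ c → IsChart Γ' c' → c.Compatible c'
  cover : ∀ x : X, ∃ (Γ : Type u) (_ : Group Γ) (_ : Finite Γ)
    (c : VectorOrbibundleChart 𝕜 Γ B F p), IsChart Γ c ∧ x ∈ c.base.target
  maximal : ∀ (Γ : Type u) [Group Γ] [Finite Γ] (c : VectorOrbibundleChart 𝕜 Γ B F p),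
    base.IsChart Γ c.base → total.IsChart Γ c.total →
    (∀ (Γ' : Type u) [Group Γ'] [Finite Γ'] (c' : VectorOrbibundleChart 𝕜 Γ' B F p),
      IsChart Γ' c' → c.Compatible c' ∧ c'.Compatible c) → IsChart Γ c

end Orbibundle

/-! ### Connections, parallel transport, geodesics -/

section Connection

variable {n : ℕ} {M : Type*} [TopologicalSpace M] [ChartedSpace (EuclideanSpace ℝ (Fin n)) M]
  {F : Type*} [NormedAddCommGroup F] [NormedSpace ℝ F]
  {E : M → Type*} [TopologicalSpace (TotalSpace F E)]
  [∀ x, AddCommGroup (E x)] [∀ x, Module ℝ (E x)] [∀ x, TopologicalSpace (E x)]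
  [∀ x, IsTopologicalAddGroup (E x)] [∀ x, ContinuousSMul ℝ (E x)] [FiberBundle F E]

/-- The covariant derivative `(D s / dt)(t)` of a section `s` along the curve `τ ↦ (s τ).proj`.  If
`s` is `f(τ)` in the local trivialization `e` around `(s t).proj`, it is the sum of `f'(t)` and of
`∇` of the `e`-constant section with value `f(t)` in the direction of the velocity of the curve. -/
noncomputable def covDerivAlong (cov : CovariantDerivative (𝓡 n) F E)
    (s : ℝ → TotalSpace F E) (t : ℝ) : E (s t).proj :=
  (trivializationAt F E (s t).proj).symm (s t).proj
      (deriv (fun τ => ((trivializationAt F E (s t).proj) (s τ)).2) t) +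
    cov (fun y => (trivializationAt F E (s t).proj).symm y
        ((trivializationAt F E (s t).proj) (s t)).2) (s t).proj
      (mfderiv 𝓘(ℝ, ℝ) (𝓡 n) (fun τ => (s τ).proj) t (1 : ℝ))

/-- `s` is a smooth parallel section along the curve `τ ↦ (s τ).proj`, for times in `J`. -/
def IsParallelOn (cov : CovariantDerivative (𝓡 n) F E) (s : ℝ → TotalSpace F E) (J : Set ℝ) :
    Prop :=
  ContMDiffOn 𝓘(ℝ, ℝ) ((𝓡 n).prod 𝓘(ℝ, F)) ∞ s J ∧ ∀ t ∈ J, covDerivAlong cov s t = 0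

/-- Parallel transport along `γ : [0, 1] → M` takes `Z` to `Z'`. -/
def IsParallelTransport (cov : CovariantDerivative (𝓡 n) F E) (γ : ℝ → M)
    (Z Z' : TotalSpace F E) : Prop :=
  ∃ (J : Set ℝ) (s : ℝ → TotalSpace F E), IsOpen J ∧ Icc 0 1 ⊆ J ∧ IsParallelOn cov s J ∧
    (∀ t ∈ J, (s t).proj = γ t) ∧ s 0 = Z ∧ s 1 = Z'

/-- The velocity field of a curve. -/
noncomputable def velocity (γ : ℝ → M) (t : ℝ) : TangentBundle (𝓡 n) M :=
  ⟨γ t, mfderiv 𝓘(ℝ, ℝ) (𝓡 n) γ t (1 : ℝ)⟩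

variable [IsManifold (𝓡 n) ∞ M]

/-- `γ` is, on a neighborhood of `[0, 1]`, the geodesic with initial velocity `ξ`; thus `γ 1` is
the value of the exponential map at `ξ`. -/
def IsGeodesicFrom (cov : CovariantDerivative (𝓡 n) (EuclideanSpace ℝ (Fin n))
    (TangentSpace (𝓡 n) : M → Type _)) (ξ : TangentBundle (𝓡 n) M) (γ : ℝ → M) : Prop :=
  ∃ J : Set ℝ, IsOpen J ∧ Icc 0 1 ⊆ J ∧ ContMDiffOn 𝓘(ℝ, ℝ) (𝓡 n) ∞ γ J ∧
    IsParallelOn cov (velocity γ) J ∧ velocity γ 0 = ξ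

/-- `cov` is the Levi-Civita connection of the Riemannian metric `g`. -/
structure IsLeviCivita
    (g : ContMDiffRiemannianMetric (𝓡 n) ∞ (EuclideanSpace ℝ (Fin n))
      (TangentSpace (𝓡 n) : M → Type _))
    (cov : CovariantDerivative (𝓡 n) (EuclideanSpace ℝ (Fin n))
      (TangentSpace (𝓡 n) : M → Type _)) : Prop where
  smooth : CovariantDerivative.ContMDiffCovariantDerivative cov ∞
  torsion_eq_zero : cov.torsion = 0
  metric : ∀ (σ τ : ∀ x : M, TangentSpace (𝓡 n) x) (x : M),
    MDifferentiableAt (𝓡 n) (𝓡 n).tangent (fun y => (⟨y, σ y⟩ : TangentBundle (𝓡 n) M)) x →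
    MDifferentiableAt (𝓡 n) (𝓡 n).tangent (fun y => (⟨y, τ y⟩ : TangentBundle (𝓡 n) M)) x →
    ∀ X : TangentSpace (𝓡 n) x,
      mfderiv (𝓡 n) 𝓘(ℝ, ℝ) (fun y => g.inner y (σ y) (τ y)) x X =
        g.inner x (cov σ x X) (τ x) + g.inner x (σ x) (cov τ x X)

end Connection

/-! ### Equivariant vector bundles and their orbit spaces -/

section Equivariant

variable {M : Type*} {F : Type*} {E : M → Type*} [∀ x, AddCommGroup (E x)]

/-- `G` acts on the total space of `E → M` by `𝕜`-vector bundle isomorphisms over its action on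
`M`. -/
class IsVectorBundleAction (𝕜 : Type*) [RCLike 𝕜] [∀ x, Module 𝕜 (E x)]
    (G : Type*) [Group G] [MulAction G M] [MulAction G (TotalSpace F E)] : Prop where
  exists_linear : ∀ (a : G) (x : M), ∃ L : E x ≃ₗ[𝕜] E (a • x),
    ∀ v : E x, a • (⟨x, v⟩ : TotalSpace F E) = ⟨a • x, L v⟩

/-- The map of orbit spaces `E/G → M/G` induced by the bundle projection. -/
def orbitProj (𝕜 : Type*) [RCLike 𝕜] [∀ x, Module 𝕜 (E x)]
    (G : Type*) [Group G] [MulAction G M] [MulAction G (TotalSpace F E)]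
    [IsVectorBundleAction (F := F) (E := E) 𝕜 G] :
    MulAction.orbitRel.Quotient G (TotalSpace F E) → MulAction.orbitRel.Quotient G M :=
  Quotient.map TotalSpace.proj (by
    rintro Z ⟨x, v⟩ ⟨a, rfl⟩
    obtain ⟨L, hL⟩ := IsVectorBundleAction.exists_linear (F := F) (E := E) (𝕜 := 𝕜) a x
    exact ⟨a, by simp only [hL v]⟩)

end Equivariant

section Canonical

variable {q n : ℕ}
  (G : Type u) [Group G] [TopologicalSpace G] [ChartedSpace (EuclideanSpace ℝ (Fin q)) G]
  {M : Type*} [TopologicalSpace M] [ChartedSpace (EuclideanSpace ℝ (Fin n)) M]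
  [MulAction G M]
  {F : Type*} [NormedAddCommGroup F] [NormedSpace ℝ F]
  {E : M → Type*} [TopologicalSpace (TotalSpace F E)]
  [∀ x, AddCommGroup (E x)] [∀ x, TopologicalSpace (E x)] [FiberBundle F E]
  [MulAction G (TotalSpace F E)]

/-- A vector orbibundle chart `(Ũ, F, Γ, U, Π, π)` for `E/G → M/G` is locally induced by `E → M` if
near each point of `Ũ` the pair `(Π, π)` lifts to a smooth vector bundle map `(H, h)` into `E → M`
that is an isomorphism on the fibers and whose base map `h` is a slice: `(a, z) ↦ a • h z` is a
local diffeomorphism from `G × Ũ` to `M`. -/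
def VectorOrbibundleChart.IsLocallyInduced {𝕜 : Type*} [RCLike 𝕜] [Module 𝕜 F]
    [∀ x, Module 𝕜 (E x)] [IsVectorBundleAction (F := F) (E := E) 𝕜 G]
    {Γ : Type u} [Group Γ] [Finite Γ]
    (c : VectorOrbibundleChart 𝕜 Γ (EuclideanSpace ℝ (Fin (n - q))) F
      (orbitProj (F := F) (E := E) 𝕜 G)) : Prop :=
  ∀ w ∈ c.base.source, ∃ (W : Set (EuclideanSpace ℝ (Fin (n - q))))
    (h : EuclideanSpace ℝ (Fin (n - q)) → M)
    (H : EuclideanSpace ℝ (Fin (n - q)) × F → TotalSpace F E),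
    IsOpen W ∧ w ∈ W ∧ W ⊆ c.base.source ∧
    ContMDiffOn (𝓡 (n - q)) (𝓡 n) ∞ h W ∧
    ContMDiffOn ((𝓡 (n - q)).prod 𝓘(ℝ, F)) ((𝓡 n).prod 𝓘(ℝ, F)) ∞ H (W ×ˢ univ) ∧
    (∀ z ∈ W, ∃ L : F ≃ₗ[𝕜] E (h z), ∀ v, H (z, v) = ⟨h z, L v⟩) ∧
    IsLocalDiffeomorphOn ((𝓡 q).prod (𝓡 (n - q))) (𝓡 n) ∞
      (fun y : G × EuclideanSpace ℝ (Fin (n - q)) => y.1 • h y.2) (univ ×ˢ W) ∧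
    (∀ z ∈ W, c.base.proj z = Quotient.mk _ (h z)) ∧
    ∀ z ∈ W, ∀ v, c.total.proj (z, v) = Quotient.mk _ (H (z, v))

variable [∀ x, Module ℝ (E x)] [∀ x, IsTopologicalAddGroup (E x)] [∀ x, ContinuousSMul ℝ (E x)]
  [IsManifold (𝓡 n) ∞ M]

/-- A `G`-invariant Riemannian metric `g` on `M`, with its Levi-Civita connection `lc`, and a
`G`-invariant smooth `𝕜`-linear connection `conn` in `E`. -/
structure InvariantGeometry (𝕜 : Type*) [RCLike 𝕜] [∀ x, Module 𝕜 (E x)] [VectorBundle ℝ F E] where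
  g : ContMDiffRiemannianMetric (𝓡 n) ∞ (EuclideanSpace ℝ (Fin n))
    (TangentSpace (𝓡 n) : M → Type _)
  g_invariant : ∀ (a : G) (x : M) (v w : TangentSpace (𝓡 n) x),
    g.inner (a • x) (mfderiv (𝓡 n) (𝓡 n) (fun y : M => a • y) x v)
      (mfderiv (𝓡 n) (𝓡 n) (fun y : M => a • y) x w) = g.inner x v w
  lc : CovariantDerivative (𝓡 n) (EuclideanSpace ℝ (Fin n)) (TangentSpace (𝓡 n) : M → Type _)
  lc_isLeviCivita : IsLeviCivita g lc
  conn : CovariantDerivative (𝓡 n) F E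
  conn_smooth : CovariantDerivative.ContMDiffCovariantDerivative conn ∞
  conn_linear : ∀ (k : 𝕜) (σ : ∀ x, E x) (x : M),
    MDifferentiableAt (𝓡 n) ((𝓡 n).prod 𝓘(ℝ, F)) (fun y => (⟨y, σ y⟩ : TotalSpace F E)) x →
    ∀ X : TangentSpace (𝓡 n) x, conn (fun y => k • σ y) x X = k • conn σ x X
  conn_invariant : ∀ (a : G) (σ σ' : ∀ x, E x),
    (∀ y, a • (⟨y, σ y⟩ : TotalSpace F E) = ⟨a • y, σ' (a • y)⟩) →
    ∀ (x : M) (X : TangentSpace (𝓡 n) x),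
      MDifferentiableAt (𝓡 n) ((𝓡 n).prod 𝓘(ℝ, F)) (fun y => (⟨y, σ y⟩ : TotalSpace F E)) x →
      a • (⟨x, conn σ x X⟩ : TotalSpace F E) =
        ⟨a • x, conn σ' (a • x) (mfderiv (𝓡 n) (𝓡 n) (fun y : M => a • y) x X)⟩

variable (q) in
/-- The orthogonal complement in `T_x M` of the tangent space `T_x(G x)` of the orbit. -/
def normalSpace (g : ContMDiffRiemannianMetric (𝓡 n) ∞ (EuclideanSpace ℝ (Fin n))
    (TangentSpace (𝓡 n) : M → Type _)) (x : M) : Submodule ℝ (TangentSpace (𝓡 n) x) where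
  carrier := {v | ∀ ξ : TangentSpace (𝓡 q) (1 : G), g.inner x v
    (show TangentSpace (𝓡 n) x from mfderiv (𝓡 q) (𝓡 n) (fun a : G => a • x) 1 ξ) = 0}
  zero_mem' := fun ξ => by rw [map_zero]; rfl
  add_mem' := fun {v w} hv hw ξ => by
    rw [map_add, _root_.add_apply, hv ξ, hw ξ, add_zero]
  smul_mem' := fun r v hv ξ => by
    rw [map_smul, _root_.smul_apply, hv ξ, smul_zero]

/-- `c = (Ũ, F, Γ, U, Π, π)` is the linear vector orbibundle chart at the orbit of `x` given by the
exponential map and the parallel transport of `A`.  The normal space of the orbit at `x` is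
identified with Euclidean space by `ν`, the fiber `E_x` with `F` by `κ`.  Then `Ũ` is a neighborhood
of the origin; the group `Γ` is the isotropy group of `x`, made effective through the surjection
`θ`, acting on the normal space and on `E_x` by its linear representations; `ψ` is the exponential
map, `Ψ` is parallel transport along the geodesics `t ↦ exp (t • ν w)`; the map `(a, w) ↦ a • ψ w`
is a diffeomorphism from `G ×_{G_x} Ũ` onto an open set; and `(Ψ, ψ)` induces `(Π, π)`. -/
def IsExponentialChart {𝕜 : Type*} [RCLike 𝕜] [Module 𝕜 F] [∀ x, Module 𝕜 (E x)]
    [VectorBundle ℝ F E] [IsVectorBundleAction (F := F) (E := E) 𝕜 G]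
    (A : InvariantGeometry (n := n) (F := F) (E := E) G 𝕜) (x : M)
    (ν : EuclideanSpace ℝ (Fin (n - q)) ≃ₗ[ℝ] normalSpace q G A.g x) (κ : F ≃ₗ[𝕜] E x)
    {Γ : Type u} [Group Γ] [Finite Γ]
    (c : VectorOrbibundleChart 𝕜 Γ (EuclideanSpace ℝ (Fin (n - q))) F
      (orbitProj (F := F) (E := E) 𝕜 G)) : Prop :=
  (0 : EuclideanSpace ℝ (Fin (n - q))) ∈ c.base.source ∧
  ∃ (θ : MulAction.stabilizer G x →* Γ) (ψ : EuclideanSpace ℝ (Fin (n - q)) → M)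
    (Ψ : EuclideanSpace ℝ (Fin (n - q)) × F → TotalSpace F E),
    Function.Surjective θ ∧
    (∀ (k : MulAction.stabilizer G x), ∀ w ∈ c.base.source,
      tangentMap (𝓡 n) (𝓡 n) (fun y : M => (k : G) • y) ⟨x, ν w⟩ =
        ⟨x, ν (c.base.act (θ k) w)⟩) ∧
    (∀ (k : MulAction.stabilizer G x), ∀ w ∈ c.base.source, ∀ v : F,
      (k : G) • (⟨x, κ v⟩ : TotalSpace F E) = ⟨x, κ (c.total.act (θ k) (w, v)).2⟩) ∧
    (∀ w ∈ c.base.source, ∃ γ : ℝ → M, IsGeodesicFrom A.lc ⟨x, ν w⟩ γ ∧ γ 1 = ψ w ∧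
      ∀ v : F, IsParallelTransport A.conn γ ⟨x, κ v⟩ (Ψ (w, v))) ∧
    IsLocalDiffeomorphOn ((𝓡 q).prod (𝓡 (n - q))) (𝓡 n) ∞
      (fun y : G × EuclideanSpace ℝ (Fin (n - q)) => y.1 • ψ y.2) (univ ×ˢ c.base.source) ∧
    (∀ a a' : G, ∀ w ∈ c.base.source, ∀ w' ∈ c.base.source, a • ψ w = a' • ψ w' ↔
      ∃ k : MulAction.stabilizer G x, a' = a * (k : G)⁻¹ ∧ w' = c.base.act (θ k) w) ∧
    ContMDiffOn ((𝓡 (n - q)).prod 𝓘(ℝ, F)) ((𝓡 n).prod 𝓘(ℝ, F)) ∞ Ψ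
      (c.base.source ×ˢ univ) ∧
    (∀ w ∈ c.base.source, c.base.proj w = Quotient.mk _ (ψ w)) ∧
    ∀ w ∈ c.base.source, ∀ v, c.total.proj (w, v) = Quotient.mk _ (Ψ (w, v))

end Canonical

/-! Call a map `h` from an open set of `R^(n-q)` to `M` a slice if `(a, z) ↦ a • h z` is a local
diffeomorphism. If two slices meet the same orbit, inverting one of these local diffeomorphisms
along the other slice gives `h z = α z • h' (τ z)` with a local diffeomorphism `τ` and a smooth
group-valued `α` (`IsSlice.exists_transition`). In the orbit space `α` disappears. Hence charts that
lift locally to slices are compatible. Conversely, a chart compatible with enough liftable charts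
lifts as well: compose their lifts with the transition maps. So the liftable charts, as soon as they
cover, form a maximal atlas, and every structure containing a covering family of them is equal to
it. A fiberwise isomorphic bundle map over a slice is a slice in `E` (`IsSlice.total`), so the
argument serves `E/G` too and, with a fiber component in the transition, the vector orbibundle
charts (`VectorOrbibundleChart.IsLocallyInduced.compatible`, `eq_inducedOrbibundleStructure`). What
remains is the existence of charts.

Let `K` be the finite isotropy group of `x`. Suppose `ψ` is a `K`-equivariant map into `M` from a
neighborhood of `0` in a linear representation, whose differential at `0` is injective with image
complementary to the tangent space of the orbit, and `Ψ` is an equivariant bundle map over `ψ`.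
Since `K` is finite, the orbit map is an immersion at the identity (`orbitDeriv_injective`), so the
inverse function theorem makes `ψ` a slice near `0`. Compactness of `G` shows that a small slice
meets each orbit in at most one `K`-orbit (`exists_nhds_eq_of_smul_eq`). Dividing `K` by the kernel
of its representation on the slice makes the action effective, and the density hypothesis is exactly
what forces this kernel to act trivially on the fiber, so that the quotient acts on the bundle chart
too (`exists_tubeChart`).

Such pairs `(Ψ, ψ)` come from two sources. Averaging a chart of `M` and a local bundle map over `K`
needs neither metric nor connection and yields the covering (`exists_isLocallyInduced`). Given a
metric and a connection, `ψ` is the exponential map and `Ψ` is radial parallel transport. Their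
smoothness comes from the joint system for geodesics and transport operators, which is stationary at
zero velocity; its flow is constructed by the inverse function theorem in a space of continuous
curves (`exists_smooth_flow`, `exists_exponential_data`). Their equivariance comes from the
uniqueness of geodesics and of parallel sections, once isometries are known to preserve the
Levi-Civita connection (`IsLeviCivita.mfderiv_covDeriv`). Exponential charts are locally induced
whatever the metric and the connection, so they always generate the same structure. -/

set_option linter.unusedSectionVars false

/-! ### Smooth dependence of solutions of differential equations -/

section Flow

set_option synthInstance.maxHeartbeats 200000

open ContinuousMap

/-- Pointwise application of a continuous family of operators to a continuous curve. -/
noncomputable def pointwiseApply (K : Type*) [TopologicalSpace K] [CompactSpace K]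
    {L Z Z' : Type*} [NormedAddCommGroup L] [NormedSpace ℝ L]
    [NormedAddCommGroup Z] [NormedSpace ℝ Z] [NormedAddCommGroup Z'] [NormedSpace ℝ Z']
    (b : L →L[ℝ] Z →L[ℝ] Z') : C(K, L) →L[ℝ] C(K, Z) →L[ℝ] C(K, Z') :=
  LinearMap.mkContinuous₂
    (LinearMap.mk₂ ℝ (fun (A : C(K, L)) (α : C(K, Z)) =>
        (⟨fun t => b (A t) (α t), by fun_prop⟩ : C(K, Z')))
      (fun _ _ _ => by ext; simp) (fun _ _ _ => by ext; simp)
      (fun _ _ _ => by ext; simp) (fun _ _ _ => by ext; simp)) ‖b‖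
    (fun A α => by
      rw [ContinuousMap.norm_le _ (by positivity)]
      intro t
      exact (b.le_opNorm₂ (A t) (α t)).trans (by
        gcongr
        exacts [A.norm_coe_le_norm t, α.norm_coe_le_norm t]))

lemma norm_pointwiseApply_le {K : Type*} [TopologicalSpace K] [CompactSpace K]
    {L Z Z' : Type*} [NormedAddCommGroup L] [NormedSpace ℝ L]
    [NormedAddCommGroup Z] [NormedSpace ℝ Z] [NormedAddCommGroup Z'] [NormedSpace ℝ Z']
    {b : L →L[ℝ] Z →L[ℝ] Z'} (A : C(K, L)) {D : ℝ} (hD : 0 ≤ D) (h : ∀ t, ‖b (A t)‖ ≤ D) :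
    ‖pointwiseApply K b A‖ ≤ D := by
  refine ContinuousLinearMap.opNorm_le_bound _ hD fun α => ?_
  rw [ContinuousMap.norm_le _ (by positivity)]
  intro t
  exact ((b (A t)).le_opNorm (α t)).trans
    (mul_le_mul (h t) (α.norm_coe_le_norm t) (norm_nonneg _) hD)

/-- Mean value inequality on the segment from `x` to `y`, along which `f'` differs from `f' x` by at
most `C * ‖y - x‖`. -/
lemma norm_sub_sub_le_of_lipschitz {Z Z' : Type*}
    [NormedAddCommGroup Z] [NormedSpace ℝ Z] [NormedAddCommGroup Z'] [NormedSpace ℝ Z']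
    {f : Z → Z'} {f' : Z → Z →L[ℝ] Z'} (hf : ∀ x, HasFDerivAt f (f' x) x) {C : NNReal}
    (hC : LipschitzWith C f') (x y : Z) : ‖f y - f x - f' x (y - x)‖ ≤ C * ‖y - x‖ * ‖y - x‖ := by
  refine Convex.norm_image_sub_le_of_norm_hasFDerivWithin_le' (s := segment ℝ x y)
    (fun z _ => (hf z).hasFDerivWithinAt) (fun z hz => ?_) (convex_segment x y)
    (left_mem_segment ℝ x y) (right_mem_segment ℝ x y)
  rw [← dist_eq_norm]
  refine (hC.dist_le_mul z x).trans ?_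
  rw [dist_eq_norm]
  exact mul_le_mul_of_nonneg_left (norm_sub_le_of_mem_segment hz) C.2

/-- A global Lipschitz constant for `f'` bounds the first-order Taylor remainder quadratically,
uniformly over the points of `K`; so the remainder is also quadratic in the sup norm. -/
lemma hasFDerivAt_continuousMap_comp {K Z Z' : Type*} [TopologicalSpace K] [CompactSpace K]
    [NormedAddCommGroup Z] [NormedSpace ℝ Z] [NormedAddCommGroup Z'] [NormedSpace ℝ Z']
    (f : C(Z, Z')) (f' : C(Z, Z →L[ℝ] Z')) (hf : ∀ x, HasFDerivAt f (f' x) x) {C : NNReal}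
    (hC : LipschitzWith C f') (α : C(K, Z)) :
    HasFDerivAt (fun β : C(K, Z) => f.comp β) (pointwiseApply K (ContinuousLinearMap.id ℝ (Z →L[ℝ] Z')) (f'.comp α)) α := by
  rw [hasFDerivAt_iff_isLittleO]
  have : (fun β : C(K, Z) => f.comp β - f.comp α - pointwiseApply K (ContinuousLinearMap.id ℝ (Z →L[ℝ] Z')) (f'.comp α) (β - α))
      =O[𝓝 α] fun β => ‖β - α‖ ^ 2 := by
    refine Asymptotics.IsBigO.of_bound C (Filter.Eventually.of_forall fun β => ?_)
    rw [ContinuousMap.norm_le _ (by positivity)]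
    intro t
    refine (norm_sub_sub_le_of_lipschitz hf hC (α t) (β t)).trans ?_
    have h : ‖β t - α t‖ ≤ ‖β - α‖ := (β - α).norm_coe_le_norm t
    rw [norm_pow, norm_norm, pow_two, ← mul_assoc]
    gcongr
  refine this.trans_isLittleO ?_
  have h2 : Filter.Tendsto (fun β : C(K, Z) => ‖β - α‖) (𝓝 α) (𝓝 0) := by
    have : Continuous fun β : C(K, Z) => ‖β - α‖ := by fun_prop
    simpa using this.tendsto α
  have h3 : (fun β : C(K, Z) => ‖β - α‖) =o[𝓝 α] (fun _ => (1 : ℝ)) :=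
    (Asymptotics.isLittleO_one_iff ℝ).2 h2
  have h4 := h3.mul_isBigO (Asymptotics.isBigO_refl (fun β : C(K, Z) => ‖β - α‖) (𝓝 α))
  simp only [one_mul] at h4
  refine (h4.congr_left fun β => (pow_two _).symm).trans_isBigO ?_
  exact (Asymptotics.isBigO_refl _ _).norm_left

/-- The derivative of composition with `f` is composition with `fderiv ℝ f` followed by a bounded
linear map, so one can induct on the order. The target must vary in the induction, since it passes
from `Z'` to `Z →L[ℝ] Z'`; compact support provides the Lipschitz constants and is inherited by the
derivative. -/
lemma contDiff_continuousMap_comp {K : Type*} {Z : Type u} [TopologicalSpace K] [CompactSpace K]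
    [NormedAddCommGroup Z] [NormedSpace ℝ Z] (k : ℕ) :
    ∀ {Z' : Type u} [NormedAddCommGroup Z'] [NormedSpace ℝ Z'] (f : C(Z, Z')),
      ContDiff ℝ ∞ f → HasCompactSupport f → ContDiff ℝ k (fun β : C(K, Z) => f.comp β) := by
  induction k with
  | zero =>
    intro Z' _ _ f _ _
    exact contDiff_zero.2 (ContinuousMap.continuous_postcomp f)
  | succ k ih =>
    intro Z' _ _ f hf hfc
    have hf1 : ContDiff ℝ ∞ (fderiv ℝ f) := hf.fderiv_right (m := ∞) (by simp)
    obtain ⟨C, hC⟩ := hf1.lipschitzWith_of_hasCompactSupport (hfc.fderiv ℝ) (by simp)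
    let f' : C(Z, Z →L[ℝ] Z') := ⟨fderiv ℝ f, hf1.continuous⟩
    rw [Nat.cast_add, Nat.cast_one, contDiff_succ_iff_hasFDerivAt]
    refine ⟨fun β => pointwiseApply K (ContinuousLinearMap.id ℝ (Z →L[ℝ] Z')) (f'.comp β), ?_, fun β =>
      hasFDerivAt_continuousMap_comp f f' (fun x => ?_) hC β⟩
    · exact (pointwiseApply K (ContinuousLinearMap.id ℝ (Z →L[ℝ] Z'))).contDiff.comp (ih f' hf1 (hfc.fderiv ℝ))
    · exact (hf.differentiable (by simp) x).hasFDerivAt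

/-- The integral from `0` of a curve on `[-1, 2]`, multiplied by `ε`. -/
noncomputable def pathPrimitive (Z : Type*) [NormedAddCommGroup Z] [NormedSpace ℝ Z] (ε : ℝ) :
    C(Icc (-1 : ℝ) 2, Z) →L[ℝ] C(Icc (-1 : ℝ) 2, Z) :=
  LinearMap.mkContinuous
    { toFun := fun α => ⟨fun t => ε • ∫ s in (0 : ℝ)..t, α (projIcc (-1) 2 (by norm_num) s), by
        refine (Continuous.comp (g := fun t : ℝ => ∫ s in (0 : ℝ)..t,
          α (projIcc (-1) 2 (by norm_num) s)) ?_ continuous_subtype_val).const_smul ε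
        exact intervalIntegral.continuous_primitive
          (fun a b => (α.continuous.comp continuous_projIcc).intervalIntegrable a b) 0⟩
      map_add' := fun α β => by
        ext t
        refine (congrArg (fun z : Z => ε • z) (intervalIntegral.integral_add
          ((α.continuous.comp continuous_projIcc).intervalIntegrable _ _)
          ((β.continuous.comp continuous_projIcc).intervalIntegrable _ _))).trans ?_
        exact smul_add _ _ _
      map_smul' := fun r α => by
        ext t
        refine (congrArg (fun z : Z => ε • z) (intervalIntegral.integral_smul r _)).trans ?_
        exact smul_comm _ _ _ } (|ε| * 2)
    (fun α => by
      rw [ContinuousMap.norm_le _ (by positivity)]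
      intro t
      change ‖ε • ∫ s in (0 : ℝ)..t, α (projIcc (-1) 2 (by norm_num) s)‖ ≤ _
      rw [norm_smul, Real.norm_eq_abs, mul_assoc]
      gcongr
      refine (intervalIntegral.norm_integral_le_of_norm_le_const
        (fun s _ => α.norm_coe_le_norm _)).trans ?_
      rw [mul_comm]
      gcongr
      rw [sub_zero, abs_le]
      constructor <;> linarith [t.2.1, t.2.2])

lemma norm_pathPrimitive_le (Z : Type*) [NormedAddCommGroup Z] [NormedSpace ℝ Z] (ε : ℝ) :
    ‖pathPrimitive Z ε‖ ≤ |ε| * 2 :=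
  LinearMap.mkContinuous_norm_le _ (by positivity) _

/-- Near a stationary point of a smooth vector field `f`, the flow of a small multiple of `f` is
defined on the time interval `(-1, 2)`, and its time one map is smooth. -/
theorem exists_smooth_flow {Z : Type u} [NormedAddCommGroup Z] [NormedSpace ℝ Z]
    [FiniteDimensional ℝ Z] {f : Z → Z} {z₀ : Z} {O : Set Z} (hO : O ∈ 𝓝 z₀)
    (hf : ContDiffOn ℝ ∞ f O) (hf0 : f z₀ = 0) {f' : Z →L[ℝ] Z} (hf' : HasFDerivAt f f' z₀)
    (hsq : f'.comp f' = 0) :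
    ∃ ε : ℝ, 0 < ε ∧ ∃ (V : Set Z) (α : Z → ℝ → Z), IsOpen V ∧ z₀ ∈ V ∧
      (∀ z ∈ V, α z 0 = z ∧ ∀ t ∈ Ioo (-1 : ℝ) 2, α z t ∈ O ∧
        HasDerivAt (α z) (ε • f (α z t)) t) ∧
      ContDiffOn ℝ ∞ (fun z => α z 1) V ∧ α z₀ 1 = z₀ ∧
      HasFDerivAt (fun z => α z 1) (ContinuousLinearMap.id ℝ Z + ε • f') z₀ := by
  have hcs : CompleteSpace Z := FiniteDimensional.complete ℝ Z
  obtain ⟨r, hr, hrO⟩ := Metric.nhds_basis_closedBall.mem_iff.1 (interior_mem_nhds.2 hO)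
  -- Cutting `f` off gives a compactly supported global field that agrees with `f` on the ball of
  -- radius `r / 2`.
  let χ : ContDiffBump z₀ := ⟨r / 2, r, by positivity, by linarith⟩
  have hg : ContDiff ℝ ∞ (fun z => χ z • f z) := by
    rw [contDiff_iff_contDiffAt]
    intro z
    by_cases hz : z ∈ interior O
    · exact χ.contDiff.contDiffAt.smul (hf.contDiffAt (mem_interior_iff_mem_nhds.1 hz))
    · have : (fun z => χ z • f z) =ᶠ[𝓝 z] fun _ => 0 := by
        have h1 : (Metric.closedBall z₀ r)ᶜ ∈ 𝓝 z :=
          Metric.isClosed_closedBall.isOpen_compl.mem_nhds fun h => hz (hrO h)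
        filter_upwards [h1] with y hy
        rw [χ.zero_of_le_dist, zero_smul]
        rw [mem_compl_iff, Metric.mem_closedBall, not_le] at hy
        exact hy.le
      exact contDiffAt_const.congr_of_eventuallyEq this
  have hgc : HasCompactSupport (fun z => χ z • f z) := χ.hasCompactSupport.smul_right
  let g : C(Z, Z) := ⟨_, hg.continuous⟩
  have hgf : ∀ z ∈ Metric.ball z₀ (r / 2), g z = f z := fun z hz => by
    change χ z • f z = f z
    rw [χ.one_of_mem_closedBall (Metric.ball_subset_closedBall hz), one_smul]
  have hg1 : ContDiff ℝ ∞ (fderiv ℝ g) := hg.fderiv_right (m := ∞) (by simp)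
  obtain ⟨C, hC⟩ := hg1.lipschitzWith_of_hasCompactSupport (hgc.fderiv ℝ) (by simp)
  obtain ⟨D, hD⟩ := (hgc.fderiv ℝ).exists_bound_of_continuous hg1.continuous
  let g' : C(Z, Z →L[ℝ] Z) := ⟨fderiv ℝ g, hg1.continuous⟩
  have hgg' : ∀ x, HasFDerivAt g (g' x) x := fun x => (hg.differentiable (by simp) x).hasFDerivAt
  have hg'0 : g' z₀ = f' := by
    refine (hgg' z₀).unique (hf'.congr_of_eventuallyEq ?_)
    filter_upwards [Metric.ball_mem_nhds z₀ (half_pos hr)] with z hz using hgf z hz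
  have hD0 : 0 ≤ D := (norm_nonneg _).trans (hD z₀)
  -- The last division by 2 cancels the length bound 2 in the norm of `pathPrimitive`; then `‖T β‖ ≤
  -- D / (2 * D + 1) < 1`.
  set ε : ℝ := 1 / (2 * D + 1) / 2 with hε
  have hε0 : 0 < ε := by positivity
  refine ⟨ε, hε0, ?_⟩
  let K := Icc (-1 : ℝ) 2
  let T : C(K, Z) → C(K, Z) →L[ℝ] C(K, Z) := fun β =>
    (pathPrimitive Z ε).comp (pointwiseApply K (ContinuousLinearMap.id ℝ (Z →L[ℝ] Z)) (g'.comp β))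
  have hT : ∀ β, ‖T β‖ < 1 := fun β => by
    calc ‖T β‖ ≤ |ε| * 2 * D :=
          (ContinuousLinearMap.opNorm_comp_le _ _).trans (mul_le_mul (norm_pathPrimitive_le Z ε)
            (norm_pointwiseApply_le _ hD0 fun t => hD _) (norm_nonneg _) (by positivity))
      _ < 1 := by
          rw [abs_of_pos hε0, hε, div_mul_cancel₀ _ (two_ne_zero), div_mul_eq_mul_div,
            div_lt_one (by positivity)]
          linarith
  -- The Picard equation: `β` is an integral curve of `ε • g` on `[-1, 2]` with `β 0 = z` exactly
  -- when `Θ β` is the constant curve `z`.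
  let Θ : C(K, Z) → C(K, Z) := fun β => β - pathPrimitive Z ε (g.comp β)
  have hΘs : ContDiff ℝ ∞ Θ := by
    refine contDiff_id.sub ((pathPrimitive Z ε).contDiff.comp ?_)
    exact contDiff_infty.2 fun k => contDiff_continuousMap_comp k g hg hgc
  -- Neumann series. Invertibility at every `β`, and not only at the stationary curve, makes the
  -- local inverse of `Θ` smooth on its whole domain.
  have hΘu : ∀ β, ∃ A : C(K, Z) ≃L[ℝ] C(K, Z),
      (A : C(K, Z) →L[ℝ] C(K, Z)) = ContinuousLinearMap.id ℝ _ - T β := fun β =>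
    ⟨ContinuousLinearEquiv.unitsEquiv ℝ _ (Units.oneSub (T β) (hT β)), by ext x; rfl⟩
  have hΘd : ∀ β, HasFDerivAt Θ (ContinuousLinearMap.id ℝ _ - T β) β := fun β => by
    refine (hasFDerivAt_id β).sub ?_
    exact (pathPrimitive Z ε).hasFDerivAt.comp β (hasFDerivAt_continuousMap_comp g g' hgg' hC β)
  let cst : Z →L[ℝ] C(K, Z) := LinearMap.mkContinuous
    { toFun := fun z => ContinuousMap.const K z
      map_add' := fun _ _ => rfl
      map_smul' := fun _ _ => rfl } 1 (fun z => by
        rw [one_mul]; exact (ContinuousMap.norm_le _ (norm_nonneg _)).2 fun t => le_rfl)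
  have hcst : ∀ z t, cst z t = z := fun _ _ => rfl
  obtain ⟨A₀, hA₀⟩ := hΘu (cst z₀)
  have hgz0 : g z₀ = 0 := by rw [hgf z₀ (Metric.mem_ball_self (half_pos hr)), hf0]
  have hΘ0 : Θ (cst z₀) = cst z₀ := by
    have : g.comp (cst z₀) = 0 := by ext t; exact hgz0
    simp only [Θ, this, map_zero, sub_zero]
  have hΘd0 : HasFDerivAt Θ (A₀ : C(K, Z) →L[ℝ] C(K, Z)) (cst z₀) := hA₀ ▸ hΘd _
  let Φ := hΘs.contDiffAt.toOpenPartialHomeomorph Θ hΘd0 (by simp)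
  have hΦ : ∀ β, Φ β = Θ β := fun β => rfl
  have hΦs : cst z₀ ∈ Φ.source :=
    hΘs.contDiffAt.mem_toOpenPartialHomeomorph_source hΘd0 (by simp)
  have hΦt : cst z₀ ∈ Φ.target := by
    have := Φ.map_source hΦs
    rwa [hΦ, hΘ0] at this
  have hΦsymm0 : Φ.symm (cst z₀) = cst z₀ := by
    have := Φ.left_inv hΦs
    rwa [hΦ, hΘ0] at this
  have hΦsmooth : ∀ y ∈ Φ.target, ContDiffAt ℝ ∞ Φ.symm y := fun y hy => by
    obtain ⟨A, hA⟩ := hΘu (Φ.symm y)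
    exact Φ.contDiffAt_symm hy (hA ▸ hΘd (Φ.symm y)) hΘs.contDiffAt
  -- Curves within `r / 2` of the stationary one only see the region where the cutoff is 1, so they
  -- are integral curves of `ε • f` itself.
  have hopen : IsOpen (Φ.target ∩ Φ.symm ⁻¹' Metric.ball (cst z₀) (r / 2)) :=
    Φ.symm.isOpen_inter_preimage Metric.isOpen_ball
  let α : Z → ℝ → Z := fun z t => Φ.symm (cst z) (projIcc (-1) 2 (by norm_num) t)
  have hproj1 : projIcc (-1 : ℝ) 2 (by norm_num) 1 = ⟨1, by norm_num, by norm_num⟩ :=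
    projIcc_of_mem _ ⟨by norm_num, by norm_num⟩
  let ev : C(K, Z) →L[ℝ] Z := LinearMap.mkContinuous
    { toFun := fun β => β (projIcc (-1) 2 (by norm_num) 1)
      map_add' := fun _ _ => rfl
      map_smul' := fun _ _ => rfl } 1 (fun β => by rw [one_mul]; exact β.norm_coe_le_norm _)
  refine ⟨cst ⁻¹' (Φ.target ∩ Φ.symm ⁻¹' Metric.ball (cst z₀) (r / 2)), α,
    hopen.preimage cst.continuous, ⟨hΦt, ?_⟩, ?_, ?_, ?_, ?_⟩
  · simp only [mem_preimage, hΦsymm0]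
    exact Metric.mem_ball_self (half_pos hr)
  · rintro z ⟨hz1, hz2⟩
    set β := Φ.symm (cst z) with hβ
    have hball : ∀ t, β t ∈ Metric.ball z₀ (r / 2) := fun t =>
      (ContinuousMap.dist_apply_le_dist (f := β) (g := cst z₀) t).trans_lt hz2
    have hint : ∀ t : K, β t = z + ε • ∫ s in (0 : ℝ)..t, g (β (projIcc (-1) 2 (by norm_num) s)) := by
      intro t
      have h1 : Θ β = cst z := Φ.right_inv hz1
      have h2 : Θ β t = z := by rw [h1, hcst]
      have h3 : Θ β t = β t - pathPrimitive Z ε (g.comp β) t := rfl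
      rw [h3, sub_eq_iff_eq_add] at h2
      rw [h2]; rfl
    have hcont : Continuous fun s : ℝ => g (β (projIcc (-1) 2 (by norm_num) s)) :=
      g.continuous.comp (β.continuous.comp continuous_projIcc)
    refine ⟨?_, fun t ht => ⟨?_, ?_⟩⟩
    · change β (projIcc (-1) 2 (by norm_num) 0) = z
      rw [projIcc_of_mem _ (⟨by norm_num, by norm_num⟩ : (0 : ℝ) ∈ Icc (-1 : ℝ) 2), hint]
      simp
    · exact interior_subset (hrO (Metric.ball_subset_closedBall
        (Metric.ball_subset_ball (by linarith) (hball _))))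
    · have h1 : HasDerivAt (fun t : ℝ => z + ε • ∫ s in (0 : ℝ)..t,
          g (β (projIcc (-1) 2 (by norm_num) s)))
          (ε • g (β (projIcc (-1) 2 (by norm_num) t))) t :=
        ((intervalIntegral.integral_hasDerivAt_right (hcont.intervalIntegrable _ _)
          hcont.stronglyMeasurable.stronglyMeasurableAtFilter hcont.continuousAt).const_smul
          ε).const_add z
      rw [hgf _ (hball _)] at h1
      refine h1.congr_of_eventuallyEq ?_
      filter_upwards [Ioo_mem_nhds ht.1 ht.2] with s hs
      change β (projIcc (-1) 2 (by norm_num) s) = _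
      rw [hint, projIcc_of_mem _ (⟨hs.1.le, hs.2.le⟩ : s ∈ Icc (-1 : ℝ) 2)]
  · intro z hz
    refine ContDiffAt.contDiffWithinAt ?_
    exact ev.contDiff.contDiffAt.comp z ((hΦsmooth _ hz.1).comp z cst.contDiff.contDiffAt)
  · change Φ.symm (cst z₀) _ = z₀
    rw [hΦsymm0, hcst]
  · have h0 : HasFDerivAt Φ (A₀ : C(K, Z) →L[ℝ] C(K, Z)) (Φ.symm (cst z₀)) := by
      rw [hΦsymm0]; exact hΘd0
    have h1 : HasFDerivAt Φ.symm (A₀.symm : C(K, Z) →L[ℝ] C(K, Z)) (cst z₀) :=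
      Φ.hasFDerivAt_symm hΦt h0
    have h2 : HasFDerivAt (fun z => α z 1)
        (ev.comp ((A₀.symm : C(K, Z) →L[ℝ] C(K, Z)).comp cst)) z₀ :=
      ev.hasFDerivAt.comp z₀ (h1.comp z₀ cst.hasFDerivAt)
    convert h2 using 1
    ext δ
    -- The solution of the linearized equation `Y' = ε • f' Y`, `Y 0 = δ`. Since `f'` squares to
    -- zero, the exponential series stops after the linear term.
    let Y : C(K, Z) := ⟨fun t => δ + (ε * (t : ℝ)) • f' δ, by fun_prop⟩
    have hY : A₀ Y = cst δ := by
      have h3 : A₀ Y = Y - T (cst z₀) Y := congr($hA₀ Y)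
      rw [h3]
      ext t
      have h4 : T (cst z₀) Y t = ε • ∫ s in (0 : ℝ)..t, g' z₀ (Y (projIcc (-1) 2 (by norm_num) s)) :=
        rfl
      have h5 : ∀ s, g' z₀ (Y s) = f' δ := fun s => by
        have h6 : f' (f' δ) = 0 := congr($hsq δ)
        rw [hg'0]
        change f' (δ + (ε * (s : ℝ)) • f' δ) = f' δ
        rw [map_add, map_smul, h6, smul_zero, add_zero]
      rw [ContinuousMap.sub_apply, h4, hcst]
      simp only [h5, intervalIntegral.integral_const, sub_zero]
      change δ + (ε * (t : ℝ)) • f' δ - _ = δ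
      rw [smul_smul, add_sub_cancel_right]
    have h7 : A₀.symm (cst δ) = Y := by rw [← hY, ContinuousLinearEquiv.symm_apply_apply]
    change δ + ε • f' δ = A₀.symm (cst δ) (projIcc (-1) 2 (by norm_num) 1)
    rw [h7, hproj1]
    change _ = δ + (ε * 1) • f' δ
    rw [mul_one]

end Flow

/-! ### Slices of a group action and induced orbifold structures -/

section Slices

variable {q : ℕ}
  {G : Type u} [Group G] [TopologicalSpace G] [ChartedSpace (EuclideanSpace ℝ (Fin q)) G]
  {B : Type*} [NormedAddCommGroup B] [NormedSpace ℝ B]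
  {EP : Type*} [NormedAddCommGroup EP] [NormedSpace ℝ EP] {HP : Type*} [TopologicalSpace HP]
  {I : ModelWithCorners ℝ EP HP} {P : Type*} [TopologicalSpace P] [ChartedSpace HP P]
  [MulAction G P]

/-- A smooth map `h` from an open set `W` to a `G`-manifold is a slice if `(a, z) ↦ a • h z` is a
local diffeomorphism. -/
structure IsSlice (q : ℕ) (G : Type*) [Group G] [TopologicalSpace G]
    [ChartedSpace (EuclideanSpace ℝ (Fin q)) G]
    {B : Type*} [NormedAddCommGroup B] [NormedSpace ℝ B]
    {EP : Type*} [NormedAddCommGroup EP] [NormedSpace ℝ EP] {HP : Type*} [TopologicalSpace HP]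
    (I : ModelWithCorners ℝ EP HP) {P : Type*} [TopologicalSpace P] [ChartedSpace HP P]
    [MulAction G P] (h : B → P) (W : Set B) : Prop where
  isOpen : IsOpen W
  contMDiffOn : ContMDiffOn 𝓘(ℝ, B) I ∞ h W
  isLocalDiffeomorphOn : IsLocalDiffeomorphOn ((𝓡 q).prod 𝓘(ℝ, B)) I ∞
    (fun y : G × B => y.1 • h y.2) (univ ×ˢ W)

/-- Applying the local inverse of `(b, z) ↦ b • h' z` to `h z` gives a pair `(α z, τ z)` with `h z =
α z • h' (τ z)`. The inverse of `τ` is obtained in the same way with the roles of the slices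
exchanged. -/
theorem IsSlice.exists_transition [LieGroup (𝓡 q) ∞ G] {h h' : B → P} {W W' : Set B}
    (hs : IsSlice q G I h W) (hs' : IsSlice q G I h' W') {w w' : B} (hw : w ∈ W) (hw' : w' ∈ W')
    {a : G} (hww' : h w = a • h' w') :
    ∃ (τ : OpenPartialHomeomorph B B) (α : B → G), IsDiffeoWithin τ W W' ∧ w ∈ τ.source ∧
      τ w = w' ∧ ContMDiffOn 𝓘(ℝ, B) (𝓡 q) ∞ α τ.source ∧
      ∀ z ∈ τ.source, h z = α z • h' (τ z) := by
  have := topologicalGroup_of_lieGroup (𝓡 q) ∞ (G := G)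
  -- The base points are matched: `a⁻¹ • h w = h' w'` and `a • h' w' = h w`, so each local inverse
  -- is defined at the center of the other slice.
  obtain ⟨Φ, hΦ, hΦe⟩ := hs.isLocalDiffeomorphOn ⟨(a⁻¹, w), trivial, hw⟩
  obtain ⟨Φ', hΦ', hΦe'⟩ := hs'.isLocalDiffeomorphOn ⟨(a, w'), trivial, hw'⟩
  have key : ∀ {Φ₁ Φ₂ : PartialDiffeomorph ((𝓡 q).prod 𝓘(ℝ, B)) I (G × B) P ∞} {h₁ h₂ : B → P}
      {W₁ W₂ : Set B}, EqOn (fun y : G × B => y.1 • h₁ y.2) Φ₁ Φ₁.source →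
      EqOn (fun y : G × B => y.1 • h₂ y.2) Φ₂ Φ₂.source → ∀ z ∈ W₁, h₁ z ∈ Φ₂.target →
      (Φ₂.symm (h₁ z)).2 ∈ W₂ → ((Φ₂.symm (h₁ z)).1⁻¹, z) ∈ Φ₁.source →
      h₁ z = (Φ₂.symm (h₁ z)).1 • h₂ (Φ₂.symm (h₁ z)).2 ∧
      (Φ₂.symm (h₁ z)).2 ∈ W₂ ∧ h₂ (Φ₂.symm (h₁ z)).2 ∈ Φ₁.target ∧
      Φ₁.symm (h₂ (Φ₂.symm (h₁ z)).2) = ((Φ₂.symm (h₁ z)).1⁻¹, z) ∧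
      ((Φ₁.symm (h₂ (Φ₂.symm (h₁ z)).2)).1⁻¹, (Φ₂.symm (h₁ z)).2) ∈ Φ₂.source := by
    intro Φ₁ Φ₂ h₁ h₂ W₁ W₂ e₁ e₂ z hz hzt hz2 hzs
    have hmem : Φ₂.symm (h₁ z) ∈ Φ₂.source := Φ₂.map_target hzt
    have h1 : (Φ₂.symm (h₁ z)).1 • h₂ (Φ₂.symm (h₁ z)).2 = h₁ z :=
      (e₂ hmem).trans (Φ₂.right_inv hzt)
    have h2 : h₂ (Φ₂.symm (h₁ z)).2 = Φ₁ ((Φ₂.symm (h₁ z)).1⁻¹, z) := by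
      rw [← e₁ hzs]
      exact (inv_smul_eq_iff.2 h1.symm).symm
    have h3 : Φ₁.symm (h₂ (Φ₂.symm (h₁ z)).2) = ((Φ₂.symm (h₁ z)).1⁻¹, z) := by
      rw [h2]; exact Φ₁.left_inv hzs
    refine ⟨h1.symm, hz2, h2 ▸ Φ₁.map_source hzs, h3, ?_⟩
    rw [h3, inv_inv]; exact hmem
  have hopen : ∀ {Φ₁ Φ₂ : PartialDiffeomorph ((𝓡 q).prod 𝓘(ℝ, B)) I (G × B) P ∞} {h₁ : B → P}
      {W₁ W₂ : Set B}, IsOpen W₁ → IsOpen W₂ → ContMDiffOn 𝓘(ℝ, B) I ∞ h₁ W₁ →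
      IsOpen {z | z ∈ W₁ ∧ h₁ z ∈ Φ₂.target ∧ (Φ₂.symm (h₁ z)).2 ∈ W₂ ∧
        ((Φ₂.symm (h₁ z)).1⁻¹, z) ∈ Φ₁.source} ∧
      ContMDiffOn 𝓘(ℝ, B) ((𝓡 q).prod 𝓘(ℝ, B)) ∞ (fun z => Φ₂.symm (h₁ z))
        (W₁ ∩ h₁ ⁻¹' Φ₂.target) := by
    intro Φ₁ Φ₂ h₁ W₁ W₂ hW₁ hW₂ hh
    have hsm : ContMDiffOn 𝓘(ℝ, B) ((𝓡 q).prod 𝓘(ℝ, B)) ∞ (fun z => Φ₂.symm (h₁ z))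
        (W₁ ∩ h₁ ⁻¹' Φ₂.target) :=
      Φ₂.symm.contMDiffOn.comp (hh.mono inter_subset_left) inter_subset_right
    have ho : IsOpen (W₁ ∩ h₁ ⁻¹' Φ₂.target) := hh.continuousOn.isOpen_inter_preimage hW₁ Φ₂.open_target
    refine ⟨?_, hsm⟩
    have hc : ContinuousOn (fun z => ((Φ₂.symm (h₁ z)).2, ((Φ₂.symm (h₁ z)).1⁻¹, z)))
        (W₁ ∩ h₁ ⁻¹' Φ₂.target) :=
      hsm.continuousOn.snd.prodMk (hsm.continuousOn.fst.inv.prodMk continuousOn_id)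
    have := hc.isOpen_inter_preimage ho (hW₂.prod Φ₁.open_source)
    convert this using 1
    ext z
    simp only [mem_ofPred_eq, mem_inter_iff, mem_preimage, mem_prod]
    tauto
  have o1 := hopen (Φ₁ := Φ) (Φ₂ := Φ') hs.isOpen hs'.isOpen hs.contMDiffOn
  have o2 := hopen (Φ₁ := Φ') (Φ₂ := Φ) hs'.isOpen hs.isOpen hs'.contMDiffOn
  have hsm1 := o1.2.mono (t := {z | z ∈ W ∧ h z ∈ Φ'.target ∧ (Φ'.symm (h z)).2 ∈ W' ∧
        ((Φ'.symm (h z)).1⁻¹, z) ∈ Φ.source}) fun z hz => ⟨hz.1, hz.2.1⟩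
  have hsm2 := o2.2.mono (t := {z | z ∈ W' ∧ h' z ∈ Φ.target ∧ (Φ.symm (h' z)).2 ∈ W ∧
        ((Φ.symm (h' z)).1⁻¹, z) ∈ Φ'.source}) fun z hz => ⟨hz.1, hz.2.1⟩
  have hΦ'w : Φ' (a, w') = h w := by rw [hww']; exact (hΦe' hΦ').symm
  have hsymm : Φ'.symm (h w) = (a, w') := by rw [← hΦ'w]; exact Φ'.left_inv hΦ'
  -- The last condition in `source` and in `target` says that the reverse transition uses the
  -- inverse group element; with it the two conditions correspond under the map and the two maps are
  -- mutually inverse.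
  refine ⟨{ toFun := fun z => (Φ'.symm (h z)).2
            invFun := fun z => (Φ.symm (h' z)).2
            source := {z | z ∈ W ∧ h z ∈ Φ'.target ∧ (Φ'.symm (h z)).2 ∈ W' ∧
              ((Φ'.symm (h z)).1⁻¹, z) ∈ Φ.source}
            target := {z | z ∈ W' ∧ h' z ∈ Φ.target ∧ (Φ.symm (h' z)).2 ∈ W ∧
              ((Φ.symm (h' z)).1⁻¹, z) ∈ Φ'.source}
            map_source' := ?_
            map_target' := ?_
            left_inv' := ?_
            right_inv' := ?_
            open_source := o1.1
            open_target := o2.1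
            continuousOn_toFun := hsm1.continuousOn.snd
            continuousOn_invFun := hsm2.continuousOn.snd },
    fun z => (Φ'.symm (h z)).1, ⟨fun z hz => hz.1, fun z hz => hz.1, ?_, ?_⟩, ⟨hw, ?_, ?_, ?_⟩,
    ?_, contMDiff_fst.comp_contMDiffOn hsm1, ?_⟩
  · rintro z ⟨h1, h2, h3, h4⟩
    obtain ⟨-, k2, k3, k4, k5⟩ := key hΦe hΦe' z h1 h2 h3 h4
    exact ⟨k2, k3, by rw [k4]; exact h1, k5⟩
  · rintro z ⟨h1, h2, h3, h4⟩
    obtain ⟨-, k2, k3, k4, k5⟩ := key hΦe' hΦe z h1 h2 h3 h4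
    exact ⟨k2, k3, by rw [k4]; exact h1, k5⟩
  · rintro z ⟨h1, h2, h3, h4⟩
    obtain ⟨-, -, -, k4, -⟩ := key hΦe hΦe' z h1 h2 h3 h4
    exact congrArg Prod.snd k4
  · rintro z ⟨h1, h2, h3, h4⟩
    obtain ⟨-, -, -, k4, -⟩ := key hΦe' hΦe z h1 h2 h3 h4
    exact congrArg Prod.snd k4
  · exact contMDiffOn_iff_contDiffOn.1 (contMDiff_snd.comp_contMDiffOn hsm1)
  · exact contMDiffOn_iff_contDiffOn.1 (contMDiff_snd.comp_contMDiffOn hsm2)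
  · rw [← hΦ'w]; exact Φ'.map_source hΦ'
  · rw [hsymm]; exact hw'
  · rw [hsymm]; exact hΦ
  · exact congrArg Prod.snd hsymm
  · rintro z ⟨h1, h2, h3, h4⟩
    exact (key hΦe hΦe' z h1 h2 h3 h4).1

/-- Slices are preserved by reparametrization through a local diffeomorphism of the model space. -/
lemma IsSlice.comp {h : B → P} {W W' : Set B} (hs : IsSlice q G I h W)
    {τ : OpenPartialHomeomorph B B} (hτ : IsDiffeoWithin τ W' W) :
    IsSlice q G I (h ∘ τ) τ.source := by
  obtain ⟨h1, h2, h3, h4⟩ := hτ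
  have hm : MapsTo τ τ.source W := fun z hz => h2 (τ.map_source hz)
  refine ⟨τ.open_source, hs.contMDiffOn.comp (contMDiffOn_iff_contDiffOn.2 h3) hm, ?_⟩
  rintro ⟨⟨a, z⟩, -, hz⟩
  have hloc : IsLocalDiffeomorphAt ((𝓡 q).prod 𝓘(ℝ, B)) ((𝓡 q).prod 𝓘(ℝ, B)) ∞
      (Prod.map id τ : G × B → G × B) (a, z) := by
    refine ⟨⟨((OpenPartialHomeomorph.refl G).prod τ).toPartialEquiv,
      ((OpenPartialHomeomorph.refl G).prod τ).open_source,
      ((OpenPartialHomeomorph.refl G).prod τ).open_target, ?_, ?_⟩, ⟨trivial, hz⟩, fun y _ => rfl⟩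
    · exact contMDiffOn_id.prodMap (contMDiffOn_iff_contDiffOn.2 h3)
    · exact contMDiffOn_id.prodMap (contMDiffOn_iff_contDiffOn.2 h4)
  exact hloc.comp I P (g := fun y : G × B => y.1 • h y.2)
    (hs.isLocalDiffeomorphOn ⟨(a, τ z), trivial, hm hz⟩)

/-- A map to the orbit space that lifts to a slice near every point of `S`. -/
def IsInducedBySlices (q : ℕ) (G : Type*) [Group G] [TopologicalSpace G]
    [ChartedSpace (EuclideanSpace ℝ (Fin q)) G]
    {B : Type*} [NormedAddCommGroup B] [NormedSpace ℝ B]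
    {EP : Type*} [NormedAddCommGroup EP] [NormedSpace ℝ EP] {HP : Type*} [TopologicalSpace HP]
    (I : ModelWithCorners ℝ EP HP) {P : Type*} [TopologicalSpace P] [ChartedSpace HP P]
    [MulAction G P] (p : B → MulAction.orbitRel.Quotient G P) (S : Set B) : Prop :=
  ∀ w ∈ S, ∃ (W : Set B) (h : B → P), w ∈ W ∧ W ⊆ S ∧ IsSlice q G I h W ∧
    ∀ z ∈ W, p z = Quotient.mk _ (h z)

lemma OrbifoldChart.exists_proj_eq {Γ : Type u} [Group Γ] [Finite Γ] {X : Type*}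
    [TopologicalSpace X] (c : OrbifoldChart Γ B X) {x : X} (hx : x ∈ c.target) :
    ∃ w ∈ c.source, c.proj w = x := by
  obtain ⟨⟨w, hw⟩, h⟩ := c.proj_isQuotientMap.surjective ⟨x, hx⟩
  exact ⟨w, hw, congrArg Subtype.val h⟩

variable {Γ Γ' : Type u} [Group Γ] [Finite Γ] [Group Γ'] [Finite Γ']
  {c : OrbifoldChart Γ B (MulAction.orbitRel.Quotient G P)}
  {c' : OrbifoldChart Γ' B (MulAction.orbitRel.Quotient G P)}

/-- Points with the same image have lifts in one orbit, so the slices differ by a transition `τ` and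
a factor `α` in `G`; passing to orbits removes `α`. -/
lemma IsInducedBySlices.compatible [LieGroup (𝓡 q) ∞ G]
    (hc : IsInducedBySlices q G I c.proj c.source) (hc' : IsInducedBySlices q G I c'.proj c'.source) :
    c.Compatible c' := by
  intro w hw w' hw' hww'
  obtain ⟨W, h, hwW, hWs, hs, hπ⟩ := hc w hw
  obtain ⟨W', h', hwW', hWs', hs', hπ'⟩ := hc' w' hw'
  rw [hπ w hwW, hπ' w' hwW'] at hww'
  obtain ⟨a, ha⟩ := Quotient.exact hww'
  obtain ⟨τ, α, hτ, h1, h2, h3, h4⟩ := hs.exists_transition hs' hwW hwW' (a := a) ha.symm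
  refine ⟨τ, ⟨hτ.1.trans hWs, hτ.2.1.trans hWs', hτ.2.2⟩, h1, h2, fun z hz => ?_⟩
  rw [hπ z (hτ.1 hz), hπ' _ (hτ.2.1 (τ.map_source hz)), h4 z hz]
  exact Quotient.sound' ⟨(α z)⁻¹, by simp⟩

/-- A chart that is compatible with enough induced charts is induced. -/
lemma IsInducedBySlices.of_compatible
    (h : ∀ w ∈ c.source, ∃ (Γ' : Type u) (_ : Group Γ') (_ : Finite Γ')
      (c' : OrbifoldChart Γ' B (MulAction.orbitRel.Quotient G P)),
      IsInducedBySlices q G I c'.proj c'.source ∧ c.proj w ∈ c'.target ∧ c.Compatible c') :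
    IsInducedBySlices q G I c.proj c.source := by
  intro w hw
  obtain ⟨Γ', _, _, c', hc', hw', hcomp⟩ := h w hw
  obtain ⟨w', hw', hww'⟩ := c'.exists_proj_eq hw'
  obtain ⟨τ, hτ, h1, rfl, h3⟩ := hcomp w hw w' hw' hww'.symm
  obtain ⟨W', h', hwW', hWs', hs', hπ'⟩ := hc' _ hw'
  -- The transition is cut down so that it takes values where `c'` has a lift; composing that lift
  -- with it lifts `c`.
  let τ' := τ.trans (OpenPartialHomeomorph.ofSet W' hs'.isOpen)
  have hsrc : ∀ z, z ∈ τ'.source ↔ z ∈ τ.source ∧ τ z ∈ W' := fun z => by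
    simp [τ']
  have hd : IsDiffeoWithin τ' c.source W' := by
    refine ⟨fun z hz => hτ.1 ((hsrc z).1 hz).1, fun z hz => ?_,
      hτ.2.2.1.mono fun z hz => ((hsrc z).1 hz).1, hτ.2.2.2.mono fun z hz => ?_⟩
    · simp only [τ', OpenPartialHomeomorph.trans_target, OpenPartialHomeomorph.ofSet_target] at hz
      exact hz.1
    · have : z ∈ W' ∩ τ.target := by
        simpa [τ', OpenPartialHomeomorph.trans_target] using hz
      exact this.2
  refine ⟨τ'.source, h' ∘ τ', (hsrc w).2 ⟨h1, hwW'⟩, hd.1, hs'.comp hd, fun z hz => ?_⟩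
  have hz' := (hsrc z).1 hz
  rw [← h3 z hz'.1]
  exact hπ' _ hz'.2

end Slices

/-! ### Orbifold structures on orbit spaces formed by charts that lift to slices -/

section InducedStructure

variable {q : ℕ}
  {G : Type u} [Group G] [TopologicalSpace G] [ChartedSpace (EuclideanSpace ℝ (Fin q)) G]
  [LieGroup (𝓡 q) ∞ G]
  {B : Type*} [NormedAddCommGroup B] [NormedSpace ℝ B]
  {EP : Type*} [NormedAddCommGroup EP] [NormedSpace ℝ EP] {HP : Type*} [TopologicalSpace HP]
  {I : ModelWithCorners ℝ EP HP} {P : Type*} [TopologicalSpace P] [ChartedSpace HP P]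
  [MulAction G P]

/-- The orbit space of a continuous action of a compact group on a Hausdorff space is Hausdorff. -/
lemma t2Space_orbitRel_quotient {G : Type*} [Group G] [TopologicalSpace G] [IsTopologicalGroup G]
    [CompactSpace G] {P : Type*} [TopologicalSpace P] [T2Space P] [MulAction G P]
    [ContinuousSMul G P] : T2Space (MulAction.orbitRel.Quotient G P) := by
  -- The graph of the action is a closed subset of `G × (P × P)`, and forgetting the compact factor
  -- `G` is a proper map.
  have hp : ProperSMul G P := ⟨by
    have h1 : IsClosedEmbedding fun y : G × P => (y.1, (y.1 • y.2, y.2)) := by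
      refine IsClosedEmbedding.of_continuous_injective_isClosedMap (by fun_prop) ?_ ?_
      · rintro ⟨a, x⟩ ⟨b, y⟩ h
        simp only [Prod.mk.injEq] at h
        exact Prod.ext h.1 h.2.2
      · intro s hs
        have : (fun y : G × P => (y.1, (y.1 • y.2, y.2))) '' s =
            {y : G × (P × P) | y.1 • y.2.2 = y.2.1} ∩ (fun y => (y.1, y.2.2)) ⁻¹' s := by
          ext ⟨a, x, y⟩
          constructor
          · rintro ⟨⟨b, z⟩, hz, h⟩
            simp only [Prod.mk.injEq] at h
            obtain ⟨rfl, rfl, rfl⟩ := h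
            exact ⟨rfl, hz⟩
          · rintro ⟨h1, h2⟩
            exact ⟨(a, y), h2, Prod.ext rfl (Prod.ext h1 rfl)⟩
        rw [this]
        exact (isClosed_eq (by fun_prop) (by fun_prop)).inter (hs.preimage (by fun_prop))
    exact (isProperMap_snd_of_compactSpace (X := G) (Y := P × P)).comp h1.isProperMap⟩
  exact t2Space_quotient_mulAction_of_properSMul

/-- The orbifold structure of an orbit space whose charts are those induced by slices. -/
noncomputable def inducedOrbifoldStructure (q : ℕ)
    (G : Type u) [Group G] [TopologicalSpace G] [ChartedSpace (EuclideanSpace ℝ (Fin q)) G]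
    [LieGroup (𝓡 q) ∞ G] (B : Type*) [NormedAddCommGroup B] [NormedSpace ℝ B]
    {EP : Type*} [NormedAddCommGroup EP] [NormedSpace ℝ EP] {HP : Type*} [TopologicalSpace HP]
    (I : ModelWithCorners ℝ EP HP) (P : Type*) [TopologicalSpace P] [ChartedSpace HP P]
    [MulAction G P] (ht2 : T2Space (MulAction.orbitRel.Quotient G P))
    (hcov : ∀ x : MulAction.orbitRel.Quotient G P, ∃ (Γ : Type u) (_ : Group Γ) (_ : Finite Γ)
      (c : OrbifoldChart Γ B (MulAction.orbitRel.Quotient G P)),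
      IsInducedBySlices q G I c.proj c.source ∧ x ∈ c.target) :
    OrbifoldStructure.{u} B (MulAction.orbitRel.Quotient G P) where
  IsChart _ _ _ c := IsInducedBySlices q G I c.proj c.source
  t2 := ht2
  compatible _ _ _ _ _ _ _ _ hc hc' := hc.compatible hc'
  cover := hcov
  maximal Γ _ _ c h := IsInducedBySlices.of_compatible fun w hw => by
    obtain ⟨Γ', i1, i2, c', hc', hx⟩ := hcov (c.proj w)
    exact ⟨Γ', i1, i2, c', hc', hx, (h Γ' c' hc').1⟩

/-- An orbifold structure on an orbit space that contains enough induced charts consists of all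
induced charts. -/
lemma OrbifoldStructure.isChart_iff_isInducedBySlices
    (S : OrbifoldStructure.{u} B (MulAction.orbitRel.Quotient G P))
    (hS : ∀ x : MulAction.orbitRel.Quotient G P, ∃ (Γ : Type u) (_ : Group Γ) (_ : Finite Γ)
      (c : OrbifoldChart Γ B (MulAction.orbitRel.Quotient G P)),
      S.IsChart Γ c ∧ IsInducedBySlices q G I c.proj c.source ∧ x ∈ c.target)
    (Γ : Type u) [Group Γ] [Finite Γ] (c : OrbifoldChart Γ B (MulAction.orbitRel.Quotient G P)) :
    S.IsChart Γ c ↔ IsInducedBySlices q G I c.proj c.source := by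
  have key : ∀ (Γ : Type u) [Group Γ] [Finite Γ]
      (c : OrbifoldChart Γ B (MulAction.orbitRel.Quotient G P)), S.IsChart Γ c →
      IsInducedBySlices q G I c.proj c.source := fun Γ _ _ c hc =>
    IsInducedBySlices.of_compatible fun w hw => by
      obtain ⟨Γ', i1, i2, c', hc', hc'', hx⟩ := hS (c.proj w)
      exact ⟨Γ', i1, i2, c', hc'', hx, S.compatible _ _ _ _ hc hc'⟩
  exact ⟨key Γ c, fun hc => S.maximal Γ c fun Γ' _ _ c' hc' =>
    ⟨hc.compatible (key Γ' c' hc'), (key Γ' c' hc').compatible hc⟩⟩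

end InducedStructure

/-! ### Slices in the total space of an equivariant vector bundle -/

section BundleSlices

variable {𝕜 : Type*} [RCLike 𝕜] {q : ℕ}
  {G : Type u} [Group G] [TopologicalSpace G] [ChartedSpace (EuclideanSpace ℝ (Fin q)) G]
  {B : Type*} [NormedAddCommGroup B] [NormedSpace ℝ B]
  {EM : Type*} [NormedAddCommGroup EM] [NormedSpace ℝ EM] {HM : Type*} [TopologicalSpace HM]
  {I : ModelWithCorners ℝ EM HM} {M : Type*} [TopologicalSpace M] [ChartedSpace HM M]
  {F : Type*} [NormedAddCommGroup F] [NormedSpace ℝ F] [NormedSpace 𝕜 F] [IsScalarTower ℝ 𝕜 F]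
  [FiniteDimensional ℝ F]
  {E : M → Type*} [TopologicalSpace (TotalSpace F E)]
  [∀ x, AddCommGroup (E x)] [∀ x, Module ℝ (E x)] [∀ x, Module 𝕜 (E x)]
  [∀ x, IsScalarTower ℝ 𝕜 (E x)] [∀ x, TopologicalSpace (E x)]
  [FiberBundle F E] [VectorBundle ℝ F E] [ContMDiffVectorBundle ∞ F E I]

/-- A smooth family of linear isomorphisms onto fibers of a vector bundle has a smooth family of
inverses. -/
lemma exists_contMDiffOn_fiber_inverse {h : B → M} {H : B × F → TotalSpace F E} {W : Set B}
    (hW : IsOpen W) (hh : ContMDiffOn 𝓘(ℝ, B) I ∞ h W)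
    (hH : ContMDiffOn (𝓘(ℝ, B).prod 𝓘(ℝ, F)) (I.prod 𝓘(ℝ, F)) ∞ H (W ×ˢ univ))
    (hL : ∀ z ∈ W, ∃ L : F ≃ₗ[𝕜] E (h z), ∀ v, H (z, v) = ⟨h z, L v⟩) {w : B} (hw : w ∈ W) :
    ∃ (W₀ : Set B) (R : B × TotalSpace F E → F), IsOpen W₀ ∧ w ∈ W₀ ∧ W₀ ⊆ W ∧
      ContMDiffOn (𝓘(ℝ, B).prod (I.prod 𝓘(ℝ, F))) 𝓘(ℝ, F) ∞ R
        (W₀ ×ˢ (trivializationAt F E (h w)).source) ∧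
      ∀ z ∈ W₀, h z ∈ (trivializationAt F E (h w)).baseSet ∧ ∀ v, R (z, H (z, v)) = v := by
  set e := trivializationAt F E (h w)
  set W₀ := W ∩ h ⁻¹' e.baseSet
  have hW₀ : IsOpen W₀ := hh.continuousOn.isOpen_inter_preimage hW e.open_baseSet
  have hwW₀ : w ∈ W₀ := ⟨hw, mem_baseSet_trivializationAt F E (h w)⟩
  have hA : ∀ z, ∃ A : F ≃L[ℝ] F, z ∈ W₀ → ∀ v, A v = (e (H (z, v))).2 := by
    intro z
    by_cases hz : z ∈ W₀
    · obtain ⟨L, hL⟩ := hL z hz.1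
      let A := (L.restrictScalars ℝ).trans (e.linearEquivAt ℝ (h z) hz.2)
      refine ⟨A.toContinuousLinearEquiv, fun _ v => ?_⟩
      rw [hL]; rfl
    · exact ⟨ContinuousLinearEquiv.refl ℝ F, fun h => (hz h).elim⟩
  choose A hA using hA
  have hproj : ∀ z ∈ W, ∀ v, (H (z, v)).proj = h z := fun z hz v => by
    obtain ⟨L, hL⟩ := hL z hz
    rw [hL]
  have hsm : ContMDiffOn (𝓘(ℝ, B).prod 𝓘(ℝ, F)) 𝓘(ℝ, F) ∞ (fun y => (e (H y)).2)
      (W₀ ×ˢ univ) := by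
    refine contMDiff_snd.comp_contMDiffOn ((e.contMDiffOn (n := ∞) (IB := I)).comp
      (hH.mono (prod_mono inter_subset_left Subset.rfl)) fun y hy => ?_)
    rw [mem_preimage, e.mem_source, ← Prod.mk.eta (p := y), hproj _ hy.1.1]
    exact hy.1.2
  -- As `F` is finite-dimensional, smoothness of a family of operators can be tested on single
  -- vectors; smoothness of the inverses then follows from that of operator inversion.
  have hA1 : ContDiffOn ℝ ∞ (fun z => (A z : F →L[ℝ] F)) W₀ := by
    rw [contDiffOn_clm_apply]
    intro v
    have h1 : ContMDiffOn 𝓘(ℝ, B) (𝓘(ℝ, B).prod 𝓘(ℝ, F)) ∞ (fun z : B => (z, v)) W₀ :=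
      contMDiffOn_id.prodMk contMDiffOn_const
    refine (contMDiffOn_iff_contDiffOn.1 (hsm.comp h1 fun z hz => ⟨hz, trivial⟩)).congr ?_
    intro z hz
    exact hA z hz v
  have hA2 : ContDiffOn ℝ ∞ (fun z => ((A z).symm : F →L[ℝ] F)) W₀ := by
    intro z hz
    have h1 := (contDiffAt_map_inverse (n := ∞) (A z)).comp z (hA1.contDiffAt (hW₀.mem_nhds hz))
    refine ContDiffAt.contDiffWithinAt (h1.congr_of_eventuallyEq (Filter.Eventually.of_forall ?_))
    intro y
    exact (ContinuousLinearMap.inverse_equiv (A y)).symm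
  refine ⟨W₀, fun y => (A y.1).symm (e y.2).2, hW₀, hwW₀, inter_subset_left, ?_,
    fun z hz => ⟨hz.2, fun v => ?_⟩⟩
  · have h1 : ContMDiffOn (𝓘(ℝ, B).prod (I.prod 𝓘(ℝ, F))) 𝓘(ℝ, F →L[ℝ] F) ∞
        (fun y : B × TotalSpace F E => ((A y.1).symm : F →L[ℝ] F)) (W₀ ×ˢ e.source) :=
      (contMDiffOn_iff_contDiffOn.2 hA2).comp contMDiff_fst.contMDiffOn fun y hy => hy.1
    have h2 : ContMDiffOn (𝓘(ℝ, B).prod (I.prod 𝓘(ℝ, F))) 𝓘(ℝ, F) ∞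
        (fun y : B × TotalSpace F E => (e y.2).2) (W₀ ×ˢ e.source) :=
      contMDiff_snd.comp_contMDiffOn ((e.contMDiffOn (n := ∞) (IB := I)).comp
        contMDiff_snd.contMDiffOn fun y hy => hy.2)
    exact h1.clm_apply h2
  · change (A z).symm (e (H (z, v))).2 = v
    rw [← hA z hz, ContinuousLinearEquiv.symm_apply_apply]

variable [MulAction G M] [MulAction G (TotalSpace F E)]

lemma proj_smul (𝕜 : Type*) [RCLike 𝕜] {M : Type*} {F : Type*} {E : M → Type*}
    [∀ x, AddCommGroup (E x)] [∀ x, Module 𝕜 (E x)] {G : Type*} [Group G] [MulAction G M]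
    [MulAction G (TotalSpace F E)] [IsVectorBundleAction (F := F) (E := E) 𝕜 G]
    (a : G) (Z : TotalSpace F E) : (a • Z).proj = a • Z.proj := by
  obtain ⟨L, hL⟩ := IsVectorBundleAction.exists_linear (F := F) (E := E) (𝕜 := 𝕜) a Z.proj
  rw [show Z = ⟨Z.proj, Z.2⟩ from rfl, hL]

variable [LieGroup (𝓡 q) ∞ G]
  [ContMDiffSMul (𝓡 q) (I.prod 𝓘(ℝ, F)) ∞ G (TotalSpace F E)]
  [IsVectorBundleAction (F := F) (E := E) 𝕜 G]

/-- A smooth bundle map that is isomorphic on fibers and covers a slice is a slice. -/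
lemma IsSlice.total {h : B → M} {H : B × F → TotalSpace F E} {W : Set B}
    (hs : IsSlice q G I h W)
    (hH : ContMDiffOn (𝓘(ℝ, B).prod 𝓘(ℝ, F)) (I.prod 𝓘(ℝ, F)) ∞ H (W ×ˢ univ))
    (hL : ∀ z ∈ W, ∃ L : F ≃ₗ[𝕜] E (h z), ∀ v, H (z, v) = ⟨h z, L v⟩) :
    IsSlice q G (I.prod 𝓘(ℝ, F)) H (W ×ˢ univ) := by
  have := topologicalGroup_of_lieGroup (𝓡 q) ∞ (G := G)
  have hproj : ∀ z ∈ W, ∀ v, (H (z, v)).proj = h z := fun z hz v => by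
    obtain ⟨L, hL⟩ := hL z hz
    rw [hL]
  have hHinj : ∀ z ∈ W, ∀ Z : TotalSpace F E, Z.proj = h z → ∃ v, H (z, v) = Z := by
    rintro z hz ⟨x, Z⟩ rfl
    obtain ⟨L, hL⟩ := hL z hz
    exact ⟨L.symm Z, by rw [hL, L.apply_symm_apply]⟩
  suffices hloc : IsLocalDiffeomorphOn ((𝓡 q).prod (𝓘(ℝ, B).prod 𝓘(ℝ, F))) (I.prod 𝓘(ℝ, F)) ∞
      (fun y : G × B × F => y.1 • H y.2) (univ ×ˢ (W ×ˢ univ)) by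
    refine ⟨hs.isOpen.prod isOpen_univ, ?_, ?_⟩
    · rw [modelWithCornersSelf_prod, ← chartedSpaceSelf_prod]; exact hH
    · rw [modelWithCornersSelf_prod, ← chartedSpaceSelf_prod]; exact hloc
  rintro ⟨⟨a, z, v⟩, -, hz, -⟩
  obtain ⟨W₀, R, hW₀, hzW₀, hsub, hR, hR'⟩ :=
    exists_contMDiffOn_fiber_inverse hs.isOpen hs.contMDiffOn hH hL hz
  obtain ⟨Φ, hΦ, hΦe⟩ := hs.isLocalDiffeomorphOn ⟨(a, z), trivial, hz⟩
  have hopen : IsOpen (Φ.source ∩ univ ×ˢ W₀) := Φ.open_source.inter (isOpen_univ.prod hW₀)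
  let T := Φ.target ∩ Φ.symm ⁻¹' (univ ×ˢ W₀)
  have hT : IsOpen T :=
    Φ.symm.contMDiffOn.continuousOn.isOpen_inter_preimage Φ.open_target (isOpen_univ.prod hW₀)
  have hΦT : ∀ x ∈ T, (Φ.symm x).1 • h (Φ.symm x).2 = x := fun x hx => by
    have h1 := hΦe (Φ.map_target hx.1)
    exact h1.trans (Φ.right_inv hx.1)
  have hinv : ∀ x ∈ T, (Φ.symm x).1⁻¹ • x = h (Φ.symm x).2 := fun x hx => by
    rw [inv_smul_eq_iff, hΦT x hx]
  have hsymm : ContMDiffOn (I.prod 𝓘(ℝ, F)) ((𝓡 q).prod 𝓘(ℝ, B)) ∞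
      (fun Z : TotalSpace F E => Φ.symm Z.proj) (TotalSpace.proj ⁻¹' T) :=
    Φ.symm.contMDiffOn.comp (contMDiff_proj E).contMDiffOn fun Z hZ => hZ.1
  -- The inverse reads `(b, z)` off the base point of `Z`, moves `Z` by `b⁻¹` into the fiber over
  -- the slice, and finds its coordinate there by `R`.
  refine ⟨⟨⟨fun y => y.1 • H y.2,
    fun Z => ((Φ.symm Z.proj).1, ((Φ.symm Z.proj).2,
      R ((Φ.symm Z.proj).2, (Φ.symm Z.proj).1⁻¹ • Z))),
    {y | (y.1, y.2.1) ∈ Φ.source ∩ univ ×ˢ W₀}, TotalSpace.proj ⁻¹' T, ?_, ?_, ?_, ?_⟩,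
    ?_, ?_, ?_, ?_⟩, ⟨hΦ, trivial, hzW₀⟩, fun y _ => rfl⟩
  · rintro ⟨b, y, u⟩ ⟨hy, -, hyW⟩
    have h1 : (b • H (y, u)).proj = Φ (b, y) := by
      rw [proj_smul 𝕜, hproj y (hsub hyW)]
      exact hΦe hy
    rw [mem_preimage, h1]
    refine ⟨Φ.map_source hy, ?_⟩
    rw [mem_preimage, show Φ.symm (Φ (b, y)) = (b, y) from Φ.left_inv hy]
    exact ⟨trivial, hyW⟩
  · rintro Z ⟨h1, h2⟩
    exact ⟨Φ.map_target h1, h2⟩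
  · rintro ⟨b, y, u⟩ ⟨hy, -, hyW⟩
    have h1 : (b • H (y, u)).proj = Φ (b, y) := by
      rw [proj_smul 𝕜, hproj y (hsub hyW)]
      exact hΦe hy
    have h2 : Φ.symm (b • H (y, u)).proj = (b, y) := by rw [h1]; exact Φ.left_inv hy
    simp only [h2, inv_smul_smul]
    rw [(hR' y hyW).2]
  · rintro Z hZ
    have hzW : (Φ.symm Z.proj).2 ∈ W₀ := hZ.2.2
    obtain ⟨v, hv⟩ := hHinj _ (hsub hzW) ((Φ.symm Z.proj).1⁻¹ • Z)
      (by rw [proj_smul 𝕜]; exact hinv _ hZ)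
    change (Φ.symm Z.proj).1 • H ((Φ.symm Z.proj).2, R (_, (Φ.symm Z.proj).1⁻¹ • Z)) = Z
    rw [← hv, (hR' _ hzW).2, hv, smul_inv_smul]
  · exact hopen.preimage (continuous_fst.prodMk (continuous_fst.comp continuous_snd))
  · exact hT.preimage (FiberBundle.continuous_proj F E)
  · exact contMDiff_fst.contMDiffOn.smul (I := 𝓡 q) (hH.comp contMDiff_snd.contMDiffOn
      fun y hy => ⟨hsub hy.2.2, trivial⟩)
  · have h1 := contMDiff_fst.comp_contMDiffOn hsymm
    have h2 := contMDiff_snd.comp_contMDiffOn hsymm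
    refine h1.prodMk (h2.prodMk (hR.comp (h2.prodMk ((h1.inv).smul (I := 𝓡 q) contMDiffOn_id))
      fun Z hZ => ⟨hZ.2.2, ?_⟩))
    rw [Trivialization.mem_source]
    change ((Φ.symm Z.proj).1⁻¹ • Z).proj ∈ _
    rw [proj_smul 𝕜, hinv _ hZ]
    exact (hR' _ hZ.2.2).1

end BundleSlices

/-! ### The vector orbibundle structure of all locally induced charts -/

section CanonicalStructure

lemma contMDiffOn_prod_self_iff {B F F' : Type*} [NormedAddCommGroup B] [NormedSpace ℝ B]
    [NormedAddCommGroup F] [NormedSpace ℝ F] [NormedAddCommGroup F'] [NormedSpace ℝ F']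
    {m : WithTop ℕ∞} {f : B × F → F'} {s : Set (B × F)} :
    ContMDiffOn (𝓘(ℝ, B).prod 𝓘(ℝ, F)) 𝓘(ℝ, F') m f s ↔ ContDiffOn ℝ m f s := by
  rw [← contMDiffOn_iff_contDiffOn, modelWithCornersSelf_prod, ← chartedSpaceSelf_prod]

variable {𝕜 : Type*} [RCLike 𝕜] {q n : ℕ}
  {G : Type u} [Group G] [TopologicalSpace G] [ChartedSpace (EuclideanSpace ℝ (Fin q)) G]
  [LieGroup (𝓡 q) ∞ G]
  {M : Type*} [TopologicalSpace M] [ChartedSpace (EuclideanSpace ℝ (Fin n)) M]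
  {F : Type*} [NormedAddCommGroup F] [NormedSpace ℝ F] [NormedSpace 𝕜 F] [IsScalarTower ℝ 𝕜 F]
  [FiniteDimensional ℝ F]
  {E : M → Type*} [TopologicalSpace (TotalSpace F E)]
  [∀ x, AddCommGroup (E x)] [∀ x, Module ℝ (E x)] [∀ x, Module 𝕜 (E x)]
  [∀ x, IsScalarTower ℝ 𝕜 (E x)] [∀ x, TopologicalSpace (E x)]
  [FiberBundle F E] [VectorBundle ℝ F E] [ContMDiffVectorBundle ∞ F E (𝓡 n)]
  [MulAction G M] [ContMDiffSMul (𝓡 q) (𝓡 n) ∞ G M]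
  [MulAction G (TotalSpace F E)]
  [ContMDiffSMul (𝓡 q) ((𝓡 n).prod 𝓘(ℝ, F)) ∞ G (TotalSpace F E)]
  [IsVectorBundleAction (F := F) (E := E) 𝕜 G]
  {Γ Γ' : Type u} [Group Γ] [Finite Γ] [Group Γ'] [Finite Γ']
  {c : VectorOrbibundleChart 𝕜 Γ (EuclideanSpace ℝ (Fin (n - q))) F
    (orbitProj (F := F) (E := E) 𝕜 G)}
  {c' : VectorOrbibundleChart 𝕜 Γ' (EuclideanSpace ℝ (Fin (n - q))) F
    (orbitProj (F := F) (E := E) 𝕜 G)}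

lemma VectorOrbibundleChart.IsLocallyInduced.base (hc : c.IsLocallyInduced G) :
    IsInducedBySlices q G (𝓡 n) c.base.proj c.base.source := by
  intro w hw
  obtain ⟨W, h, H, hW, hwW, hWs, hh, hH, hL, hF, hp, hP⟩ := hc w hw
  exact ⟨W, h, hwW, hWs, ⟨hW, hh, hF⟩, hp⟩

lemma VectorOrbibundleChart.IsLocallyInduced.total (hc : c.IsLocallyInduced G) :
    IsInducedBySlices q G ((𝓡 n).prod 𝓘(ℝ, F)) c.total.proj c.total.source := by
  rintro ⟨w, v⟩ hw
  rw [c.source_eq] at hw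
  obtain ⟨W, h, H, hW, hwW, hWs, hh, hH, hL, hF, hp, hP⟩ := hc w hw.1
  refine ⟨W ×ˢ univ, H, ⟨hwW, trivial⟩, ?_, IsSlice.total (𝕜 := 𝕜) ⟨hW, hh, hF⟩ hH hL,
    fun z hz => hP z.1 hz.1 z.2⟩
  rw [c.source_eq]
  exact prod_mono hWs Subset.rfl

/-- The composite of `H (z, ·)`, the inverse of the action of `a`, and the inverse of `H' (z', ·)`.
The points `h z` and `a • h' z'` are only propositionally equal, so one of them is generalized and
substituted. -/
lemma exists_linearEquiv_of_eq_smul {h h' : EuclideanSpace ℝ (Fin (n - q)) → M}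
    {H H' : EuclideanSpace ℝ (Fin (n - q)) × F → TotalSpace F E}
    {z z' : EuclideanSpace ℝ (Fin (n - q))} {a : G} (hz : h z = a • h' z')
    (hL : ∃ L : F ≃ₗ[𝕜] E (h z), ∀ v, H (z, v) = ⟨h z, L v⟩)
    (hL' : ∃ L : F ≃ₗ[𝕜] E (h' z'), ∀ v, H' (z', v) = ⟨h' z', L v⟩) :
    ∃ L : F ≃ₗ[𝕜] F, ∀ v, H (z, v) = a • H' (z', L v) := by
  obtain ⟨L, hL⟩ := hL
  obtain ⟨L', hL'⟩ := hL'
  obtain ⟨N, hN⟩ := IsVectorBundleAction.exists_linear (F := F) (E := E) (𝕜 := 𝕜) a (h' z')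
  generalize h z = y at hz L
  subst hz
  refine ⟨L.trans (N.symm.trans L'.symm), fun v => ?_⟩
  rw [hL, hL', hN]
  simp

/-- The transition of the base slices comes with a factor `α`; on fibers the transition is `L z = H'
(τ z, ·)⁻¹ ∘ (α z)⁻¹ ∘ H (z, ·)`. It is smooth in both directions because fiberwise isomorphic
bundle maps have smooth fiber inverses. -/
lemma VectorOrbibundleChart.IsLocallyInduced.compatible (hc : c.IsLocallyInduced G)
    (hc' : c'.IsLocallyInduced G) : c.Compatible c' := by
  have := topologicalGroup_of_lieGroup (𝓡 q) ∞ (G := G)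
  intro w hw w' hw' hww'
  obtain ⟨W, h, H, hW, hwW, hWs, hh, hH, hL, hF, hp, hP⟩ := hc w hw
  obtain ⟨W', h', H', hW', hwW', hWs', hh', hH', hL', hF', hp', hP'⟩ := hc' w' hw'
  rw [hp w hwW, hp' w' hwW'] at hww'
  obtain ⟨a, ha⟩ := Quotient.exact hww'
  obtain ⟨τ, α, hτ, h1, h2, h3, h4⟩ := IsSlice.exists_transition (q := q) (G := G)
    (I := 𝓡 n) ⟨hW, hh, hF⟩ ⟨hW', hh', hF'⟩ hwW hwW' (a := a) ha.symm
  have hmap : ∀ z ∈ τ.source, τ z ∈ W' := fun z hz => hτ.2.1 (τ.map_source hz)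
  -- `L` has to be defined on all of the model space; off the source the identity is an arbitrary
  -- value.
  have hex : ∀ z, ∃ L : F ≃ₗ[𝕜] F, z ∈ τ.source → ∀ v, H (z, v) = α z • H' (τ z, L v) := by
    intro z
    by_cases hz : z ∈ τ.source
    · obtain ⟨L, hL⟩ := exists_linearEquiv_of_eq_smul (h4 z hz) (hL z (hτ.1 hz))
        (hL' _ (hmap z hz))
      exact ⟨L, fun _ => hL⟩
    · exact ⟨LinearEquiv.refl 𝕜 F, fun h => (hz h).elim⟩
  choose L hLz using hex
  have hτs : ContMDiffOn (𝓡 (n - q)) (𝓡 (n - q)) ∞ τ τ.source :=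
    contMDiffOn_iff_contDiffOn.2 hτ.2.2.1
  have hproj : ∀ z ∈ W, ∀ v, (H (z, v)).proj = h z := fun z hz v => by
    obtain ⟨L, hL⟩ := hL z hz
    rw [hL]
  have hproj' : ∀ z ∈ W', ∀ v, (H' (z, v)).proj = h' z := fun z hz v => by
    obtain ⟨L, hL⟩ := hL' z hz
    rw [hL]
  refine ⟨τ, L, ⟨hτ.1.trans hWs, hτ.2.1.trans hWs', hτ.2.2⟩, h1, h2, ?_, ?_, fun z hz => ?_,
    fun z hz v => ?_⟩
  · rw [← contMDiffOn_prod_self_iff]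
    rintro ⟨z₁, v₁⟩ ⟨hz₁, -⟩
    obtain ⟨W₀, R, hW₀, hzW₀, hsub, hR, hR'⟩ :=
      exists_contMDiffOn_fiber_inverse hW' hh' hH' hL' (hmap z₁ hz₁)
    have ho : IsOpen (τ.source ∩ τ ⁻¹' W₀) := τ.isOpen_inter_preimage hW₀
    have hfst : ContMDiffOn ((𝓡 (n - q)).prod 𝓘(ℝ, F)) (𝓡 (n - q)) ∞ Prod.fst
      ((τ.source ∩ τ ⁻¹' W₀) ×ˢ (univ : Set F)) := contMDiff_fst.contMDiffOn
    -- Here `R` is a smooth fiber inverse of `H'`, and the function written down is `L z v`.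
    have hsm : ContMDiffOn ((𝓡 (n - q)).prod 𝓘(ℝ, F)) 𝓘(ℝ, F) ∞
        (fun y : EuclideanSpace ℝ (Fin (n - q)) × F => R (τ y.1, (α y.1)⁻¹ • H y))
        ((τ.source ∩ τ ⁻¹' W₀) ×ˢ univ) := by
      refine hR.comp (ContMDiffOn.prodMk (hτs.comp hfst fun y hy => hy.1.1)
        (ContMDiffOn.smul (I := 𝓡 q) ((h3.comp hfst fun y hy => hy.1.1).inv)
          (hH.mono (prod_mono (fun z hz => hτ.1 hz.1) Subset.rfl)))) ?_
      rintro ⟨z, v⟩ ⟨⟨hz, hzW⟩, -⟩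
      refine ⟨hzW, ?_⟩
      rw [Trivialization.mem_source]
      change ((α z)⁻¹ • H (z, v)).proj ∈ _
      rw [hLz z hz, inv_smul_smul, hproj' _ (hmap z hz)]
      exact (hR' _ hzW).1
    refine ContMDiffAt.contMDiffWithinAt ?_
    have hnhds : (τ.source ∩ τ ⁻¹' W₀) ×ˢ (univ : Set F) ∈ 𝓝 (z₁, v₁) :=
      (ho.prod isOpen_univ).mem_nhds ⟨⟨hz₁, hzW₀⟩, trivial⟩
    refine (hsm.contMDiffAt hnhds).congr_of_eventuallyEq (Filter.mem_of_superset hnhds ?_)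
    rintro ⟨z, v⟩ ⟨⟨hz, hzW⟩, -⟩
    change L z v = R (τ z, (α z)⁻¹ • H (z, v))
    rw [hLz z hz, inv_smul_smul, (hR' _ hzW).2]
  · rw [← contMDiffOn_prod_self_iff]
    rintro ⟨z₁, v₁⟩ ⟨hz₁, -⟩
    obtain ⟨W₀, R, hW₀, hzW₀, hsub, hR, hR'⟩ :=
      exists_contMDiffOn_fiber_inverse hW hh hH hL (hτ.1 hz₁)
    have ho : IsOpen (τ.source ∩ W₀) := τ.open_source.inter hW₀
    have hfst : ContMDiffOn ((𝓡 (n - q)).prod 𝓘(ℝ, F)) (𝓡 (n - q)) ∞ Prod.fst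
      ((τ.source ∩ W₀) ×ˢ (univ : Set F)) := contMDiff_fst.contMDiffOn
    -- Now `R` inverts `H`, and the function is `(L z).symm v`.
    have hsm : ContMDiffOn ((𝓡 (n - q)).prod 𝓘(ℝ, F)) 𝓘(ℝ, F) ∞
        (fun y : EuclideanSpace ℝ (Fin (n - q)) × F => R (y.1, α y.1 • H' (τ y.1, y.2)))
        ((τ.source ∩ W₀) ×ˢ univ) := by
      refine hR.comp (ContMDiffOn.prodMk hfst
        (ContMDiffOn.smul (I := 𝓡 q) (h3.comp hfst fun y hy => hy.1.1)
          (hH'.comp ((hτs.comp hfst fun y hy => hy.1.1).prodMk contMDiff_snd.contMDiffOn)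
            fun y hy => ⟨hmap _ hy.1.1, trivial⟩))) ?_
      rintro ⟨z, v⟩ ⟨⟨hz, hzW⟩, -⟩
      refine ⟨hzW, ?_⟩
      rw [Trivialization.mem_source]
      change (α z • H' (τ z, v)).proj ∈ _
      rw [proj_smul 𝕜, hproj' _ (hmap z hz), ← h4 z hz]
      exact (hR' _ hzW).1
    refine ContMDiffAt.contMDiffWithinAt ?_
    have hnhds : (τ.source ∩ W₀) ×ˢ (univ : Set F) ∈ 𝓝 (z₁, v₁) :=
      (ho.prod isOpen_univ).mem_nhds ⟨⟨hz₁, hzW₀⟩, trivial⟩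
    refine (hsm.contMDiffAt hnhds).congr_of_eventuallyEq (Filter.mem_of_superset hnhds ?_)
    rintro ⟨z, v⟩ ⟨⟨hz, hzW⟩, -⟩
    change (L z).symm v = R (z, α z • H' (τ z, v))
    have h5 := hLz z hz ((L z).symm v)
    rw [LinearEquiv.apply_symm_apply] at h5
    rw [← h5, (hR' _ hzW).2]
  · rw [hp z (hτ.1 hz), hp' _ (hmap z hz), h4 z hz]
    exact Quotient.sound' ⟨(α z)⁻¹, by simp⟩
  · rw [hP z (hτ.1 hz), hP' _ (hmap z hz), hLz z hz]
    exact Quotient.sound' ⟨(α z)⁻¹, by simp⟩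

/-- A vector orbibundle chart that is compatible with enough locally induced charts is locally
induced. -/
lemma VectorOrbibundleChart.isLocallyInduced_of_compatible
    (h : ∀ w ∈ c.base.source, ∃ (Γ' : Type u) (_ : Group Γ') (_ : Finite Γ')
      (c' : VectorOrbibundleChart 𝕜 Γ' (EuclideanSpace ℝ (Fin (n - q))) F
        (orbitProj (F := F) (E := E) 𝕜 G)),
      c'.IsLocallyInduced G ∧ c.base.proj w ∈ c'.base.target ∧ c.Compatible c') :
    c.IsLocallyInduced G := by
  intro w hw
  obtain ⟨Γ', _, _, c', hc', hw', hcomp⟩ := h w hw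
  obtain ⟨w', hw', hww'⟩ := c'.base.exists_proj_eq hw'
  obtain ⟨τ, L, hτ, h1, rfl, hLs, -, h3, h4⟩ := hcomp w hw w' hw' hww'.symm
  obtain ⟨W', h', H', hW', hwW', hWs', hh', hH', hL', hF', hp', hP'⟩ := hc' _ hw'
  have ho : IsOpen (τ.source ∩ τ ⁻¹' W') := τ.isOpen_inter_preimage hW'
  let τ' := τ.restrOpen _ ho
  have hsrc : τ'.source = τ.source ∩ τ ⁻¹' W' := by
    change τ.source ∩ (τ.source ∩ τ ⁻¹' W') = _
    rw [← inter_assoc, inter_self]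
  have hd : IsDiffeoWithin τ' c.base.source W' := by
    refine ⟨fun z hz => hτ.1 (hsrc ▸ hz).1, fun z hz => ?_,
      hτ.2.2.1.mono fun z hz => (hsrc ▸ hz).1, hτ.2.2.2.mono fun z hz => ?_⟩
    · have h5 := τ'.map_target hz
      rw [hsrc] at h5
      have h6 : τ (τ'.symm z) = z := τ'.right_inv hz
      rw [← h6]
      exact h5.2
    · have h5 := τ'.map_target hz
      rw [hsrc] at h5
      have h6 : τ (τ'.symm z) = z := τ'.right_inv hz
      rw [← h6]
      exact τ.map_source h5.1
  have hs := IsSlice.comp (q := q) (G := G) (I := 𝓡 n) (h := h') ⟨hW', hh', hF'⟩ hd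
  rw [hsrc] at hs
  have hfst : ContMDiffOn ((𝓡 (n - q)).prod 𝓘(ℝ, F)) (𝓡 (n - q)) ∞ Prod.fst
    ((τ.source ∩ τ ⁻¹' W') ×ˢ (univ : Set F)) := contMDiff_fst.contMDiffOn
  -- The lift of `c` is the lift of `c'` precomposed with the bundle transition `(z, v) ↦ (τ z, L z
  -- v)`.
  refine ⟨τ.source ∩ τ ⁻¹' W', h' ∘ τ, fun y => H' (τ y.1, L y.1 y.2), ho, ⟨h1, hwW'⟩,
    fun z hz => hτ.1 hz.1, hs.contMDiffOn, ?_, fun z hz => ?_, hs.isLocalDiffeomorphOn,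
    fun z hz => ?_, fun z hz v => ?_⟩
  · refine hH'.comp (((contMDiffOn_iff_contDiffOn.2 hτ.2.2.1).comp hfst fun y hy => hy.1.1).prodMk
      ((contMDiffOn_prod_self_iff.2 hLs).mono (prod_mono inter_subset_left Subset.rfl))) ?_
    exact fun y hy => ⟨hy.1.2, trivial⟩
  · obtain ⟨K, hK⟩ := hL' (τ z) hz.2
    exact ⟨(L z).trans K, fun v => hK _⟩
  · rw [← h3 z hz.1]
    exact hp' _ hz.2
  · rw [← h4 z hz.1]
    exact hP' _ hz.2 _

variable (𝕜 q n F E) in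
lemma continuous_orbitProj : Continuous (orbitProj (F := F) (E := E) 𝕜 G) :=
  Continuous.quotient_map' (FiberBundle.continuous_proj F E) _

variable (𝕜 q n F E) in
/-- The vector orbibundle structure formed by all locally induced charts. -/
noncomputable def inducedOrbibundleStructure (ht2M : T2Space (MulAction.orbitRel.Quotient G M))
    (ht2E : T2Space (MulAction.orbitRel.Quotient G (TotalSpace F E)))
    (hcov : ∀ x : MulAction.orbitRel.Quotient G M, ∃ (Γ : Type u) (_ : Group Γ) (_ : Finite Γ)
      (c : VectorOrbibundleChart 𝕜 Γ (EuclideanSpace ℝ (Fin (n - q))) F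
        (orbitProj (F := F) (E := E) 𝕜 G)), c.IsLocallyInduced G ∧ x ∈ c.base.target) :
    VectorOrbibundleStructure.{u} 𝕜 (EuclideanSpace ℝ (Fin (n - q))) F
      (orbitProj (F := F) (E := E) 𝕜 G) where
  base := inducedOrbifoldStructure q G _ (𝓡 n) M ht2M fun x => by
    obtain ⟨Γ, i1, i2, c, hc, hx⟩ := hcov x
    exact ⟨Γ, i1, i2, c.base, hc.base, hx⟩
  total := inducedOrbifoldStructure q G _ ((𝓡 n).prod 𝓘(ℝ, F)) (TotalSpace F E) ht2E fun x => by
    obtain ⟨Γ, i1, i2, c, hc, hx⟩ := hcov (orbitProj 𝕜 G x)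
    exact ⟨Γ, i1, i2, c.total, hc.total, by rw [c.target_eq]; exact hx⟩
  IsChart _ _ _ c := c.IsLocallyInduced G
  continuous := continuous_orbitProj 𝕜 F E
  isChart_base _ _ _ _ hc := hc.base
  isChart_total _ _ _ _ hc := hc.total
  compatible _ _ _ _ _ _ _ _ hc hc' := hc.compatible hc'
  cover := hcov
  maximal Γ _ _ c _ _ h := c.isLocallyInduced_of_compatible fun w _ => by
    obtain ⟨Γ', i1, i2, c', hc', hx⟩ := hcov (c.base.proj w)
    exact ⟨Γ', i1, i2, c', hc', hx, (h Γ' c' hc').1⟩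

/-- A vector orbibundle structure that contains enough locally induced charts consists of all
locally induced charts. -/
lemma eq_inducedOrbibundleStructure {ht2M : T2Space (MulAction.orbitRel.Quotient G M)}
    {ht2E : T2Space (MulAction.orbitRel.Quotient G (TotalSpace F E))}
    {hcov : ∀ x : MulAction.orbitRel.Quotient G M, ∃ (Γ : Type u) (_ : Group Γ) (_ : Finite Γ)
      (c : VectorOrbibundleChart 𝕜 Γ (EuclideanSpace ℝ (Fin (n - q))) F
        (orbitProj (F := F) (E := E) 𝕜 G)), c.IsLocallyInduced G ∧ x ∈ c.base.target}
    (S : VectorOrbibundleStructure.{u} 𝕜 (EuclideanSpace ℝ (Fin (n - q))) F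
      (orbitProj (F := F) (E := E) 𝕜 G))
    (hS : ∀ x : MulAction.orbitRel.Quotient G M, ∃ (Γ : Type u) (_ : Group Γ) (_ : Finite Γ)
      (c : VectorOrbibundleChart 𝕜 Γ (EuclideanSpace ℝ (Fin (n - q))) F
        (orbitProj (F := F) (E := E) 𝕜 G)),
      S.IsChart Γ c ∧ c.IsLocallyInduced G ∧ x ∈ c.base.target) :
    S = inducedOrbibundleStructure 𝕜 q n F E ht2M ht2E hcov := by
  have hbase : ∀ (Γ : Type u) [Group Γ] [Finite Γ] (c : OrbifoldChart Γ
      (EuclideanSpace ℝ (Fin (n - q))) (MulAction.orbitRel.Quotient G M)),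
      S.base.IsChart Γ c ↔ IsInducedBySlices q G (𝓡 n) c.proj c.source :=
    S.base.isChart_iff_isInducedBySlices fun x => by
      obtain ⟨Γ, i1, i2, c, hc, hc', hx⟩ := hS x
      exact ⟨Γ, i1, i2, c.base, S.isChart_base _ _ hc, hc'.base, hx⟩
  have htotal : ∀ (Γ : Type u) [Group Γ] [Finite Γ] (c : OrbifoldChart Γ
      (EuclideanSpace ℝ (Fin (n - q)) × F) (MulAction.orbitRel.Quotient G (TotalSpace F E))),
      S.total.IsChart Γ c ↔ IsInducedBySlices q G ((𝓡 n).prod 𝓘(ℝ, F)) c.proj c.source :=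
    S.total.isChart_iff_isInducedBySlices fun x => by
      obtain ⟨Γ, i1, i2, c, hc, hc', hx⟩ := hS (orbitProj 𝕜 G x)
      exact ⟨Γ, i1, i2, c.total, S.isChart_total _ _ hc, hc'.total, by rw [c.target_eq]; exact hx⟩
  have key : ∀ (Γ : Type u) [Group Γ] [Finite Γ]
      (c : VectorOrbibundleChart 𝕜 Γ (EuclideanSpace ℝ (Fin (n - q))) F
        (orbitProj (F := F) (E := E) 𝕜 G)), S.IsChart Γ c → c.IsLocallyInduced G :=
    fun Γ _ _ c hc => c.isLocallyInduced_of_compatible fun w _ => by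
      obtain ⟨Γ', i1, i2, c', hc', hc'', hx⟩ := hS (c.base.proj w)
      exact ⟨Γ', i1, i2, c', hc'', hx, S.compatible _ _ _ _ hc hc'⟩
  refine VectorOrbibundleStructure.ext (OrbifoldStructure.ext ?_) (OrbifoldStructure.ext ?_) ?_
  · ext Γ i1 i2 c
    exact hbase Γ c
  · ext Γ i1 i2 c
    exact htotal Γ c
  · ext Γ i1 i2 c
    -- Maximality applies only to bundle charts made of charts of the two orbifolds, so the orbifold
    -- structures have to be identified before the bundle atlas.
    exact ⟨key Γ c, fun hc => S.maximal Γ c ((hbase Γ _).2 hc.base) ((htotal Γ _).2 hc.total)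
      fun Γ' _ _ c' hc' => ⟨hc.compatible (key Γ' c' hc'), (key Γ' c' hc').compatible hc⟩⟩

end CanonicalStructure

/-! ### Openness of tubes and separation of orbits along a slice -/

section Tubes

variable {q : ℕ}
  {G : Type u} [Group G] [TopologicalSpace G] [ChartedSpace (EuclideanSpace ℝ (Fin q)) G]
  {B : Type*} [NormedAddCommGroup B] [NormedSpace ℝ B]
  {EP : Type*} [NormedAddCommGroup EP] [NormedSpace ℝ EP] {HP : Type*} [TopologicalSpace HP]
  {I : ModelWithCorners ℝ EP HP} {P : Type*} [TopologicalSpace P] [ChartedSpace HP P]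
  [MulAction G P] {h : B → P} {W V : Set B}

lemma IsSlice.isOpen_image (hs : IsSlice q G I h W) (hV : IsOpen V) (hVW : V ⊆ W) :
    IsOpen ((fun y : G × B => y.1 • h y.2) '' (univ ×ˢ V)) := by
  rw [isOpen_iff_mem_nhds]
  rintro _ ⟨⟨a, w⟩, ⟨-, hw⟩, rfl⟩
  obtain ⟨Φ, hΦ, hΦe⟩ := hs.isLocalDiffeomorphOn ⟨(a, w), trivial, hVW hw⟩
  have ho : IsOpen (Φ '' (Φ.source ∩ univ ×ˢ V)) :=
    Φ.toOpenPartialHomeomorph.isOpen_image_of_subset_source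
      (Φ.open_source.inter (isOpen_univ.prod hV)) inter_subset_left
  refine Filter.mem_of_superset (ho.mem_nhds ⟨(a, w), ⟨hΦ, trivial, hw⟩, (hΦe hΦ).symm⟩) ?_
  rintro _ ⟨y, ⟨hy, hyV⟩, rfl⟩
  exact ⟨y, hyV, hΦe hy⟩

/-- The set is also the image of the open tube swept out by the slice, and the projection to the
orbit space is open. -/
lemma IsSlice.isOpen_image_mk [ContinuousConstSMul G P] (hs : IsSlice q G I h W) (hV : IsOpen V)
    (hVW : V ⊆ W) :
    IsOpen ((fun w => (Quotient.mk _ (h w) : MulAction.orbitRel.Quotient G P)) '' V) := by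
  have h1 : (fun w => (Quotient.mk _ (h w) : MulAction.orbitRel.Quotient G P)) '' V =
      (fun x => (Quotient.mk _ x : MulAction.orbitRel.Quotient G P)) ''
        ((fun y : G × B => y.1 • h y.2) '' (univ ×ˢ V)) := by
    ext x
    constructor
    · rintro ⟨w, hw, rfl⟩
      exact ⟨_, ⟨(1, w), ⟨trivial, hw⟩, rfl⟩, by simp⟩
    · rintro ⟨_, ⟨⟨a, w⟩, ⟨-, hw⟩, rfl⟩, rfl⟩
      exact ⟨w, hw, Quotient.sound' ⟨a⁻¹, by simp⟩⟩
  rw [h1]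
  exact isOpenMap_quotient_mk'_mul _ (hs.isOpen_image hV hVW)

/-- The map is open, continuous and surjective. `U` is only assumed equal to the image, so that the
target of a bundle chart, which is given as a preimage, is covered as well. -/
lemma IsSlice.isQuotientMap [ContinuousConstSMul G P] (hs : IsSlice q G I h W)
    {p : B → MulAction.orbitRel.Quotient G P} (hp : ∀ w, p w = Quotient.mk _ (h w))
    {U : Set (MulAction.orbitRel.Quotient G P)} (hU : U = p '' W) (hm : MapsTo p W U) :
    IsQuotientMap (hm.restrict p W U) := by
  obtain rfl : p = fun w => Quotient.mk _ (h w) := funext hp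
  refine IsOpenMap.isQuotientMap ?_ ?_ ?_
  · intro V hV
    obtain ⟨V', hV', rfl⟩ := isOpen_induced_iff.1 hV
    refine isOpen_induced_iff.2 ⟨_, hs.isOpen_image_mk (hV'.inter hs.isOpen) inter_subset_right, ?_⟩
    ext ⟨x, hx⟩
    constructor
    · rintro ⟨w, ⟨hw1, hw2⟩, hw3⟩
      exact ⟨⟨w, hw2⟩, hw1, Subtype.ext hw3⟩
    · rintro ⟨⟨w, hw2⟩, hw1, hw3⟩
      exact ⟨w, ⟨hw1, hw2⟩, congrArg Subtype.val hw3⟩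
  · refine ContinuousOn.mapsToRestrict ?_ hm
    exact continuous_quotient_mk'.comp_continuousOn hs.contMDiffOn.continuousOn
  · rintro ⟨x, hx⟩
    obtain ⟨w, hw, rfl⟩ := hU ▸ hx
    exact ⟨⟨w, hw⟩, rfl⟩

/-- Translation invariance: `b • h z = a • ((a⁻¹ * b) • h z)` writes the map near `(a, w)` as its
germ at `(1, w)` between two diffeomorphisms. -/
lemma isSlice_of_isLocalDiffeomorphAt [LieGroup (𝓡 q) ∞ G] [ContMDiffSMul (𝓡 q) I ∞ G P]
    (hW : IsOpen W) (hh : ContMDiffOn 𝓘(ℝ, B) I ∞ h W)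
    (hF : ∀ w ∈ W, IsLocalDiffeomorphAt ((𝓡 q).prod 𝓘(ℝ, B)) I ∞
      (fun y : G × B => y.1 • h y.2) (1, w)) : IsSlice q G I h W := by
  refine ⟨hW, hh, ?_⟩
  rintro ⟨⟨a, w⟩, -, hw⟩
  have h1 : IsLocalDiffeomorphAt ((𝓡 q).prod 𝓘(ℝ, B)) ((𝓡 q).prod 𝓘(ℝ, B)) ∞
      (Prod.map (fun b => a⁻¹ * b) id : G × B → G × B) (a, w) := by
    refine ⟨⟨((Equiv.mulLeft a⁻¹).prodCongr (Equiv.refl B)).toPartialEquiv, isOpen_univ, isOpen_univ,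
      ?_, ?_⟩, trivial, fun y _ => rfl⟩
    · exact ((contMDiff_mul_left (a := a⁻¹)).prodMap contMDiff_id).contMDiffOn
    · have := ((contMDiff_mul_left (I := 𝓡 q) (n := ∞) (a := a)).prodMap
        (contMDiff_id (I := 𝓘(ℝ, B)) (M := B))).contMDiffOn (s := univ)
      refine this.congr fun y _ => ?_
      change ((a⁻¹)⁻¹ * y.1, y.2) = _
      rw [inv_inv]; rfl
  have h2 : IsLocalDiffeomorphAt I I ∞ (fun y : P => a • y) (((1 : G)) • h w) := by
    refine ⟨⟨(MulAction.toPerm a).toPartialEquiv, isOpen_univ, isOpen_univ, ?_, ?_⟩, trivial,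
      fun y _ => rfl⟩
    · exact (ContMDiffSMul.contMDiff_const_smul (I := 𝓡 q) a).contMDiffOn
    · exact (ContMDiffSMul.contMDiff_const_smul (I := 𝓡 q) a⁻¹).contMDiffOn
  have h3 : Prod.map (fun b => a⁻¹ * b) id (a, w) = ((1 : G), w) := by simp
  have h4 := h1.comp I P (g := fun y : G × B => y.1 • h y.2) (by rw [h3]; exact hF w hw)
  have h5 := h4.comp I P (g := fun y : P => a • y)
    (by simpa [Function.comp_def] using h2)
  convert h5 using 1
  ext y
  simp [smul_smul]

/-- If `(a, w) ↦ a • h w` is a local diffeomorphism at `(1, 0)`, two points of the slice that are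
close to `h 0` lie in the same orbit only if they are related by the isotropy group of `h 0`. -/
lemma exists_nhds_eq_of_smul_eq [LieGroup (𝓡 q) ∞ G] [CompactSpace G] [T2Space G] [T2Space P]
    [ContMDiffSMul (𝓡 q) I ∞ G P] {x : P} [Finite (MulAction.stabilizer G x)]
    (ρ : MulAction.stabilizer G x → B → B) (hρ : ∀ k, Continuous (ρ k)) (hρ0 : ∀ k, ρ k 0 = 0)
    (hW : W ∈ 𝓝 0) (hx : h 0 = x) (hc : ContinuousAt h 0)
    (heq : ∀ k, ∀ w ∈ W, h (ρ k w) = (k : G) • h w)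
    (hF : IsLocalDiffeomorphAt ((𝓡 q).prod 𝓘(ℝ, B)) I ∞
      (fun y : G × B => y.1 • h y.2) (1, 0)) :
    ∃ U ∈ 𝓝 (0 : B), ∀ w ∈ U, ∀ w' ∈ U, ∀ b : G, b • h w = h w' →
      ∃ k : MulAction.stabilizer G x, b = k ∧ ρ k w = w' := by
  have := topologicalGroup_of_lieGroup (𝓡 q) ∞ (G := G)
  have := ContMDiffSMul.continuousSMul (I := 𝓡 q) (I' := I) (G := G) (M := P) ∞
  obtain ⟨Φ, hΦ, hΦe⟩ := hF
  obtain ⟨O, U₁, hO, hU₁, h1O, h0U₁, hOU⟩ := isOpen_prod_iff.1 Φ.open_source 1 0 hΦ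
  -- The complement of the neighborhood `⋃ O k` of the isotropy group. It is compact and moves `x`
  -- off itself, so for `w`, `w'` near `0` no `b ∈ C` takes `h w` to `h w'`.
  let C : Set G := (⋃ k : MulAction.stabilizer G x, (fun b => b * (k : G)⁻¹) ⁻¹' O)ᶜ
  have hC : IsCompact C := by
    refine IsClosed.isCompact (isOpen_iUnion fun k => ?_).isClosed_compl
    exact hO.preimage (continuous_mul_const _)
  have hCne : ∀ᶠ w : B × B in 𝓝 (0, 0), ∀ b ∈ C, b • h w.1 ≠ h w.2 := by
    refine hC.eventually_forall_of_forall_eventually fun b hb => ?_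
    have hne : b • h 0 ≠ h 0 := by
      intro hbx
      rw [hx] at hbx
      refine hb (mem_iUnion.2 ⟨⟨b, hbx⟩, ?_⟩)
      simpa using h1O
    have c1 : ContinuousAt (fun y : (B × B) × G => y.2 • h y.1.1) ((0, 0), b) :=
      continuousAt_snd.smul (ContinuousAt.comp (g := h) hc (by fun_prop))
    have c2 : ContinuousAt (fun y : (B × B) × G => h y.1.2) ((0, 0), b) :=
      ContinuousAt.comp (g := h) hc (by fun_prop)
    exact (c1.prodMk c2).eventually (isClosed_diagonal.isOpen_compl.mem_nhds hne)
  obtain ⟨U₂, hU₂, U₃, hU₃, hU₂₃⟩ := mem_nhds_prod_iff.1 hCne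
  refine ⟨U₁ ∩ U₂ ∩ U₃ ∩ W ∩ ⋂ k, ρ k ⁻¹' U₁, ?_, ?_⟩
  · refine Filter.inter_mem (Filter.inter_mem (Filter.inter_mem (Filter.inter_mem
      (hU₁.mem_nhds h0U₁) hU₂) hU₃) hW) (Filter.iInter_mem.2 fun k => ?_)
    exact ((hU₁.preimage (hρ k)).mem_nhds (by rw [mem_preimage, hρ0]; exact h0U₁))
  · rintro w ⟨⟨⟨⟨-, hw2⟩, -⟩, hwW⟩, hwk⟩ w' ⟨⟨⟨⟨hw'1, -⟩, hw'3⟩, -⟩, -⟩ b hb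
    have hbC : b ∉ C := fun hbC => hU₂₃ (show (w, w') ∈ U₂ ×ˢ U₃ from ⟨hw2, hw'3⟩) b hbC hb
    simp only [C, mem_compl_iff, not_not, mem_iUnion, mem_preimage] at hbC
    obtain ⟨k, hk⟩ := hbC
    -- By equivariance `(b * k⁻¹, ρ k w)` and `(1, w')` have the same image, and both lie where `Φ`
    -- is injective.
    have s1 : (b * (k : G)⁻¹, ρ k w) ∈ Φ.source := hOU ⟨hk, mem_iInter.1 hwk k⟩
    have s2 : ((1 : G), w') ∈ Φ.source := hOU ⟨h1O, hw'1⟩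
    have e1 : Φ (b * (k : G)⁻¹, ρ k w) = Φ (1, w') := by
      rw [← hΦe s1, ← hΦe s2]
      change (b * (k : G)⁻¹) • h (ρ k w) = (1 : G) • h w'
      rw [heq k w hwW, one_smul, smul_smul, inv_mul_cancel_right, hb]
    have e2 := Φ.injOn s1 s2 e1
    refine ⟨k, ?_, congrArg Prod.snd e2⟩
    exact mul_inv_eq_one.1 (congrArg Prod.fst e2)

end Tubes

/-! ### Vector orbibundle charts from equivariant slices -/

section TubeCharts

variable {𝕜 : Type*} [RCLike 𝕜] {q n : ℕ}
  {G : Type u} [Group G] [TopologicalSpace G] [ChartedSpace (EuclideanSpace ℝ (Fin q)) G]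
  [LieGroup (𝓡 q) ∞ G] [CompactSpace G] [T2Space G]
  {M : Type*} [TopologicalSpace M] [ChartedSpace (EuclideanSpace ℝ (Fin n)) M] [T2Space M]
  {F : Type*} [NormedAddCommGroup F] [NormedSpace ℝ F] [NormedSpace 𝕜 F] [IsScalarTower ℝ 𝕜 F]
  [FiniteDimensional ℝ F]
  {E : M → Type*} [TopologicalSpace (TotalSpace F E)]
  [∀ x, AddCommGroup (E x)] [∀ x, Module ℝ (E x)] [∀ x, Module 𝕜 (E x)]
  [∀ x, IsScalarTower ℝ 𝕜 (E x)] [∀ x, TopologicalSpace (E x)]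
  [FiberBundle F E] [VectorBundle ℝ F E] [ContMDiffVectorBundle ∞ F E (𝓡 n)]
  [MulAction G M] [ContMDiffSMul (𝓡 q) (𝓡 n) ∞ G M]
  [MulAction G (TotalSpace F E)]
  [ContMDiffSMul (𝓡 q) ((𝓡 n).prod 𝓘(ℝ, F)) ∞ G (TotalSpace F E)]
  [IsVectorBundleAction (F := F) (E := E) 𝕜 G]
  {B : Type*} [NormedAddCommGroup B] [NormedSpace ℝ B]
  {x : M}

lemma mk_eq_mk_iff_exists_smul {G P : Type*} [Group G] [MulAction G P] {y z : P} :
    (Quotient.mk _ y : MulAction.orbitRel.Quotient G P) = Quotient.mk _ z ↔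
      ∃ a : G, a • y = z := by
  rw [Quotient.eq]
  constructor
  · rintro ⟨a, rfl⟩
    exact ⟨a⁻¹, by simp⟩
  · rintro ⟨a, rfl⟩
    exact ⟨a⁻¹, by simp⟩

/-- A slice through `x` whose base map and bundle map are equivariant under the isotropy group
induces arbitrarily small vector orbibundle charts. -/
theorem exists_tubeChart [Finite (MulAction.stabilizer G x)]
    (effective : Dense {y : M | ∀ a : G, a • y = y →
      ∀ v : E y, a • (⟨y, v⟩ : TotalSpace F E) = ⟨y, v⟩})
    (ρ : MulAction.stabilizer G x →* (B →L[ℝ] B)) (σ : MulAction.stabilizer G x →* (F →ₗ[𝕜] F))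
    {N : Set B} (hN : IsOpen N) (h0 : (0 : B) ∈ N) {ψ : B → M} {Ψ : B × F → TotalSpace F E}
    (hψ : ContMDiffOn 𝓘(ℝ, B) (𝓡 n) ∞ ψ N) (hψ0 : ψ 0 = x)
    (hΨ : ContMDiffOn (𝓘(ℝ, B).prod 𝓘(ℝ, F)) ((𝓡 n).prod 𝓘(ℝ, F)) ∞ Ψ (N ×ˢ univ))
    (hL : ∀ w ∈ N, ∃ L : F ≃ₗ[𝕜] E (ψ w), ∀ v, Ψ (w, v) = ⟨ψ w, L v⟩)
    (hψeq : ∀ k, ∀ w ∈ N, ρ k w ∈ N → ψ (ρ k w) = (k : G) • ψ w)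
    (hΨeq : ∀ k, ∀ w ∈ N, ρ k w ∈ N → ∀ v, Ψ (ρ k w, σ k v) = (k : G) • Ψ (w, v))
    (hF : IsLocalDiffeomorphAt ((𝓡 q).prod 𝓘(ℝ, B)) (𝓡 n) ∞
      (fun y : G × B => y.1 • ψ y.2) (1, 0)) {W : Set B} (hW : W ∈ 𝓝 0) :
    ∃ (Γ : Type u) (_ : Group Γ) (_ : Finite Γ)
      (c : VectorOrbibundleChart 𝕜 Γ B F (orbitProj (F := F) (E := E) 𝕜 G))
      (θ : MulAction.stabilizer G x →* Γ),
      (0 : B) ∈ c.base.source ∧ c.base.source ⊆ W ∩ N ∧ Function.Surjective θ ∧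
      (∀ k w, c.base.act (θ k) w = ρ k w) ∧
      (∀ k w v, c.total.act (θ k) (w, v) = (ρ k w, σ k v)) ∧
      IsSlice q G (𝓡 n) ψ c.base.source ∧
      (∀ a a' : G, ∀ w ∈ c.base.source, ∀ w' ∈ c.base.source, a • ψ w = a' • ψ w' ↔
        ∃ k : MulAction.stabilizer G x, a' = a * (k : G)⁻¹ ∧ w' = ρ k w) ∧
      (∀ w, c.base.proj w = Quotient.mk _ (ψ w)) ∧
      ∀ y, c.total.proj y = Quotient.mk _ (Ψ y) := by
  have := topologicalGroup_of_lieGroup (𝓡 q) ∞ (G := G)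
  have := ContMDiffSMul.continuousSMul (I := 𝓡 q) (I' := 𝓡 n) (G := G) (M := M) ∞
  have := ContMDiffSMul.continuousSMul (I := 𝓡 q) (I' := (𝓡 n).prod 𝓘(ℝ, F)) (G := G)
    (M := TotalSpace F E) ∞
  have hρmul : ∀ k k' w, ρ (k * k') w = ρ k (ρ k' w) := fun k k' w => by simp
  -- the open set on which everything is defined
  have hρN : ∀ᶠ w in 𝓝 (0 : B), ∀ k, ρ k w ∈ N := by
    rw [Filter.eventually_all]
    exact fun k => (ρ k).continuous.continuousAt.eventually
      (hN.mem_nhds (by rw [map_zero]; exact h0))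
  obtain ⟨U, hU, hUeq⟩ := exists_nhds_eq_of_smul_eq (q := q) (I := 𝓡 n) (h := ψ)
    (fun k w => ρ k w) (fun k => (ρ k).continuous) (fun k => map_zero _)
    (W := {w | w ∈ N ∧ ∀ k, ρ k w ∈ N}) (Filter.inter_mem (hN.mem_nhds h0) hρN) hψ0
    (hψ.continuousOn.continuousAt (hN.mem_nhds h0)) (fun k w hw => hψeq k w hw.1 (hw.2 k)) hF
  have hF' : ∀ᶠ w in 𝓝 (0 : B), IsLocalDiffeomorphAt ((𝓡 q).prod 𝓘(ℝ, B)) (𝓡 n) ∞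
      (fun y : G × B => y.1 • ψ y.2) (1, w) := by
    obtain ⟨Φ, hΦ, hΦe⟩ := hF
    have h1 : ContinuousAt (fun w : B => ((1 : G), w)) 0 := by fun_prop
    filter_upwards [h1.preimage_mem_nhds (Φ.open_source.mem_nhds hΦ)] with w hw
    exact ⟨Φ, hw, hΦe⟩
  obtain ⟨S₀, hS₀, hS₀o, h0S₀⟩ := mem_nhds_iff.1 (Filter.inter_mem (Filter.inter_mem hU hF')
    (Filter.inter_mem hW (hN.mem_nhds h0)))
  -- Intersecting the finitely many preimages makes the domain invariant under the isotropy group.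
  let S : Set B := ⋂ k, ρ k ⁻¹' S₀
  have hSmem : ∀ {w}, w ∈ S ↔ ∀ k, ρ k w ∈ S₀ := fun {w} => mem_iInter
  have hSo : IsOpen S := isOpen_iInter_of_finite fun k => hS₀o.preimage (ρ k).continuous
  have h0S : (0 : B) ∈ S := hSmem.2 fun k => by rw [map_zero]; exact h0S₀
  have hSS₀ : S ⊆ S₀ := fun w hw => by simpa using hSmem.1 hw 1
  have hSN : S ⊆ N := fun w hw => (hS₀ (hSS₀ hw)).2.2
  have hSW : S ⊆ W := fun w hw => (hS₀ (hSS₀ hw)).2.1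
  have hSρ : ∀ k, MapsTo (ρ k) S S := fun k w hw => hSmem.2 fun k' => by
    rw [← hρmul]; exact hSmem.1 hw _
  have hslice : IsSlice q G (𝓡 n) ψ S :=
    isSlice_of_isLocalDiffeomorphAt hSo (hψ.mono hSN) fun w hw => (hS₀ (hSS₀ hw)).1.2
  have hsliceT : IsSlice q G ((𝓡 n).prod 𝓘(ℝ, F)) Ψ (S ×ˢ univ) :=
    hslice.total (hΨ.mono (prod_mono hSN subset_rfl)) fun w hw => hL w (hSN hw)
  have hψS : ∀ k, ∀ w ∈ S, ψ (ρ k w) = (k : G) • ψ w := fun k w hw =>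
    hψeq k w (hSN hw) (hSN (hSρ k hw))
  have hΨS : ∀ k, ∀ w ∈ S, ∀ v, Ψ (ρ k w, σ k v) = (k : G) • Ψ (w, v) := fun k w hw =>
    hΨeq k w (hSN hw) (hSN (hSρ k hw))
  have horb : ∀ w ∈ S, ∀ w' ∈ S, ∀ b : G, b • ψ w = ψ w' →
      ∃ k : MulAction.stabilizer G x, b = k ∧ ρ k w = w' := fun w hw w' hw' =>
    hUeq w (hS₀ (hSS₀ hw)).1.1 w' (hS₀ (hSS₀ hw')).1.1
  have hproj : ∀ w ∈ S, ∀ v, (Ψ (w, v)).proj = ψ w := fun w hw v => by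
    obtain ⟨L, hL⟩ := hL w (hSN hw); rw [hL]
  have hinj : ∀ w ∈ S, ∀ v v', Ψ (w, v) = Ψ (w, v') → v = v' := fun w hw v v' h => by
    obtain ⟨L, hL⟩ := hL w (hSN hw)
    rw [hL, hL, TotalSpace.mk_inj] at h
    exact L.injective h
  have hsurj : ∀ w ∈ S, ∀ Z : TotalSpace F E, Z.proj = ψ w → ∃ v, Ψ (w, v) = Z := by
    rintro w hw ⟨y, Z⟩ rfl
    obtain ⟨L, hL⟩ := hL w (hSN hw)
    exact ⟨L.symm Z, by rw [hL, L.apply_symm_apply]⟩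
  -- the kernel of `ρ` acts trivially on the fiber
  have hker : ∀ k, ρ k = 1 → σ k = 1 := by
    intro k hk
    obtain ⟨y, ⟨⟨a, w⟩, ⟨-, hw⟩, rfl⟩, hy⟩ := effective.inter_open_nonempty _
      (hslice.isOpen_image hSo subset_rfl) ⟨x, (1, 0), ⟨trivial, h0S⟩, by simp [hψ0]⟩
    have hkw : (k : G) • ψ w = ψ w := by rw [← hψS k w hw, hk]; rfl
    refine LinearMap.ext fun v => ?_
    -- Density yields only a point `a • ψ w` of the tube, not a point of the slice. As `ρ k = 1`,
    -- `k` fixes `ψ w`, so the conjugate `a k a⁻¹` fixes that point and acts trivially on its fiber;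
    -- the equality is then moved back by `a`.
    have h1 := hy (a * k * a⁻¹) (by simp [mul_smul, hkw])
    have h2 : (a • Ψ (w, v)).proj = a • ψ w := by rw [proj_smul 𝕜, hproj w hw]
    generalize hZ : a • Ψ (w, v) = Z at h2
    obtain ⟨y, Z⟩ := Z
    change y = _ at h2
    subst h2
    have h3 := h1 Z
    rw [← hZ, smul_smul, inv_mul_cancel_right, mul_smul] at h3
    have h4 := smul_left_cancel _ h3
    rw [← hΨS k w hw, hk] at h4
    exact hinj w hw _ _ h4
  -- The quotient acts effectively on the slice, and `σ` descends to it by `hker`.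
  let Γ := MulAction.stabilizer G x ⧸ ρ.ker
  let ρ' : Γ →* (B →L[ℝ] B) := QuotientGroup.lift ρ.ker ρ fun k hk => hk
  let σ' : Γ →* (F →ₗ[𝕜] F) := QuotientGroup.lift ρ.ker σ fun k hk => hker k hk
  let θ : MulAction.stabilizer G x →* Γ := QuotientGroup.mk' ρ.ker
  have hθ : Function.Surjective θ := QuotientGroup.mk'_surjective _
  have hσsm : ∀ k, ContDiff ℝ ∞ (σ k) := fun k =>
    (LinearMap.toContinuousLinearMap ((σ k).restrictScalars ℝ)).contDiff
  have hfaith : ∀ k, (∀ w ∈ S, ρ k w = w) → θ k = 1 := by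
    intro k hk
    refine (QuotientGroup.eq_one_iff _).2 (MonoidHom.mem_ker.2 ?_)
    refine ContinuousLinearMap.ext fun w => ?_
    -- Any `w` can be scaled into `S` by some `t ≠ 0`, so a linear map that is the identity on `S`
    -- is the identity everywhere.
    have h1 : Filter.Tendsto (fun t : ℝ => t • w) (𝓝[≠] 0) (𝓝 0) := by
      have : Filter.Tendsto (fun t : ℝ => t • w) (𝓝 0) (𝓝 ((0 : ℝ) • w)) :=
        (continuous_id.smul continuous_const).continuousAt
      rw [zero_smul] at this
      exact this.mono_left nhdsWithin_le_nhds
    obtain ⟨t, ht, ht0⟩ := ((h1.eventually (hSo.mem_nhds h0S)).and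
      eventually_mem_nhdsWithin).exists
    have h2 := hk _ ht
    rw [map_smul] at h2
    exact smul_right_injective B (show t ≠ 0 from ht0) h2
  have hbase : ∀ w ∈ S, ∀ w' ∈ S, (Quotient.mk _ (ψ w) : MulAction.orbitRel.Quotient G M) =
      Quotient.mk _ (ψ w') ↔ ∃ k, ρ k w = w' := by
    intro w hw w' hw'
    rw [mk_eq_mk_iff_exists_smul]
    constructor
    · rintro ⟨a, ha⟩
      obtain ⟨k, -, hk⟩ := horb w hw w' hw' a ha
      exact ⟨k, hk⟩
    · rintro ⟨k, rfl⟩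
      exact ⟨k, (hψS k w hw).symm⟩
  have htot : ∀ w ∈ S, ∀ w' ∈ S, ∀ v v',
      (Quotient.mk _ (Ψ (w, v)) : MulAction.orbitRel.Quotient G (TotalSpace F E)) =
      Quotient.mk _ (Ψ (w', v')) ↔ ∃ k, ρ k w = w' ∧ σ k v = v' := by
    intro w hw w' hw' v v'
    rw [mk_eq_mk_iff_exists_smul]
    constructor
    · rintro ⟨a, ha⟩
      have h1 : a • ψ w = ψ w' := by
        rw [← hproj w hw v, ← proj_smul 𝕜, ha, hproj w' hw']
      obtain ⟨k, rfl, hk⟩ := horb w hw w' hw' a h1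
      refine ⟨k, hk, ?_⟩
      rw [← hΨS k w hw, hk] at ha
      exact hinj _ hw' _ _ ha
    · rintro ⟨k, rfl, rfl⟩
      exact ⟨k, (hΨS k w hw v).symm⟩
  let base : OrbifoldChart Γ B (MulAction.orbitRel.Quotient G M) :=
    { source := S
      target := (fun w => Quotient.mk _ (ψ w)) '' S
      act := fun γ w => ρ' γ w
      proj := fun w => Quotient.mk _ (ψ w)
      isOpen_source := hSo
      isOpen_target := hslice.isOpen_image_mk hSo subset_rfl
      act_mapsTo := fun γ => by obtain ⟨k, rfl⟩ := hθ γ; exact hSρ k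
      act_one := fun w _ => by rw [map_one]; rfl
      act_mul := fun γ γ' w _ => by rw [map_mul]; rfl
      act_smooth := fun γ => (ρ' γ).contDiff.contDiffOn
      act_faithful := fun γ hγ => by obtain ⟨k, rfl⟩ := hθ γ; exact hfaith k hγ
      proj_mapsTo := mapsTo_image _ _
      proj_isQuotientMap := hslice.isQuotientMap (fun w => rfl) rfl _
      proj_eq_iff := fun w hw w' hw' => by
        exact (hbase w hw w' hw').trans (hθ.exists (p := fun γ => ρ' γ w = w')).symm }
  have htarget : (orbitProj (F := F) (E := E) 𝕜 G) ⁻¹' base.target =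
      (fun y => Quotient.mk _ (Ψ y)) '' (S ×ˢ univ) := by
    ext Z
    constructor
    · induction Z using Quotient.inductionOn with | h Z => ?_
      rintro ⟨w, hw, hwZ⟩
      obtain ⟨a, ha⟩ := mk_eq_mk_iff_exists_smul.1
        (hwZ : (Quotient.mk _ (ψ w) : MulAction.orbitRel.Quotient G M) = Quotient.mk _ Z.proj)
      obtain ⟨v, hv⟩ := hsurj w hw (a⁻¹ • Z) (by rw [proj_smul 𝕜, ← ha, inv_smul_smul])
      exact ⟨(w, v), ⟨hw, trivial⟩, mk_eq_mk_iff_exists_smul.2 ⟨a, by simp [hv]⟩⟩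
    · rintro ⟨⟨w, v⟩, ⟨hw, -⟩, rfl⟩
      exact ⟨w, hw, congrArg (Quotient.mk _) (hproj w hw v).symm⟩
  let total : OrbifoldChart Γ (B × F) (MulAction.orbitRel.Quotient G (TotalSpace F E)) :=
    { source := S ×ˢ univ
      target := (orbitProj (F := F) (E := E) 𝕜 G) ⁻¹' base.target
      act := fun γ y => (ρ' γ y.1, σ' γ y.2)
      proj := fun y => Quotient.mk _ (Ψ y)
      isOpen_source := hSo.prod isOpen_univ
      isOpen_target := base.isOpen_target.preimage (continuous_orbitProj 𝕜 F E)
      act_mapsTo := fun γ y hy => ⟨base.act_mapsTo γ hy.1, trivial⟩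
      act_one := fun y _ => by rw [map_one, map_one]; rfl
      act_mul := fun γ γ' y _ => by rw [map_mul, map_mul]; rfl
      act_smooth := fun γ => by
        obtain ⟨k, rfl⟩ := hθ γ
        exact (((ρ k).contDiff.comp contDiff_fst).prodMk
          ((hσsm k).comp contDiff_snd)).contDiffOn
      act_faithful := fun γ hγ => base.act_faithful γ fun w hw =>
        congrArg Prod.fst (hγ (w, 0) ⟨hw, trivial⟩)
      proj_mapsTo := by rw [htarget]; exact mapsTo_image _ _
      proj_isQuotientMap := hsliceT.isQuotientMap (fun w => rfl) htarget _
      proj_eq_iff := fun y hy y' hy' => by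
        rw [htot y.1 hy.1 y'.1 hy'.1 y.2 y'.2]
        exact (exists_congr fun k => Prod.ext_iff.symm).trans
          (hθ.exists (p := fun γ => (ρ' γ y.1, σ' γ y.2) = y')).symm }
  refine ⟨Γ, inferInstance, inferInstance,
    { base := base
      total := total
      source_eq := rfl
      target_eq := rfl
      act_linear := fun γ w _ => ?_
      proj_comm := fun w hw v => congrArg (Quotient.mk _) (hproj w hw v) }, θ, h0S,
    subset_inter hSW hSN, hθ, fun k w => rfl, fun k w v => rfl, hslice, ?_, fun w => rfl,
    fun y => rfl⟩
  · obtain ⟨k, rfl⟩ := hθ γ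
    have h1 : ∀ k, σ k ∘ₗ σ k⁻¹ = LinearMap.id := fun k => by
      change σ k * σ k⁻¹ = 1
      rw [← map_mul, mul_inv_cancel, map_one]
    exact ⟨LinearEquiv.ofLinearMap (σ k) (σ k⁻¹) (h1 k) (by simpa using h1 k⁻¹), fun v => rfl⟩
  · intro a a' w hw w' hw'
    constructor
    · intro h
      obtain ⟨k, hk, hkw⟩ := horb w hw w' hw' (a'⁻¹ * a) (by rw [mul_smul, h, inv_smul_smul])
      exact ⟨k, by rw [← hk]; group, hkw.symm⟩
    · rintro ⟨k, rfl, rfl⟩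
      rw [hψS k w hw, mul_smul, inv_smul_smul]

end TubeCharts

/-! ### The inverse function theorem on boundaryless manifolds -/

section InverseFunction

/-- The local inverse is known to be smooth only at images of points with invertible derivative.
Invertibility is an open condition and the derivative is continuous, so shrinking the domain makes
the inverse smooth on the whole target. -/
lemma isLocalDiffeomorphAt_of_hasFDerivAt {E E' : Type*} [NormedAddCommGroup E]
    [NormedSpace ℝ E] [CompleteSpace E] [NormedAddCommGroup E'] [NormedSpace ℝ E'] {f : E → E'}
    {O : Set E} (hO : IsOpen O) (hf : ContDiffOn ℝ ∞ f O) {p : E} (hp : p ∈ O) {f' : E ≃L[ℝ] E'}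
    (hf' : HasFDerivAt f (f' : E →L[ℝ] E') p) : IsLocalDiffeomorphAt 𝓘(ℝ, E) 𝓘(ℝ, E') ∞ f p := by
  have hfp : ContDiffAt ℝ ∞ f p := hf.contDiffAt (hO.mem_nhds hp)
  let Θ := hfp.toOpenPartialHomeomorph f hf' (by simp)
  have hΘ : p ∈ Θ.source := hfp.mem_toOpenPartialHomeomorph_source hf' (by simp)
  have hc : ContinuousAt (fderiv ℝ f) p :=
    ((hf.fderiv_of_isOpen (m := 0) hO (by simp)).continuousOn).continuousAt (hO.mem_nhds hp)
  obtain ⟨V, hV, hVo, hpV⟩ := mem_nhds_iff.1 (Filter.inter_mem (hO.mem_nhds hp)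
    (hc.preimage_mem_nhds (by rw [hf'.fderiv]; exact f'.nhds)))
  let Θ' := Θ.restrOpen V hVo
  have hs : Θ'.source = Θ.source ∩ V := rfl
  refine ⟨⟨Θ'.toPartialEquiv, Θ'.open_source, Θ'.open_target, ?_, ?_⟩, ⟨hΘ, hpV⟩, fun y _ => rfl⟩
  · exact contMDiffOn_iff_contDiffOn.2 (hf.mono fun y hy => (hV hy.2).1)
  · refine contMDiffOn_iff_contDiffOn.2 fun y hy => ContDiffAt.contDiffWithinAt ?_
    have h1 : Θ'.symm y ∈ V := (Θ'.map_target hy).2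
    obtain ⟨e, he⟩ := (hV h1).2
    have h2 : ContDiffAt ℝ ∞ f (Θ'.symm y) := hf.contDiffAt (hO.mem_nhds (hV h1).1)
    refine Θ'.contDiffAt_symm hy (f₀' := e) ?_ h2
    rw [he]
    exact (h2.differentiableAt (by simp)).hasFDerivAt

variable {E : Type*} [NormedAddCommGroup E] [NormedSpace ℝ E] {H : Type*}
  [TopologicalSpace H] {I : ModelWithCorners ℝ E H} [I.Boundaryless] {P : Type*}
  [TopologicalSpace P] [ChartedSpace H P] [IsManifold I ∞ P]

lemma isLocalDiffeomorphAt_extChartAt (p : P) :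
    IsLocalDiffeomorphAt I 𝓘(ℝ, E) ∞ (extChartAt I p) p :=
  ⟨⟨extChartAt I p, isOpen_extChartAt_source p, isOpen_extChartAt_target p,
    by simpa using contMDiffOn_extChartAt, contMDiffOn_extChartAt_symm p⟩,
    mem_extChartAt_source p, fun _ _ => rfl⟩

lemma isLocalDiffeomorphAt_extChartAt_symm (p : P) :
    IsLocalDiffeomorphAt 𝓘(ℝ, E) I ∞ (extChartAt I p).symm (extChartAt I p p) :=
  ⟨⟨(extChartAt I p).symm, isOpen_extChartAt_target p, isOpen_extChartAt_source p,
    contMDiffOn_extChartAt_symm p, by simpa using contMDiffOn_extChartAt⟩,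
    mem_extChartAt_target p, fun _ _ => rfl⟩

lemma IsLocalDiffeomorphAt.congr_of_eventuallyEq {E' : Type*} [NormedAddCommGroup E']
    [NormedSpace ℝ E'] {H' : Type*} [TopologicalSpace H'] {J : ModelWithCorners ℝ E' H'}
    {Q : Type*} [TopologicalSpace Q] [ChartedSpace H' Q] {f g : P → Q} {p : P}
    (hf : IsLocalDiffeomorphAt I J ∞ f p) (hfg : g =ᶠ[𝓝 p] f) :
    IsLocalDiffeomorphAt I J ∞ g p := by
  obtain ⟨Φ, hΦ, hΦe⟩ := hf
  obtain ⟨V, hV, hVo, hpV⟩ := mem_nhds_iff.1 hfg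
  let Θ := Φ.toOpenPartialHomeomorph.restrOpen V hVo
  exact ⟨⟨Θ.toPartialEquiv, Θ.open_source, Θ.open_target, Φ.contMDiffOn.mono fun y hy => hy.1,
    Φ.symm.contMDiffOn.mono fun y hy => hy.1⟩, ⟨hΦ, hpV⟩,
    fun y hy => (hV hy.2).trans (hΦe hy.1)⟩

/-- The inverse function theorem for manifolds. -/
theorem isLocalDiffeomorphAt_of_hasMFDerivAt [CompleteSpace E] {E' : Type*} [NormedAddCommGroup E']
    [NormedSpace ℝ E'] {H' : Type*} [TopologicalSpace H'] {J : ModelWithCorners ℝ E' H'}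
    [J.Boundaryless] {Q : Type*} [TopologicalSpace Q] [ChartedSpace H' Q] [IsManifold J ∞ Q]
    {f : P → Q} {O : Set P} {p : P} (hO : IsOpen O) (hf : ContMDiffOn I J ∞ f O) (hp : p ∈ O)
    {f' : E ≃L[ℝ] E'} (hf' : HasMFDerivAt I J f p (f' : E →L[ℝ] E')) :
    IsLocalDiffeomorphAt I J ∞ f p := by
  let V : Set P := O ∩ f ⁻¹' (extChartAt J (f p)).source
  have hV : IsOpen V := hf.continuousOn.isOpen_inter_preimage hO (isOpen_extChartAt_source _)
  have hpV : p ∈ V := ⟨hp, mem_extChartAt_source _⟩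
  let g := writtenInExtChartAt I J p f
  have hg' : HasFDerivAt g (f' : E →L[ℝ] E') (extChartAt I p p) := by
    have : HasFDerivWithinAt g (f' : E →L[ℝ] E') (range I) (extChartAt I p p) := hf'.2
    rwa [I.range_eq_univ, hasFDerivWithinAt_univ] at this
  let O' : Set E := (extChartAt I p).target ∩ (extChartAt I p).symm ⁻¹' V
  have hO' : IsOpen O' := (continuousOn_extChartAt_symm p).isOpen_inter_preimage
    (isOpen_extChartAt_target p) hV
  have hg : ContDiffOn ℝ ∞ g O' := by
    rw [← contMDiffOn_iff_contDiffOn]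
    refine (contMDiffOn_extChartAt (I := J) (x := f p)).comp
      (hf.comp ((contMDiffOn_extChartAt_symm p).mono inter_subset_left) fun y hy => hy.2.1)
      fun y hy => ?_
    have := hy.2.2
    rwa [mem_preimage, extChartAt_source] at this
  have h1 := isLocalDiffeomorphAt_of_hasFDerivAt hO' hg
    (p := extChartAt I p p) ⟨mem_extChartAt_target p, by simpa using hpV⟩ hg'
  have h2 := ((isLocalDiffeomorphAt_extChartAt (I := I) p).comp 𝓘(ℝ, E') E' h1).comp J Q
    (g := (extChartAt J (f p)).symm) (by
      have := isLocalDiffeomorphAt_extChartAt_symm (I := J) (f p)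
      simpa [g, writtenInExtChartAt] using this)
  refine h2.congr_of_eventuallyEq ?_
  filter_upwards [hV.mem_nhds hpV, extChartAt_source_mem_nhds (I := I) p] with y hy hy'
  simp only [g, writtenInExtChartAt, Function.comp_apply]
  rw [(extChartAt I p).left_inv hy', (extChartAt J (f p)).left_inv hy.2]

end InverseFunction

/-! ### Orbit maps are immersions where the isotropy is finite -/

section OrbitMap

variable {q n : ℕ}
  {G : Type u} [Group G] [TopologicalSpace G] [ChartedSpace (EuclideanSpace ℝ (Fin q)) G]
  [LieGroup (𝓡 q) ∞ G] [T2Space G]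
  {M : Type*} [TopologicalSpace M] [ChartedSpace (EuclideanSpace ℝ (Fin n)) M]
  [IsManifold (𝓡 n) ∞ M] [MulAction G M] [ContMDiffSMul (𝓡 q) (𝓡 n) ∞ G M]

/-- A curve with vanishing derivative is locally constant. -/
lemma eventually_eq_of_hasMFDerivAt_zero {c : ℝ → M}
    (hc : ∀ᶠ t in 𝓝 0, HasMFDerivAt 𝓘(ℝ, ℝ) (𝓡 n) c t 0) : ∀ᶠ t in 𝓝 0, c t = c 0 := by
  have hc0 : ContinuousAt c 0 := hc.self_of_nhds.continuousAt
  obtain ⟨ε, hε, hball⟩ := Metric.eventually_nhds_iff_ball.1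
    (hc.and (hc0.eventually (extChartAt_source_mem_nhds (I := 𝓡 n) (c 0))))
  have hd : ∀ t ∈ Metric.ball (0 : ℝ) ε, HasFDerivWithinAt (extChartAt (𝓡 n) (c 0) ∘ c)
      (0 : ℝ →L[ℝ] _) (Metric.ball 0 ε) t := by
    intro t ht
    obtain ⟨h1, h2⟩ := hball t ht
    have h3 := (hasMFDerivAt_extChartAt (I := 𝓡 n) (x := c 0) (y := c t)
      (by rwa [extChartAt_source] at h2)).comp t h1
    exact (hasMFDerivAt_iff_hasFDerivAt.1
      (h3.congr_mfderiv (ContinuousLinearMap.comp_zero _))).hasFDerivWithinAt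
  filter_upwards [Metric.ball_mem_nhds 0 hε] with t ht
  have h4 : (extChartAt (𝓡 n) (c 0) ∘ c) t = (extChartAt (𝓡 n) (c 0) ∘ c) 0 := by
    refine (convex_ball (0 : ℝ) ε).is_const_of_fderivWithin_eq_zero (𝕜 := ℝ)
      (fun t ht => (hd t ht).differentiableWithinAt) (fun t ht => ?_) ht (Metric.mem_ball_self hε)
    exact (hd t ht).fderivWithin (Metric.isOpen_ball.uniqueDiffWithinAt ht)
  exact (extChartAt (𝓡 n) (c 0)).injOn (hball t ht).2 (mem_extChartAt_source _) h4

lemma contMDiff_orbitMap (x : M) : ContMDiff (𝓡 q) (𝓡 n) ∞ (fun a : G => a • x) :=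
  contMDiff_id.smul (I := 𝓡 q) contMDiff_const

variable (q n G) in
/-- The derivative at the identity of the orbit map of `x`. -/
noncomputable def orbitDeriv (x : M) : EuclideanSpace ℝ (Fin q) →L[ℝ] EuclideanSpace ℝ (Fin n) :=
  mfderiv (𝓡 q) (𝓡 n) (fun a : G => a • x) 1

lemma hasMFDerivAt_orbitMap (x : M) :
    HasMFDerivAt (𝓡 q) (𝓡 n) (fun a : G => a • x) 1 (orbitDeriv q n G x) :=
  ((contMDiff_orbitMap x).contMDiffAt.mdifferentiableAt (by simp)).hasMFDerivAt

/-- If `ξ` is in the kernel, take the integral curve `γ` through `1` of the left-invariant field of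
`ξ`. By equivariance the orbit map has zero derivative along this field, so `γ t • x` is locally
constant and `γ` stays in the isotropy group. That group is finite, so `γ` is constant near `0` and
its initial velocity `ξ` vanishes. -/
lemma orbitDeriv_injective {x : M} [Finite (MulAction.stabilizer G x)] :
    Function.Injective (orbitDeriv q n G x) := by
  rw [injective_iff_map_eq_zero]
  intro ξ hξ
  have : LieGroup (𝓡 q) (minSmoothness ℝ 3) G := by
    rw [minSmoothness_of_isRCLikeNormedField]
    exact LieGroup.of_le (n := ∞) ENat.LEInfty.out
  have : IsManifold (𝓡 q) 1 G := IsManifold.of_le (n := ∞) (by simp)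
  obtain ⟨γ, hγ0, hγ⟩ := exists_isMIntegralCurveAt_of_contMDiffAt_boundaryless (I := 𝓡 q) (M := G)
    (t₀ := 0) (x₀ := 1) (v := mulInvariantVectorField (I := 𝓡 q) (G := G) ξ)
    ((contMDiff_mulInvariantVectorField (I := 𝓡 q) (G := G) ξ).contMDiffAt.of_le
      (by rw [minSmoothness_of_isRCLikeNormedField]; norm_num))
  -- Differentiate `(g * b) • x = g • (b • x)` in `b` at the identity.
  have hzero : ∀ g : G, mfderiv (𝓡 q) (𝓡 n) (fun a : G => a • x) g
      (mulInvariantVectorField (I := 𝓡 q) (G := G) ξ g) = 0 := by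
    intro g
    have h1 : HasMFDerivAt (𝓡 q) (𝓡 q) (fun b : G => g * b) 1
        (mfderiv (𝓡 q) (𝓡 q) (fun b : G => g * b) 1) :=
      ((contMDiff_mul_left (n := ∞)).contMDiffAt.mdifferentiableAt (by simp)).hasMFDerivAt
    have h2 : HasMFDerivAt (𝓡 q) (𝓡 n) (fun a : G => a • x) (g * 1)
        (mfderiv (𝓡 q) (𝓡 n) (fun a : G => a • x) (g * 1)) :=
      ((contMDiff_orbitMap x).contMDiffAt.mdifferentiableAt (by simp)).hasMFDerivAt
    have h3 := h2.comp 1 h1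
    have h4 : HasMFDerivAt (𝓡 n) (𝓡 n) (fun y : M => g • y) ((1 : G) • x)
        (mfderiv (𝓡 n) (𝓡 n) (fun y : M => g • y) ((1 : G) • x)) :=
      ((ContMDiffSMul.contMDiff_const_smul (I := 𝓡 q) (n := ∞) g).contMDiffAt.mdifferentiableAt
        (by simp)).hasMFDerivAt
    have h5 := h4.comp 1 (hasMFDerivAt_orbitMap (q := q) (n := n) (G := G) x)
    have h6 : (fun a : G => a • x) ∘ (fun b : G => g * b) =
        (fun y : M => g • y) ∘ (fun a : G => a • x) := by
      ext b; simp [mul_smul]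
    rw [h6] at h3
    have h7 := hasMFDerivAt_unique h3 h5
    have h8 := congrArg (fun L : EuclideanSpace ℝ (Fin q) →L[ℝ] EuclideanSpace ℝ (Fin n) => L ξ) h7
    have h9 : mfderiv (𝓡 q) (𝓡 n) (fun a : G => a • x) (g * 1)
        (mulInvariantVectorField (I := 𝓡 q) (G := G) ξ g) = 0 := by
      refine Eq.trans h8 ?_
      change (mfderiv (𝓡 n) (𝓡 n) (fun y : M => g • y) ((1 : G) • x)) (orbitDeriv q n G x ξ) = _
      rw [hξ]
      exact map_zero _
    rwa [mul_one] at h9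
  have hγx : ∀ᶠ t in 𝓝 0, γ t • x = γ 0 • x := by
    refine eventually_eq_of_hasMFDerivAt_zero (n := n) (c := fun t => γ t • x) ?_
    filter_upwards [hγ] with t ht
    have h1 : HasMFDerivAt (𝓡 q) (𝓡 n) (fun a : G => a • x) (γ t)
        (mfderiv (𝓡 q) (𝓡 n) (fun a : G => a • x) (γ t)) :=
      ((contMDiff_orbitMap x).contMDiffAt.mdifferentiableAt (by simp)).hasMFDerivAt
    refine HasMFDerivAt.congr_mfderiv (h1.comp t ht) (ContinuousLinearMap.ext fun r => ?_)
    refine (map_smul (mfderiv (𝓡 q) (𝓡 n) (fun a : G => a • x) (γ t)) (show ℝ from r)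
      (mulInvariantVectorField (I := 𝓡 q) (G := G) ξ (γ t))).trans ?_
    rw [hzero, smul_zero]
    rfl
  have hγc : ContinuousAt γ 0 := hγ.self_of_nhds.continuousAt
  have hγ1 : γ =ᶠ[𝓝 0] fun _ => (1 : G) := by
    -- Finite sets are closed, so `1 = γ 0` is isolated in the isotropy group.
    have hK : ((MulAction.stabilizer G x : Set G) \ {1})ᶜ ∈ 𝓝 (γ 0) := by
      have hfin : ((MulAction.stabilizer G x : Set G)).Finite := ‹Finite _›
      exact (hfin.subset sdiff_subset).isClosed.isOpen_compl.mem_nhds (by simp [hγ0])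
    filter_upwards [hγx, hγc.preimage_mem_nhds hK] with t h1 h2
    by_contra h3
    exact h2 ⟨by simpa [hγ0] using h1, h3⟩
  have h1 := hγ.self_of_nhds
  have h2 : HasMFDerivAt 𝓘(ℝ, ℝ) (𝓡 q) γ 0 (0 : ℝ →L[ℝ] EuclideanSpace ℝ (Fin q)) :=
    (hasMFDerivAt_const (1 : G) (0 : ℝ)).congr_of_eventuallyEq hγ1
  have h3 := hasMFDerivAt_unique h1 h2
  have h4 := congrArg (fun L : ℝ →L[ℝ] EuclideanSpace ℝ (Fin q) => L 1) h3
  have h5 : mulInvariantVectorField (I := 𝓡 q) (G := G) ξ (γ 0) = 0 := by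
    refine Eq.trans ?_ h4
    exact (one_smul ℝ _).symm
  rw [hγ0] at h5
  have h6 : (fun b : G => (1 : G) * b) = id := by ext; simp
  change mfderiv (𝓡 q) (𝓡 q) (fun b : G => (1 : G) * b) 1 ξ = 0 at h5
  rw [h6, mfderiv_id] at h5
  exact h5

end OrbitMap

/-! ### Restricted representations and orthogonal complements -/

section LinearAlgebra

variable {K V B : Type*} [Group K] [NormedAddCommGroup V] [NormedSpace ℝ V]
  [FiniteDimensional ℝ V] [NormedAddCommGroup B] [NormedSpace ℝ B] [FiniteDimensional ℝ B]

/-- A representation restricts to an invariant subspace. -/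
lemma exists_restrict_representation (D : K →* (V →L[ℝ] V)) {N : Submodule ℝ V}
    (hN : ∀ k, ∀ v ∈ N, D k v ∈ N) (ν : B ≃ₗ[ℝ] N) :
    ∃ ρ : K →* (B →L[ℝ] B), ∀ k w, (ν (ρ k w) : V) = D k (ν w) := by
  let r : K → B →L[ℝ] B := fun k => LinearMap.toContinuousLinearMap
    (ν.symm.toLinearMap ∘ₗ ((D k : V →ₗ[ℝ] V).restrict (hN k)) ∘ₗ ν.toLinearMap)
  have hr : ∀ k w, (ν (r k w) : V) = D k (ν w) := fun k w => by
    change ((ν (ν.symm _) : N) : V) = _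
    rw [LinearEquiv.apply_symm_apply]; rfl
  refine ⟨⟨⟨r, ?_⟩, fun k k' => ?_⟩, hr⟩
  · ext1 w
    exact ν.injective (Subtype.ext (by rw [hr, map_one]; rfl))
  · ext1 w
    refine ν.injective (Subtype.ext ?_)
    change (ν (r (k * k') w) : V) = ν (r k (r k' w))
    rw [hr, hr, hr, map_mul]; rfl

/-- A positive form is nondegenerate, and `N` is the orthogonal complement of the range of the
injective map `o`, so the dimension formula applies. -/
lemma finrank_forall_eq_zero {W : Type*} [NormedAddCommGroup W] [NormedSpace ℝ W]
    [FiniteDimensional ℝ W] {b : V →L[ℝ] V →L[ℝ] ℝ} (hsymm : ∀ v w, b v w = b w v)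
    (hpos : ∀ v, v ≠ 0 → 0 < b v v) {o : W →L[ℝ] V} (ho : Function.Injective o)
    {N : Submodule ℝ V} (hN : ∀ v, v ∈ N ↔ ∀ ξ, b v (o ξ) = 0) :
    Module.finrank ℝ N = Module.finrank ℝ V - Module.finrank ℝ W := by
  let β : LinearMap.BilinForm ℝ V :=
    LinearMap.mk₂ ℝ (fun v w => b v w) (by simp) (by simp) (by simp) (by simp)
  have hβ : β.Nondegenerate := by
    refine ⟨fun v hv => ?_, fun v hv => ?_⟩ <;>
    · by_contra h
      exact (hpos v h).ne' (hv v)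
  have h1 : N = β.orthogonal (LinearMap.range (o : W →ₗ[ℝ] V)) := by
    ext v
    rw [hN, LinearMap.BilinForm.mem_orthogonal_iff]
    constructor
    · rintro h _ ⟨ξ, rfl⟩
      exact (hsymm _ _).trans (h ξ)
    · intro h ξ
      exact (hsymm _ _).trans (h _ ⟨ξ, rfl⟩)
  rw [h1, LinearMap.BilinForm.finrank_orthogonal hβ, LinearMap.finrank_range_of_inj ho]

end LinearAlgebra

/-! ### The linear isotropy representation and transversality to the orbit -/

section Isotropy

lemma hasMFDerivAt_smul (q n : ℕ) {G : Type u} [Group G] [TopologicalSpace G]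
    [ChartedSpace (EuclideanSpace ℝ (Fin q)) G] {M : Type*} [TopologicalSpace M]
    [ChartedSpace (EuclideanSpace ℝ (Fin n)) M] [MulAction G M]
    [ContMDiffSMul (𝓡 q) (𝓡 n) ∞ G M] (a : G) (y : M) :
    HasMFDerivAt (𝓡 n) (𝓡 n) (fun y : M => a • y) y (mfderiv (𝓡 n) (𝓡 n) (fun y : M => a • y) y) :=
  ((ContMDiffSMul.contMDiff_const_smul (I := 𝓡 q) (n := ∞) a).contMDiffAt.mdifferentiableAt
    (by simp)).hasMFDerivAt

variable {q n : ℕ}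
  {G : Type u} [Group G] [TopologicalSpace G] [ChartedSpace (EuclideanSpace ℝ (Fin q)) G]
  [LieGroup (𝓡 q) ∞ G] [T2Space G]
  {M : Type*} [TopologicalSpace M] [ChartedSpace (EuclideanSpace ℝ (Fin n)) M]
  [IsManifold (𝓡 n) ∞ M] [MulAction G M] [ContMDiffSMul (𝓡 q) (𝓡 n) ∞ G M] {x : M}

/-- If the differential of `ψ` at `0` is a complement of the tangent space of the orbit, then
`(a, w) ↦ a • ψ w` is a local diffeomorphism at `(1, 0)`. -/
lemma isLocalDiffeomorphAt_smul_of_disjoint {B : Type*} [NormedAddCommGroup B] [NormedSpace ℝ B]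
    [FiniteDimensional ℝ B] (hB : Module.finrank ℝ B = n - q)
    [Finite (MulAction.stabilizer G x)] {ψ : B → M} {N : Set B} (hN : IsOpen N)
    (hψ : ContMDiffOn 𝓘(ℝ, B) (𝓡 n) ∞ ψ N) (h0 : (0 : B) ∈ N) (hψ0 : ψ 0 = x)
    {ψ' : B →L[ℝ] EuclideanSpace ℝ (Fin n)} (hψ' : HasMFDerivAt 𝓘(ℝ, B) (𝓡 n) ψ 0 ψ')
    (hdis : ∀ w ξ, ψ' w = orbitDeriv q n G x ξ → w = 0) :
    IsLocalDiffeomorphAt ((𝓡 q).prod 𝓘(ℝ, B)) (𝓡 n) ∞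
      (fun y : G × B => y.1 • ψ y.2) (1, 0) := by
  have := IsManifold.of_le (I := 𝓡 n) (M := M) (m := 1) (n := ∞) (by simp)
  have ho := orbitDeriv_injective (q := q) (n := n) (G := G) (x := x)
  -- The subtraction in `n - q` is truncated; this bound makes the dimensions add up to `n`.
  have hq : q ≤ n := by
    simpa using LinearMap.finrank_le_finrank_of_injective (f := (orbitDeriv q n G x).toLinearMap) ho
  have hsm : ContMDiffOn ((𝓡 q).prod 𝓘(ℝ, B)) (𝓡 n) ∞
      (fun y : G × B => y.1 • ψ y.2) (univ ×ˢ N) :=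
    contMDiff_fst.contMDiffOn.smul (I := 𝓡 q)
      (hψ.comp contMDiff_snd.contMDiffOn fun y hy => hy.2)
  have hopen : IsOpen ((univ : Set G) ×ˢ N) := isOpen_univ.prod hN
  have hmem : ((1 : G), (0 : B)) ∈ (univ : Set G) ×ˢ N := ⟨trivial, h0⟩
  let f' : EuclideanSpace ℝ (Fin q) × B →L[ℝ] EuclideanSpace ℝ (Fin n) :=
    (orbitDeriv q n G x).coprod ψ'
  have hf' : HasMFDerivAt ((𝓡 q).prod 𝓘(ℝ, B)) (𝓡 n) (fun y : G × B => y.1 • ψ y.2) (1, 0) f' := by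
    have hd : MDifferentiableAt ((𝓡 q).prod 𝓘(ℝ, B)) (𝓡 n) (fun y : G × B => y.1 • ψ y.2) (1, 0) :=
      (hsm.contMDiffAt (hopen.mem_nhds hmem)).mdifferentiableAt (by simp)
    refine hd.hasMFDerivAt.congr_mfderiv ?_
    refine ContinuousLinearMap.ext fun v => ?_
    refine (mfderiv_prod_eq_add_apply hd).trans ?_
    refine congrArg₂ (· + ·) ?_ ?_
    · change mfderiv (𝓡 q) (𝓡 n) (fun a : G => a • ψ 0) 1 v.1 = _
      rw [hψ0]; rfl
    · change mfderiv 𝓘(ℝ, B) (𝓡 n) (fun w : B => (1 : G) • ψ w) 0 v.2 = _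
      rw [show (fun w : B => (1 : G) • ψ w) = ψ from funext fun w => one_smul _ _, hψ'.mfderiv]
      rfl
  have hinj : Function.Injective f' := by
    rw [injective_iff_map_eq_zero]
    rintro ⟨ξ, w⟩ h
    have h1 : orbitDeriv q n G x ξ + ψ' w = 0 := h
    have hw : w = 0 := hdis w (-ξ) (by rw [map_neg]; exact eq_neg_of_add_eq_zero_right h1)
    subst hw
    rw [map_zero, add_zero] at h1
    exact Prod.ext (ho (h1.trans (map_zero _).symm)) rfl
  have hdim : Module.finrank ℝ (EuclideanSpace ℝ (Fin q) × B) =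
      Module.finrank ℝ (EuclideanSpace ℝ (Fin n)) := by
    rw [Module.finrank_prod, hB]; simp [hq]
  exact isLocalDiffeomorphAt_of_hasMFDerivAt hopen hsm hmem
    (f' := (LinearEquiv.ofInjectiveOfFinrankEq f'.toLinearMap hinj hdim).toContinuousLinearEquiv)
    hf'

variable (q n G x) in
/-- The linear isotropy representation at `x`. -/
noncomputable def isotropyRep : MulAction.stabilizer G x →*
    (EuclideanSpace ℝ (Fin n) →L[ℝ] EuclideanSpace ℝ (Fin n)) where
  toFun k := mfderiv (𝓡 n) (𝓡 n) (fun y : M => (k : G) • y) x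
  map_one' := by
    have h : (fun y : M => ((1 : MulAction.stabilizer G x) : G) • y) = id := by ext; simp
    rw [h, mfderiv_id]; rfl
  map_mul' k k' := by
    have h1 : HasMFDerivAt (𝓡 n) (𝓡 n) (fun y : M => (k : G) • y) ((k' : G) • x)
        (mfderiv (𝓡 n) (𝓡 n) (fun y : M => (k : G) • y) x :
          EuclideanSpace ℝ (Fin n) →L[ℝ] EuclideanSpace ℝ (Fin n)) := by
      -- The chain rule asks for the derivative at `k' • x`, which is `x` only propositionally; a
      -- variable `y` can be substituted.
      have h : ∀ y, y = x → HasMFDerivAt (𝓡 n) (𝓡 n) (fun y : M => (k : G) • y) y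
        (mfderiv (𝓡 n) (𝓡 n) (fun y : M => (k : G) • y) x :
          EuclideanSpace ℝ (Fin n) →L[ℝ] EuclideanSpace ℝ (Fin n)) := by
        rintro _ rfl
        exact hasMFDerivAt_smul q n _ _
      exact h _ k'.2
    have h2 := h1.comp x (hasMFDerivAt_smul q n (k' : G) x)
    have h3 : (fun y : M => ((k * k' : MulAction.stabilizer G x) : G) • y) =
        (fun y : M => (k : G) • y) ∘ (fun y : M => (k' : G) • y) := by
      ext y; simp [mul_smul]
    rw [h3, h2.mfderiv]; rfl

/-- The isotropy representation preserves the tangent space of the orbit. -/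
lemma isotropyRep_orbitDeriv (k : MulAction.stabilizer G x) (ξ : EuclideanSpace ℝ (Fin q)) :
    ∃ ξ', isotropyRep q n G x k (orbitDeriv q n G x ξ) = orbitDeriv q n G x ξ' := by
  have := topologicalGroup_of_lieGroup (𝓡 q) ∞ (G := G)
  -- Since `k⁻¹` fixes `x`, `k • (a • x) = c a • x`: the isotropy representation acts on the orbit
  -- directions through the derivative of conjugation.
  let c : G → G := fun a => (k : G) * a * (k : G)⁻¹
  have hc : HasMFDerivAt (𝓡 q) (𝓡 q) c 1 (mfderiv (𝓡 q) (𝓡 q) c 1) := by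
    have : ContMDiff (𝓡 q) (𝓡 q) ∞ c :=
      (contMDiff_mul_right (a := (k : G)⁻¹)).comp (contMDiff_mul_left (a := (k : G)))
    exact (this.contMDiffAt.mdifferentiableAt (by simp)).hasMFDerivAt
  have h1 : HasMFDerivAt (𝓡 q) (𝓡 n) (fun a : G => a • x) (c 1) (orbitDeriv q n G x) := by
    have : c 1 = 1 := by simp [c]
    rw [this]
    exact hasMFDerivAt_orbitMap x
  have h2 : HasMFDerivAt (𝓡 n) (𝓡 n) (fun y : M => (k : G) • y) ((1 : G) • x)
      (isotropyRep q n G x k) := by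
    rw [one_smul]
    exact hasMFDerivAt_smul q n _ _
  have h3 := h1.comp 1 hc
  have h4 := h2.comp 1 (hasMFDerivAt_orbitMap (q := q) (n := n) x)
  have h5 : (fun a : G => a • x) ∘ c = (fun y : M => (k : G) • y) ∘ (fun a : G => a • x) := by
    ext a
    have hk : (k : G)⁻¹ • x = x := (k⁻¹).2
    simp [c, mul_smul, hk]
  rw [h5] at h3
  exact ⟨_, congrArg (fun L : EuclideanSpace ℝ (Fin q) →L[ℝ] EuclideanSpace ℝ (Fin n) => L ξ)
    (hasMFDerivAt_unique h4 h3)⟩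

/-- The complement of the tangent space of the orbit with respect to an invariant inner product is
invariant. -/
lemma isotropyRep_mem {b : EuclideanSpace ℝ (Fin n) →L[ℝ] EuclideanSpace ℝ (Fin n) →L[ℝ] ℝ}
    (hb : ∀ k v w, b (isotropyRep q n G x k v) (isotropyRep q n G x k w) = b v w)
    {N : Submodule ℝ (EuclideanSpace ℝ (Fin n))}
    (hN : ∀ v, v ∈ N ↔ ∀ ξ, b v (orbitDeriv q n G x ξ) = 0) (k : MulAction.stabilizer G x)
    {v : EuclideanSpace ℝ (Fin n)} (hv : v ∈ N) : isotropyRep q n G x k v ∈ N := by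
  rw [hN] at hv ⊢
  intro ξ
  -- By invariance of `b`, pairing the image of `v` with an orbit direction is pairing `v` with the
  -- image of that direction under `k⁻¹`, again an orbit direction.
  obtain ⟨ξ', h⟩ := isotropyRep_orbitDeriv (q := q) (n := n) (G := G) k⁻¹ ξ
  have h1 : isotropyRep q n G x k (isotropyRep q n G x k⁻¹ (orbitDeriv q n G x ξ)) =
      orbitDeriv q n G x ξ := by
    change (isotropyRep q n G x k * isotropyRep q n G x k⁻¹) _ = _
    rw [← map_mul, mul_inv_cancel, map_one]; rfl
  rw [← h1, hb, h, hv]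

end Isotropy

/-! ### The action of the isotropy group on a fiber -/

section FiberRepresentation

variable {𝕜 : Type*} [RCLike 𝕜] {G M F : Type*} [Group G] [MulAction G M]
  [AddCommGroup F] [Module 𝕜 F] {E : M → Type*}
  [∀ x, AddCommGroup (E x)] [∀ x, Module 𝕜 (E x)] [MulAction G (TotalSpace F E)]
  [IsVectorBundleAction (F := F) (E := E) 𝕜 G]

/-- The isotropy representation on the fiber. -/
lemma exists_fiber_representation (x : M) (κ : F ≃ₗ[𝕜] E x) :
    ∃ σ : MulAction.stabilizer G x →* (F →ₗ[𝕜] F),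
      ∀ (k : MulAction.stabilizer G x) v, (k : G) • (⟨x, κ v⟩ : TotalSpace F E) = ⟨x, κ (σ k v)⟩ := by
  have h : ∀ k : MulAction.stabilizer G x, ∃ s : F →ₗ[𝕜] F, ∀ v,
      (k : G) • (⟨x, κ v⟩ : TotalSpace F E) = ⟨x, κ (s v)⟩ := by
    intro k
    obtain ⟨L, hL⟩ := IsVectorBundleAction.exists_linear (F := F) (E := E) (𝕜 := 𝕜) (k : G) x
    have hk : (k : G) • x = x := k.2
    revert L
    generalize (k : G) • x = y at hk
    subst hk
    intro L hL
    refine ⟨κ.symm.toLinearMap ∘ₗ L.toLinearMap ∘ₗ κ.toLinearMap, fun v => ?_⟩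
    rw [hL]; simp
  choose s hs using h
  have hinj : ∀ v v', (⟨x, κ v⟩ : TotalSpace F E) = ⟨x, κ v'⟩ → v = v' := fun v v' h =>
    κ.injective (by simpa using h)
  refine ⟨⟨⟨s, ?_⟩, fun k k' => ?_⟩, hs⟩
  · ext1 v
    refine hinj _ _ ?_
    rw [← hs]; simp
  · ext1 v
    refine hinj _ _ ?_
    rw [← hs]
    change _ = (⟨x, κ (s k (s k' v))⟩ : TotalSpace F E)
    rw [← hs, ← hs]; simp [mul_smul]

end FiberRepresentation

/-! ### Linearization of a finite isotropy group in coordinates -/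

section EquivariantCharts

variable {q n : ℕ}
  {G : Type u} [Group G] [TopologicalSpace G] [ChartedSpace (EuclideanSpace ℝ (Fin q)) G]
  [LieGroup (𝓡 q) ∞ G] [T2Space G]
  {M : Type*} [TopologicalSpace M] [ChartedSpace (EuclideanSpace ℝ (Fin n)) M]
  [IsManifold (𝓡 n) ∞ M] [MulAction G M] [ContMDiffSMul (𝓡 q) (𝓡 n) ∞ G M]

lemma contMDiff_const_smul' (q n : ℕ) {G : Type u} [Group G] [TopologicalSpace G]
    [ChartedSpace (EuclideanSpace ℝ (Fin q)) G] {M : Type*} [TopologicalSpace M]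
    [ChartedSpace (EuclideanSpace ℝ (Fin n)) M] [MulAction G M]
    [ContMDiffSMul (𝓡 q) (𝓡 n) ∞ G M] (a : G) : ContMDiff (𝓡 n) (𝓡 n) ∞ (fun y : M => a • y) :=
  ContMDiffSMul.contMDiff_const_smul (I := 𝓡 q) a

variable (q n G) in
/-- Near a point with finite isotropy group there are coordinates in which the isotropy group acts
linearly. -/
lemma exists_equivariant_parametrization (x : M) [Finite (MulAction.stabilizer G x)] :
    ∃ (ψ : EuclideanSpace ℝ (Fin n) → M) (N : Set (EuclideanSpace ℝ (Fin n))),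
      IsOpen N ∧ 0 ∈ N ∧ ContMDiffOn (𝓡 n) (𝓡 n) ∞ ψ N ∧ ψ 0 = x ∧
      HasMFDerivAt (𝓡 n) (𝓡 n) ψ 0 (ContinuousLinearMap.id ℝ (EuclideanSpace ℝ (Fin n))) ∧
      ∀ (k : MulAction.stabilizer G x), ∀ w ∈ N,
        ψ (isotropyRep q n G x k w) = (k : G) • ψ w := by
  have := IsManifold.of_le (I := 𝓡 n) (M := M) (m := 1) (n := ∞) (by simp)
  let K := MulAction.stabilizer G x
  have := Fintype.ofFinite K
  let D : K →* (EuclideanSpace ℝ (Fin n) →L[ℝ] EuclideanSpace ℝ (Fin n)) := isotropyRep q n G x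
  let φ := extChartAt (𝓡 n) x
  have hsm : ∀ k : K, ContMDiff (𝓡 n) (𝓡 n) ∞ (fun y : M => (k : G) • y) := fun k =>
    contMDiff_const_smul' q n _
  have hfix : ∀ k : K, (k : G) • x = x := fun k => k.2
  let O : Set M := ⋂ k : K, (fun y : M => (k : G) • y) ⁻¹' φ.source
  have hO : IsOpen O := isOpen_iInter_of_finite fun k =>
    (isOpen_extChartAt_source x).preimage (hsm k).continuous
  have hxO : x ∈ O := mem_iInter.2 fun k => by
    rw [mem_preimage, hfix]; exact mem_extChartAt_source x
  -- Averaging over `K`: the mean of the `f k` is equivariant, and each `f k` has the identity as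
  -- derivative at `x`, because `D k⁻¹` cancels the derivative of `k`. So the mean is still a local
  -- coordinate.
  let f : K → M → EuclideanSpace ℝ (Fin n) := fun k y => D k⁻¹ (φ ((k : G) • y) - φ x)
  let φ' : M → EuclideanSpace ℝ (Fin n) := fun y => (Fintype.card K : ℝ)⁻¹ • ∑ k, f k y
  have hcard : (Fintype.card K : ℝ) ≠ 0 := by simp
  have hf : ∀ k, ContMDiffOn (𝓡 n) (𝓡 n) ∞ (f k) O := by
    intro k
    have h1 : ContMDiffOn (𝓡 n) (𝓡 n) ∞ (fun y : M => φ ((k : G) • y)) O :=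
      (contMDiffOn_extChartAt (x := x)).comp (hsm k).contMDiffOn fun y hy => by
        have := mem_iInter.1 hy k
        rwa [mem_preimage, extChartAt_source] at this
    have h2 : ContDiff ℝ ∞ (fun z => D k⁻¹ (z - φ x)) :=
      (D k⁻¹).contDiff.comp (contDiff_id.sub contDiff_const)
    exact h2.contMDiff.comp_contMDiffOn h1
  have hφ' : ContMDiffOn (𝓡 n) (𝓡 n) ∞ φ' O := by
    have h1 : ContMDiffOn (𝓡 n) (𝓡 n) ∞ (fun y => ∑ k, f k y) O :=
      contMDiffOn_finsetSum fun k _ => hf k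
    exact (contDiff_const_smul (𝕜 := ℝ) (n := ∞) (F := EuclideanSpace ℝ (Fin n))
      (Fintype.card K : ℝ)⁻¹).contMDiff.comp_contMDiffOn h1
  have hDinv : ∀ k : K, (D k⁻¹).comp (D k) = ContinuousLinearMap.id ℝ _ := fun k => by
    change D k⁻¹ * D k = 1
    rw [← map_mul, inv_mul_cancel, map_one]
  have hfd : ∀ k, HasMFDerivAt (𝓡 n) (𝓡 n) (f k) x
      (ContinuousLinearMap.id ℝ (EuclideanSpace ℝ (Fin n))) := by
    intro k
    have h1 : HasMFDerivAt (𝓡 n) (𝓡 n) φ ((k : G) • x)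
        (ContinuousLinearMap.id ℝ (EuclideanSpace ℝ (Fin n))) := by
      rw [hfix]
      have := (mdifferentiableAt_extChartAt (I := 𝓡 n) (mem_chart_source _ x)).hasMFDerivAt
      rwa [mfderiv_extChartAt_self] at this
    have h2 := h1.comp x (hasMFDerivAt_smul q n (k : G) x)
    have h3 : HasFDerivAt (fun z => D k⁻¹ (z - φ x)) (D k⁻¹) (φ ((k : G) • x)) :=
      (D k⁻¹).hasFDerivAt.comp _ ((hasFDerivAt_id _).sub_const _)
    exact ((hasMFDerivAt_iff_hasFDerivAt.2 h3).comp x h2).congr_mfderiv (hDinv k)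
  have hφ'd : HasMFDerivAt (𝓡 n) (𝓡 n) φ' x
      (ContinuousLinearMap.id ℝ (EuclideanSpace ℝ (Fin n))) := by
    have h1 : ∀ s : Finset K, HasMFDerivAt (𝓡 n) (𝓡 n) (∑ k ∈ s, f k) x
        ((s.card : ℝ) • ContinuousLinearMap.id ℝ (EuclideanSpace ℝ (Fin n))) := by
      classical
      intro s
      induction s using Finset.induction_on with
      | empty =>
        exact (hasMFDerivAt_const (I := 𝓡 n) (0 : EuclideanSpace ℝ (Fin n)) x).congr_mfderiv
          (ContinuousLinearMap.ext fun v => by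
            change (0 : EuclideanSpace ℝ (Fin n)) = ((∅ : Finset K).card : ℝ) • v
            rw [Finset.card_empty, Nat.cast_zero, zero_smul]
            rfl)
      | insert k s hk ih =>
        rw [Finset.sum_insert hk]
        have h3 : ContinuousLinearMap.id ℝ (EuclideanSpace ℝ (Fin n)) + (s.card : ℝ) •
            ContinuousLinearMap.id ℝ (EuclideanSpace ℝ (Fin n)) = ((insert k s).card : ℝ) •
            ContinuousLinearMap.id ℝ (EuclideanSpace ℝ (Fin n)) := by
          refine ContinuousLinearMap.ext fun v => ?_
          change v + (s.card : ℝ) • v = ((insert k s).card : ℝ) • v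
          rw [Finset.card_insert_of_notMem hk, Nat.cast_succ, add_comm (s.card : ℝ), add_smul,
            one_smul]
        exact ((hfd k).add ih).congr_mfderiv h3
    have h2 : φ' = (Fintype.card K : ℝ)⁻¹ • ∑ k, f k := by
      ext1 y; simp [φ']
    rw [h2]
    refine ((h1 Finset.univ).const_smul (Fintype.card K : ℝ)⁻¹).congr_mfderiv ?_
    exact inv_smul_smul₀ hcard _
  have hφ'x : φ' x = 0 := by simp [φ', f, hfix]
  have hφ'eq : ∀ (j : K) y, φ' ((j : G) • y) = D j (φ' y) := by
    intro j y
    simp only [φ', map_smul, map_sum]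
    congr 1
    -- Substituting `k * j` for `k` turns `D j` of each summand at `y` into a summand at `j • y`.
    rw [← Equiv.sum_comp (Equiv.mulRight j) (fun k => D j (f k y))]
    refine Finset.sum_congr rfl fun k _ => ?_
    simp only [f, Equiv.coe_mulRight, mul_inv_rev, map_mul]
    change D k⁻¹ _ = (D j * (D j⁻¹ * D k⁻¹)) _
    rw [← mul_assoc, ← map_mul D j, mul_inv_cancel, map_one, one_mul, Subgroup.coe_mul, mul_smul]
  obtain ⟨Φ, hΦ, hΦe⟩ := isLocalDiffeomorphAt_of_hasMFDerivAt hO hφ' hxO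
    (f' := ContinuousLinearEquiv.refl ℝ _) hφ'd
  have hsymm0 : Φ.symm 0 = x := by
    rw [← hφ'x, hΦe hΦ]; exact Φ.left_inv hΦ
  have h0T : (0 : EuclideanSpace ℝ (Fin n)) ∈ Φ.target := by
    rw [← hφ'x, hΦe hΦ]; exact Φ.map_source hΦ
  -- Equivariance of the inverse requires the translates of the points to remain in the injectivity
  -- domain.
  have hSo : IsOpen (⋂ k : K, (fun y : M => (k : G) • y) ⁻¹' Φ.source) :=
    isOpen_iInter_of_finite fun k => Φ.open_source.preimage (hsm k).continuous
  refine ⟨Φ.symm, Φ.target ∩ Φ.symm ⁻¹' (⋂ k : K, (fun y : M => (k : G) • y) ⁻¹' Φ.source),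
    Φ.symm.contMDiffOn.continuousOn.isOpen_inter_preimage Φ.open_target hSo, ⟨h0T, ?_⟩,
    Φ.symm.contMDiffOn.mono inter_subset_left, hsymm0, ?_, ?_⟩
  · rw [mem_preimage, hsymm0]
    exact mem_iInter.2 fun k => by rw [mem_preimage, hfix]; exact hΦ
  · have h1 : MDifferentiableAt (𝓡 n) (𝓡 n) Φ.symm 0 :=
      (Φ.symm.contMDiffOn.contMDiffAt (Φ.open_target.mem_nhds h0T)).mdifferentiableAt (by simp)
    have h2 : HasMFDerivAt (𝓡 n) (𝓡 n) φ' (Φ.symm 0)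
        (ContinuousLinearMap.id ℝ (EuclideanSpace ℝ (Fin n))) := by rw [hsymm0]; exact hφ'd
    have h3 := h2.comp 0 h1.hasMFDerivAt
    have h4 : HasMFDerivAt (𝓡 n) (𝓡 n) (φ' ∘ Φ.symm) 0
        (ContinuousLinearMap.id ℝ (EuclideanSpace ℝ (Fin n))) := by
      refine (hasMFDerivAt_id (I := 𝓡 n) (0 : EuclideanSpace ℝ (Fin n))).congr_of_eventuallyEq ?_
      filter_upwards [Φ.open_target.mem_nhds h0T] with y hy
      exact (hΦe (Φ.map_target hy)).trans (Φ.right_inv hy)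
    refine h1.hasMFDerivAt.congr_mfderiv ?_
    have h5 := hasMFDerivAt_unique h3 h4
    exact (ContinuousLinearMap.id_comp _).symm.trans h5
  · rintro k w ⟨hw, hw'⟩
    have h1 : (k : G) • Φ.symm w ∈ Φ.source := mem_iInter.1 hw' k
    have h2 : Φ.symm w ∈ Φ.source := Φ.map_target hw
    have h3 : Φ ((k : G) • Φ.symm w) = D k w := by
      rw [← hΦe h1, hφ'eq, hΦe h2]
      exact congrArg (D k) (Φ.right_inv hw)
    rw [show isotropyRep q n G x k w = D k w from rfl, ← h3]
    exact Φ.left_inv h1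

end EquivariantCharts

/-! ### Equivariant bundle maps by averaging -/

section EquivariantBundleMaps

variable {𝕜 : Type*} [RCLike 𝕜] {n : ℕ} {G : Type u} [Group G]
  {M : Type*} [TopologicalSpace M] [ChartedSpace (EuclideanSpace ℝ (Fin n)) M]
  {F : Type*} [NormedAddCommGroup F] [NormedSpace ℝ F] [NormedSpace 𝕜 F] [IsScalarTower ℝ 𝕜 F]
  [FiniteDimensional ℝ F]
  {E : M → Type*} [TopologicalSpace (TotalSpace F E)]
  [∀ x, AddCommGroup (E x)] [∀ x, Module ℝ (E x)] [∀ x, Module 𝕜 (E x)]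
  [∀ x, IsScalarTower ℝ 𝕜 (E x)] [∀ x, TopologicalSpace (E x)]
  [FiberBundle F E] [VectorBundle ℝ F E] [VectorBundle 𝕜 F E] [ContMDiffVectorBundle ∞ F E (𝓡 n)]
  [MulAction G M] [MulAction G (TotalSpace F E)]
  [IsVectorBundleAction (F := F) (E := E) 𝕜 G]
  {B : Type*} [NormedAddCommGroup B] [NormedSpace ℝ B]

/-- The action of `a` in a local trivialization is linear. -/
lemma exists_linearMap_trivialization (e : Trivialization F (TotalSpace.proj : TotalSpace F E → M))
    [MemTrivializationAtlas e] (a : G) {y : M} (hy : y ∈ e.baseSet) (hay : a • y ∈ e.baseSet) :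
    ∃ T : F →ₗ[𝕜] F, ∀ v, (e (a • (⟨y, e.symm y v⟩ : TotalSpace F E))).2 = T v := by
  obtain ⟨L, hL⟩ := IsVectorBundleAction.exists_linear (F := F) (E := E) (𝕜 := 𝕜) a y
  refine ⟨(e.linearEquivAt 𝕜 _ hay).toLinearMap ∘ₗ L.toLinearMap ∘ₗ
    (e.linearEquivAt 𝕜 y hy).symm.toLinearMap, fun v => ?_⟩
  rw [hL]; rfl

/-- An equivariant parametrization near `x` is covered by an equivariant bundle map. -/
lemma exists_equivariant_bundleMap (q : ℕ) [TopologicalSpace G]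
    [ChartedSpace (EuclideanSpace ℝ (Fin q)) G]
    [ContMDiffSMul (𝓡 q) ((𝓡 n).prod 𝓘(ℝ, F)) ∞ G (TotalSpace F E)] {x : M} [Finite (MulAction.stabilizer G x)]
    (ρ : MulAction.stabilizer G x →* (B →L[ℝ] B)) {ψ : B → M} {N : Set B} (hN : IsOpen N)
    (h0 : 0 ∈ N) (hψ : ContMDiffOn 𝓘(ℝ, B) (𝓡 n) ∞ ψ N) (hψ0 : ψ 0 = x)
    (hψeq : ∀ (k : MulAction.stabilizer G x), ∀ w ∈ N, ψ (ρ k w) = (k : G) • ψ w) :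
    ∃ (σ : MulAction.stabilizer G x →* (F →ₗ[𝕜] F)) (Ψ : B × F → TotalSpace F E) (N' : Set B),
      IsOpen N' ∧ 0 ∈ N' ∧ N' ⊆ N ∧
      ContMDiffOn (𝓘(ℝ, B).prod 𝓘(ℝ, F)) ((𝓡 n).prod 𝓘(ℝ, F)) ∞ Ψ (N' ×ˢ univ) ∧
      (∀ w ∈ N', ∃ L : F ≃ₗ[𝕜] E (ψ w), ∀ v, Ψ (w, v) = ⟨ψ w, L v⟩) ∧
      ∀ (k : MulAction.stabilizer G x), ∀ w ∈ N', ρ k w ∈ N' → ∀ v,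
        Ψ (ρ k w, σ k v) = (k : G) • Ψ (w, v) := by
  let K := MulAction.stabilizer G x
  have := Fintype.ofFinite K
  let e := trivializationAt F E x
  have hxe : x ∈ e.baseSet := FiberBundle.mem_baseSet_trivializationAt' x
  obtain ⟨σ, hσ⟩ := exists_fiber_representation (G := G) (F := F) x (e.linearEquivAt 𝕜 x hxe).symm
  have hσsm : ∀ k, ContDiff ℝ ∞ (σ k) := fun k =>
    (LinearMap.toContinuousLinearMap ((σ k).restrictScalars ℝ)).contDiff
  have hρmul : ∀ k k' w, ρ (k * k') w = ρ k (ρ k' w) := fun k k' w => by simp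
  have hρ1 : ∀ w, ρ 1 w = w := fun w => by simp
  have hσmul : ∀ k k' v, σ (k * k') v = σ k (σ k' v) := fun k k' w => by simp
  -- the domain on which all points `k • ψ w` lie in the trivializing neighborhood
  let N₁ : Set B := ⋂ k : K, ρ k ⁻¹' (N ∩ ψ ⁻¹' e.baseSet)
  have hN₁ : IsOpen N₁ := isOpen_iInter_of_finite fun k =>
    (hψ.continuousOn.isOpen_inter_preimage hN e.open_baseSet).preimage (ρ k).continuous
  have h0N₁ : (0 : B) ∈ N₁ := mem_iInter.2 fun k => by
    rw [mem_preimage, map_zero]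
    exact ⟨h0, by rw [mem_preimage, hψ0]; exact hxe⟩
  have hN₁k : ∀ {w} (k : K), w ∈ N₁ → ρ k w ∈ N ∧ ψ (ρ k w) ∈ e.baseSet :=
    fun k hw => mem_iInter.1 hw k
  have hN₁N : ∀ {w}, w ∈ N₁ → w ∈ N ∧ ψ w ∈ e.baseSet := fun hw => by
    simpa [hρ1] using hN₁k 1 hw
  have hkinv : ∀ (k : K) {w}, w ∈ N₁ → (k : G)⁻¹ • ψ (ρ k w) = ψ w := fun k w hw => by
    rw [hψeq k w (hN₁N hw).1, inv_smul_smul]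
  -- The bundle map that is constant in the trivialization, conjugated by `k`. All of these cover
  -- `ψ`, so they can be added in fibers.
  let P : K → B × F → TotalSpace F E := fun k y =>
    (k : G)⁻¹ • (⟨ψ (ρ k y.1), e.symm (ψ (ρ k y.1)) (σ k y.2)⟩ : TotalSpace F E)
  have hPproj : ∀ k {w}, w ∈ N₁ → ∀ v, (P k (w, v)).proj = ψ w := fun k w hw v => by
    rw [show P k (w, v) = (k : G)⁻¹ • _ from rfl, proj_smul 𝕜]
    exact hkinv k hw
  have hPsrc : ∀ k {w}, w ∈ N₁ → ∀ v, P k (w, v) ∈ e.source := fun k w hw v => by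
    rw [e.mem_source, hPproj k hw]; exact (hN₁N hw).2
  have hT : ∀ w k, ∃ T : F →ₗ[𝕜] F, w ∈ N₁ → ∀ v, (e (P k (w, v))).2 = T v := by
    intro w k
    by_cases hw : w ∈ N₁
    · obtain ⟨T, hT⟩ := exists_linearMap_trivialization (𝕜 := 𝕜) e (k : G)⁻¹ (hN₁k k hw).2
        (by rw [hkinv k hw]; exact (hN₁N hw).2)
      exact ⟨T ∘ₗ σ k, fun _ v => hT _⟩
    · exact ⟨0, fun h => (hw h).elim⟩
  choose T hT using hT
  -- The sum need not be normalized: at `0` it is multiplication by the order of `K`, which is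
  -- invertible, and invertibility persists nearby.
  let A : B → F →ₗ[𝕜] F := fun w => ∑ k, T w k
  have hAapp : ∀ w v, A w v = ∑ k, T w k v := fun w v => LinearMap.sum_apply _ _ _
  have hsymm : ∀ {f : B × F → B} {g : B × F → F}, ContDiff ℝ ∞ f →
      ContMDiffOn (𝓘(ℝ, B).prod 𝓘(ℝ, F)) 𝓘(ℝ, F) ∞ g (N₁ ×ˢ univ) →
      (∀ y ∈ N₁ ×ˢ univ, f y ∈ N ∧ ψ (f y) ∈ e.baseSet) →
      ContMDiffOn (𝓘(ℝ, B).prod 𝓘(ℝ, F)) ((𝓡 n).prod 𝓘(ℝ, F)) ∞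
        (fun y => (⟨ψ (f y), e.symm (ψ (f y)) (g y)⟩ : TotalSpace F E)) (N₁ ×ˢ univ) := by
    intro f g hf hg hfN
    have h1 : ContMDiffOn (𝓘(ℝ, B).prod 𝓘(ℝ, F)) 𝓘(ℝ, B) ∞ f (N₁ ×ˢ univ) :=
      contMDiffOn_prod_self_iff.2 hf.contDiffOn
    have h2 := (hψ.comp h1 fun y hy => (hfN y hy).1).prodMk hg
    refine (e.contMDiffOn_symm.comp h2 fun y hy => ?_).congr fun y hy => ?_
    · rw [e.target_eq]; exact ⟨(hfN y hy).2, trivial⟩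
    · exact e.mk_symm (hfN y hy).2 _
  have hPsm : ∀ k, ContMDiffOn (𝓘(ℝ, B).prod 𝓘(ℝ, F)) ((𝓡 n).prod 𝓘(ℝ, F)) ∞ (P k)
      (N₁ ×ˢ univ) := fun k =>
    (ContMDiffSMul.contMDiff_const_smul (I := 𝓡 q) (k : G)⁻¹).comp_contMDiffOn
      (hsymm ((ρ k).contDiff.comp contDiff_fst)
        (contMDiffOn_prod_self_iff.2 ((hσsm k).comp contDiff_snd).contDiffOn)
        fun y hy => hN₁k k hy.1)
  have hAsm : ContMDiffOn (𝓘(ℝ, B).prod 𝓘(ℝ, F)) 𝓘(ℝ, F) ∞ (fun y => A y.1 y.2)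
      (N₁ ×ˢ univ) := by
    have h1 : ∀ k, ContMDiffOn (𝓘(ℝ, B).prod 𝓘(ℝ, F)) 𝓘(ℝ, F) ∞ (fun y => (e (P k y)).2)
        (N₁ ×ˢ univ) := fun k => contMDiff_snd.comp_contMDiffOn
      ((e.contMDiffOn (n := ∞) (IB := 𝓡 n)).comp (hPsm k) fun y hy => hPsrc k hy.1 y.2)
    refine (contMDiffOn_finsetSum (t := Finset.univ) fun k _ => h1 k).congr fun y hy => ?_
    rw [hAapp]
    exact Finset.sum_congr rfl fun k _ => (hT y.1 k hy.1 y.2).symm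
  let A' : B → F →L[ℝ] F := fun w => LinearMap.toContinuousLinearMap ((A w).restrictScalars ℝ)
  have hA'c : ContinuousOn A' N₁ := by
    refine (contDiffOn_zero (𝕜 := ℝ)).1 (contDiffOn_clm_apply.2 fun v => ?_)
    have h1 := (contMDiffOn_prod_self_iff.1 hAsm).comp (s := N₁)
      (g := fun y : B × F => A y.1 y.2) (f := fun w => (w, v))
      (contDiff_id.prodMk contDiff_const).contDiffOn fun w hw => ⟨hw, trivial⟩
    exact h1.of_le (by simp)
  have hA0 : ∀ v, A 0 v = (Fintype.card K : ℝ) • v := by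
    intro v
    rw [hAapp]
    have h1 : ∀ k, T 0 k v = v := by
      intro k
      rw [← hT 0 k h0N₁ v]
      have h2 : P k (0, v) = ⟨x, (e.linearEquivAt 𝕜 x hxe).symm v⟩ := by
        have h3 : P k (0, v) = (k : G)⁻¹ • (⟨x, (e.linearEquivAt 𝕜 x hxe).symm (σ k v)⟩ :
            TotalSpace F E) := by
          have h4 : ∀ y, y = x → ∀ u, (⟨y, e.symm y u⟩ : TotalSpace F E) =
              ⟨x, (e.linearEquivAt 𝕜 x hxe).symm u⟩ := by
            rintro _ rfl u; rfl
          exact congrArg _ (h4 _ (by rw [map_zero, hψ0]) _)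
        rw [h3, ← hσ, inv_smul_smul]
      rw [h2]
      exact (e.linearEquivAt 𝕜 x hxe).apply_symm_apply v
    simp [h1, Nat.cast_smul_eq_nsmul]
  have hcard : (Fintype.card K : ℝ) ≠ 0 := by simp
  have hA'0 : A' 0 = (ContinuousLinearEquiv.smulLeft (Units.mk0 _ hcard) : F ≃L[ℝ] F) := by
    ext v; exact hA0 v
  have hinv : A' ⁻¹' range ContinuousLinearEquiv.toContinuousLinearMap ∈ 𝓝 (0 : B) :=
    (hA'c.continuousAt (hN₁.mem_nhds h0N₁)).preimage_mem_nhds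
      (by rw [hA'0]; exact ContinuousLinearEquiv.nhds _)
  obtain ⟨N', hN', hN'o, h0N'⟩ := mem_nhds_iff.1 (Filter.inter_mem hinv (hN₁.mem_nhds h0N₁))
  refine ⟨σ, fun y => ⟨ψ y.1, e.symm (ψ y.1) (A y.1 y.2)⟩, N', hN'o, h0N',
    fun w hw => (hN₁N (hN' hw).2).1, ?_, ?_, ?_⟩
  · exact (hsymm contDiff_fst hAsm fun y hy => hN₁N hy.1).mono
      (prod_mono (fun w hw => (hN' hw).2) subset_rfl)
  · intro w hw
    obtain ⟨a, ha⟩ := (hN' hw).1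
    have hbij : Function.Bijective (A w) := by
      have h1 : (A w : F → F) = a := by
        ext v; exact (congrArg (fun L : F →L[ℝ] F => L v) ha).symm
      rw [h1]; exact a.bijective
    exact ⟨(LinearEquiv.ofBijective (A w) hbij).trans
      (e.linearEquivAt 𝕜 (ψ w) (hN₁N (hN' hw).2).2).symm, fun v => rfl⟩
  · intro j w hw hjw v
    have hw₁ := (hN' hw).2
    have hjw₁ := (hN' hjw).2
    have hψj : ψ (ρ j w) = (j : G) • ψ w := hψeq j w (hN₁N hw₁).1
    have hsrc : ∀ Z : TotalSpace F E, Z.proj = ψ w → (j : G) • Z ∈ e.source := fun Z hZ => by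
      rw [e.mem_source, proj_smul 𝕜, hZ, ← hψj]; exact (hN₁N hjw₁).2
    obtain ⟨S, hS⟩ := exists_linearMap_trivialization (𝕜 := 𝕜) e (j : G) (hN₁N hw₁).2
      (by rw [← hψj]; exact (hN₁N hjw₁).2)
    -- Acting by `j` carries the summand of `k` at `w` to the summand of `k * j⁻¹` at `ρ j w`, so
    -- the sums agree after reindexing.
    have hterm : ∀ k, S (T w k v) = T (ρ j w) (k * j⁻¹) (σ j v) := by
      intro k
      rw [← hS, ← hT w k hw₁, ← hT _ _ hjw₁]
      have h1 : (⟨ψ w, e.symm (ψ w) (e (P k (w, v))).2⟩ : TotalSpace F E) = P k (w, v) := by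
        rw [e.mk_symm (hN₁N hw₁).2]
        conv_lhs => rw [← hPproj k hw₁ v]
        exact e.symm_apply_mk_proj (hPsrc k hw₁ v)
      rw [h1]
      have h2 : P (k * j⁻¹) (ρ j w, σ j v) = (j : G) • P k (w, v) := by
        have a1 : ρ (k * j⁻¹) (ρ j w) = ρ k w := by rw [← hρmul, inv_mul_cancel_right]
        have a2 : σ (k * j⁻¹) (σ j v) = σ k v := by rw [← hσmul, inv_mul_cancel_right]
        simp only [P]
        rw [a1, a2, smul_smul]
        simp
      rw [h2]
    have hsrc' : (⟨ψ (ρ j w), e.symm (ψ (ρ j w)) (A (ρ j w) (σ j v))⟩ : TotalSpace F E) ∈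
        e.source := by
      rw [e.mem_source]; exact (hN₁N hjw₁).2
    refine e.injOn hsrc' (hsrc _ rfl) (Prod.ext ?_ ?_)
    · refine (e.coe_fst hsrc').trans (Eq.trans ?_ (e.coe_fst (hsrc _ rfl)).symm)
      rw [proj_smul 𝕜]
      exact hψj
    · refine (congrArg Prod.snd (e.apply_mk_symm (hN₁N hjw₁).2 _)).trans ?_
      refine Eq.trans ?_ (hS _).symm
      change A (ρ j w) (σ j v) = _
      rw [hAapp, hAapp, map_sum, ← Equiv.sum_comp (Equiv.mulRight j⁻¹) (fun k =>
        T (ρ j w) k (σ j v))]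
      exact Finset.sum_congr rfl fun k _ => (hterm k).symm

end EquivariantBundleMaps

/-! ### Locally induced charts at every orbit, without a metric or a connection -/

section Cover

variable {𝕜 : Type*} [RCLike 𝕜] {q n : ℕ}
  {G : Type u} [Group G] [TopologicalSpace G] [ChartedSpace (EuclideanSpace ℝ (Fin q)) G]
  [LieGroup (𝓡 q) ∞ G] [CompactSpace G] [T2Space G]
  {M : Type*} [TopologicalSpace M] [ChartedSpace (EuclideanSpace ℝ (Fin n)) M]
  [IsManifold (𝓡 n) ∞ M] [T2Space M]
  {F : Type*} [NormedAddCommGroup F] [NormedSpace ℝ F] [NormedSpace 𝕜 F] [IsScalarTower ℝ 𝕜 F]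
  [FiniteDimensional ℝ F]
  {E : M → Type*} [TopologicalSpace (TotalSpace F E)]
  [∀ x, AddCommGroup (E x)] [∀ x, Module ℝ (E x)] [∀ x, Module 𝕜 (E x)]
  [∀ x, IsScalarTower ℝ 𝕜 (E x)] [∀ x, TopologicalSpace (E x)]
  [FiberBundle F E] [VectorBundle ℝ F E] [VectorBundle 𝕜 F E] [ContMDiffVectorBundle ∞ F E (𝓡 n)]
  [MulAction G M] [ContMDiffSMul (𝓡 q) (𝓡 n) ∞ G M]
  [MulAction G (TotalSpace F E)]
  [ContMDiffSMul (𝓡 q) ((𝓡 n).prod 𝓘(ℝ, F)) ∞ G (TotalSpace F E)]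
  [IsVectorBundleAction (F := F) (E := E) 𝕜 G]

variable (q n G) in
-- Sum the pullbacks of the Euclidean product under the isotropy representation; the term of the
-- identity makes the sum positive. An inner product on the single space `T_x M` suffices for
-- constructing a slice.
lemma exists_invariant_inner (x : M) [Finite (MulAction.stabilizer G x)] :
    ∃ b : EuclideanSpace ℝ (Fin n) →L[ℝ] EuclideanSpace ℝ (Fin n) →L[ℝ] ℝ,
      (∀ v w, b v w = b w v) ∧ (∀ v, v ≠ 0 → 0 < b v v) ∧
      ∀ k v w, b (isotropyRep q n G x k v) (isotropyRep q n G x k w) = b v w := by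
  have := Fintype.ofFinite (MulAction.stabilizer G x)
  let D := isotropyRep q n G x
  let b : EuclideanSpace ℝ (Fin n) →L[ℝ] EuclideanSpace ℝ (Fin n) →L[ℝ] ℝ :=
    ∑ k, (innerSL ℝ).bilinearComp (D k) (D k)
  have hb : ∀ v w, b v w = ∑ k, inner ℝ (D k v) (D k w) := fun v w => by
    simp [b]
  refine ⟨b, fun v w => ?_, fun v hv => ?_, fun j v w => ?_⟩
  · rw [hb, hb]
    exact Finset.sum_congr rfl fun k _ => real_inner_comm _ _
  · rw [hb]
    refine Finset.sum_pos' (fun k _ => real_inner_self_nonneg) ⟨1, Finset.mem_univ _, ?_⟩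
    rw [map_one]
    exact real_inner_self_pos.2 hv
  · rw [hb, hb, ← Equiv.sum_comp (Equiv.mulRight j) (fun k => inner ℝ (D k v) (D k w))]
    refine Finset.sum_congr rfl fun k _ => ?_
    simp only [Equiv.coe_mulRight, map_mul]
    rfl

variable (F E) in
/-- Locally induced charts cover the orbit space. -/
theorem exists_isLocallyInduced (x : M) [Finite (MulAction.stabilizer G x)]
    (effective : Dense {y : M | ∀ a : G, a • y = y →
      ∀ v : E y, a • (⟨y, v⟩ : TotalSpace F E) = ⟨y, v⟩}) :
    ∃ (Γ : Type u) (_ : Group Γ) (_ : Finite Γ)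
      (c : VectorOrbibundleChart 𝕜 Γ (EuclideanSpace ℝ (Fin (n - q))) F
        (orbitProj (F := F) (E := E) 𝕜 G)),
      c.IsLocallyInduced G ∧ Quotient.mk _ x ∈ c.base.target := by
  obtain ⟨b, hsymm, hpos, hinv⟩ := exists_invariant_inner q n G x
  let N : Submodule ℝ (EuclideanSpace ℝ (Fin n)) :=
    { carrier := {v | ∀ ξ, b v (orbitDeriv q n G x ξ) = 0}
      zero_mem' := fun ξ => by simp
      add_mem' := fun {v w} hv hw ξ => by simp [hv ξ, hw ξ]
      smul_mem' := fun r v hv ξ => by simp [hv ξ] }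
  have hN : ∀ v, v ∈ N ↔ ∀ ξ, b v (orbitDeriv q n G x ξ) = 0 := fun v => Iff.rfl
  have ho := orbitDeriv_injective (q := q) (n := n) (G := G) (x := x)
  have hfr : Module.finrank ℝ N = n - q := by
    have := finrank_forall_eq_zero hsymm hpos ho hN
    simpa using this
  let ν : EuclideanSpace ℝ (Fin (n - q)) ≃ₗ[ℝ] N := LinearEquiv.ofFinrankEq _ _ (by simp [hfr])
  obtain ⟨ρ, hρ⟩ := exists_restrict_representation (isotropyRep q n G x)
    (fun k v hv => isotropyRep_mem hinv hN k hv) ν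
  obtain ⟨ψ₀, N₀, hN₀, h0N₀, hψ₀, hψ₀0, hψ₀d, hψ₀eq⟩ := exists_equivariant_parametrization q n G x
  let ν' : EuclideanSpace ℝ (Fin (n - q)) →L[ℝ] EuclideanSpace ℝ (Fin n) :=
    LinearMap.toContinuousLinearMap (N.subtype ∘ₗ ν.toLinearMap)
  have hν' : ∀ w, ν' w = ν w := fun w => rfl
  let ψ : EuclideanSpace ℝ (Fin (n - q)) → M := fun w => ψ₀ (ν' w)
  have hN₁ : IsOpen (ν' ⁻¹' N₀) := hN₀.preimage ν'.continuous
  have h0N₁ : (0 : EuclideanSpace ℝ (Fin (n - q))) ∈ ν' ⁻¹' N₀ := by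
    rw [mem_preimage, map_zero]; exact h0N₀
  have hψ : ContMDiffOn (𝓡 (n - q)) (𝓡 n) ∞ ψ (ν' ⁻¹' N₀) :=
    hψ₀.comp ν'.contDiff.contMDiff.contMDiffOn fun w hw => hw
  have hψ0 : ψ 0 = x := by simp only [ψ, map_zero, hψ₀0]
  have hψeq : ∀ (k : MulAction.stabilizer G x), ∀ w ∈ ν' ⁻¹' N₀, ψ (ρ k w) = (k : G) • ψ w := by
    intro k w hw
    rw [← hψ₀eq k _ hw]
    simp only [ψ, hν', hρ]
  have hψd : HasMFDerivAt (𝓡 (n - q)) (𝓡 n) ψ 0 ν' := by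
    have h1 : HasMFDerivAt (𝓡 n) (𝓡 n) ψ₀ (ν' 0)
        (ContinuousLinearMap.id ℝ (EuclideanSpace ℝ (Fin n))) := by rw [map_zero]; exact hψ₀d
    exact h1.comp 0 (hasMFDerivAt_iff_hasFDerivAt.2 ν'.hasFDerivAt)
  obtain ⟨σ, Ψ, N', hN'o, h0N', hN'N, hΨ, hL, hΨeq⟩ := exists_equivariant_bundleMap (𝕜 := 𝕜)
    (F := F) (E := E) q ρ hN₁ h0N₁ hψ hψ0 hψeq
  have hF := isLocalDiffeomorphAt_smul_of_disjoint (q := q) (G := G) (by simp) hN₁ hψ h0N₁ hψ0 hψd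
    -- A vector that is both normal and tangent to the orbit is orthogonal to itself, hence zero.
    (fun w ξ hw => by
      have h1 : b (ν' w) (orbitDeriv q n G x ξ) = 0 := (ν w).2 ξ
      rw [← hw] at h1
      by_contra hne
      refine (hpos _ ?_).ne' h1
      intro h2
      exact hne (ν.injective (Subtype.ext (h2.trans (by simp)))))
  obtain ⟨Γ, i1, i2, c, θ, h0c, hsub, hθ, hact, hactT, hslice, hinj, hp, hP⟩ :=
    exists_tubeChart (𝕜 := 𝕜) (F := F) (E := E) effective ρ σ hN'o h0N' (hψ.mono hN'N) hψ0 hΨ hL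
      (fun k w hw _ => hψeq k w (hN'N hw)) hΨeq hF Filter.univ_mem
  refine ⟨Γ, i1, i2, c, fun w hw => ⟨c.base.source, ψ, Ψ, c.base.isOpen_source, hw, subset_rfl,
    hslice.contMDiffOn, hΨ.mono (prod_mono (fun w hw => (hsub hw).2) subset_rfl),
    fun z hz => hL z (hsub hz).2, hslice.isLocalDiffeomorphOn, fun z _ => hp z,
    fun z _ v => hP _⟩, ?_⟩
  have := c.base.proj_mapsTo h0c
  rwa [hp, hψ0] at this

end Cover

/-! ### Covariant derivatives in local trivializations and along curves -/

section FrameFormula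

variable {n : ℕ} {M : Type*} [TopologicalSpace M] [ChartedSpace (EuclideanSpace ℝ (Fin n)) M]
  [IsManifold (𝓡 n) ∞ M]
  {F : Type*} [NormedAddCommGroup F] [NormedSpace ℝ F] [FiniteDimensional ℝ F]
  {E : M → Type*} [TopologicalSpace (TotalSpace F E)]
  [∀ x, AddCommGroup (E x)] [∀ x, Module ℝ (E x)] [∀ x, TopologicalSpace (E x)]
  [∀ x, IsTopologicalAddGroup (E x)] [∀ x, ContinuousSMul ℝ (E x)] [FiberBundle F E]
  [VectorBundle ℝ F E] [ContMDiffVectorBundle ∞ F E (𝓡 n)]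
  (cov : CovariantDerivative (𝓡 n) F E)
  (e : Trivialization F (TotalSpace.proj : TotalSpace F E → M)) [MemTrivializationAtlas e]
  {x : M}

lemma contMDiffVectorBundle_one : ContMDiffVectorBundle 1 F E (𝓡 n) :=
  ContMDiffVectorBundle.of_le (n := ∞) (by simp)

variable {e} in
lemma mdifferentiableAt_trivialization_snd {σ : ∀ y, E y} (hx : x ∈ e.baseSet)
    (hσ : MDifferentiableAt (𝓡 n) ((𝓡 n).prod 𝓘(ℝ, F))
      (fun y => (⟨y, σ y⟩ : TotalSpace F E)) x) :
    MDifferentiableAt (𝓡 n) 𝓘(ℝ, F) (fun y => (e ⟨y, σ y⟩).2) x := by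
  have := contMDiffVectorBundle_one (n := n) (F := F) (E := E)
  exact (e.mdifferentiableAt_section_iff (𝓡 n) σ hx).1 hσ

variable {e} in
lemma contMDiffOn_symm_const (v : F) :
    ContMDiffOn (𝓡 n) ((𝓡 n).prod 𝓘(ℝ, F)) ∞
      (fun y => (⟨y, e.symm y v⟩ : TotalSpace F E)) e.baseSet := by
  refine (e.contMDiffOn_section_baseSet_iff (s := fun y => e.symm y v)).2 ?_
  refine (contMDiffOn_const (c := v)).congr fun y hy => ?_
  rw [e.apply_mk_symm hy]

variable {e} in
lemma mdifferentiableAt_symm_const (hx : x ∈ e.baseSet) (v : F) :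
    MDifferentiableAt (𝓡 n) ((𝓡 n).prod 𝓘(ℝ, F))
      (fun y => (⟨y, e.symm y v⟩ : TotalSpace F E)) x :=
  ((contMDiffOn_symm_const v).contMDiffAt (e.open_baseSet.mem_nhds hx)).mdifferentiableAt
    (by simp)

/-- The covariant derivative for which the `e`-constant sections are parallel. -/
noncomputable def flatDeriv (σ : ∀ y, E y) (y : M) : TangentSpace (𝓡 n) y →L[ℝ] E y :=
  (e.symmL ℝ y).comp (mvfderiv (𝓡 n) (fun z => (e ⟨z, σ z⟩).2) y)

/-- Additivity and the Leibniz rule are those of the ordinary derivative, carried over by the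
trivialization, which is fiberwise linear on its base set. -/
lemma isCovariantDerivativeOn_flatDeriv :
    IsCovariantDerivativeOn F (flatDeriv (n := n) e) e.baseSet where
  add {σ σ' y} hσ hσ' hy := by
    have h : mvfderiv (𝓡 n) (fun z => (e ⟨z, (σ + σ') z⟩).2) y =
        mvfderiv (𝓡 n) ((fun z => (e ⟨z, σ z⟩).2) + fun z => (e ⟨z, σ' z⟩).2) y := by
      have hev : (fun z => (e ⟨z, (σ + σ') z⟩).2) =ᶠ[𝓝 y]
          ((fun z => (e ⟨z, σ z⟩).2) + fun z => (e ⟨z, σ' z⟩).2) := by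
        filter_upwards [e.open_baseSet.mem_nhds hy] with z hz
        exact (e.linear ℝ hz).map_add (σ z) (σ' z)
      unfold mvfderiv
      ext v
      exact congrArg (fun L : EuclideanSpace ℝ (Fin n) →L[ℝ] F => L v) hev.mfderiv_eq
    unfold flatDeriv
    rw [h, mvfderiv_add (mdifferentiableAt_trivialization_snd hy hσ)
      (mdifferentiableAt_trivialization_snd hy hσ'), ContinuousLinearMap.comp_add]
  leibniz {σ g y} hσ hg hy := by
    have h : mvfderiv (𝓡 n) (fun z => (e ⟨z, (g • σ) z⟩).2) y =
        mvfderiv (𝓡 n) (g • fun z => (e ⟨z, σ z⟩).2) y := by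
      have hev : (fun z => (e ⟨z, (g • σ) z⟩).2) =ᶠ[𝓝 y] (g • fun z => (e ⟨z, σ z⟩).2) := by
        filter_upwards [e.open_baseSet.mem_nhds hy] with z hz
        exact (e.linear ℝ hz).map_smul (g z) (σ z)
      unfold mvfderiv
      ext v
      exact congrArg (fun L : EuclideanSpace ℝ (Fin n) →L[ℝ] F => L v) hev.mfderiv_eq
    unfold flatDeriv
    rw [h, mvfderiv_smul hg (mdifferentiableAt_trivialization_snd hy hσ)]
    ext v
    have hsp : e.symmL ℝ y (e ⟨y, σ y⟩).2 = σ y :=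
      (e.symmL_apply hy _).trans (e.symm_proj_apply ⟨y, σ y⟩ hy)
    simp [hsp]

/-- A covariant derivative is a flat derivative plus a tensor. -/
lemma exists_connectionForm (hx : x ∈ e.baseSet) :
    ∃ A : E x →L[ℝ] TangentSpace (𝓡 n) x →L[ℝ] E x, ∀ σ : ∀ y, E y,
      MDifferentiableAt (𝓡 n) ((𝓡 n).prod 𝓘(ℝ, F))
        (fun y => (⟨y, σ y⟩ : TotalSpace F E)) x →
      ∀ X : TangentSpace (𝓡 n) x, cov σ x X =
        e.symm x (mvfderiv (𝓡 n) (fun z => (e ⟨z, σ z⟩).2) x X) + A (σ x) X := by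
  have := contMDiffVectorBundle_one (n := n) (F := F) (E := E)
  refine ⟨(cov.isCovariantDerivativeOn (s := e.baseSet)).difference
    (isCovariantDerivativeOn_flatDeriv e) x, fun σ hσ X => ?_⟩
  rw [IsCovariantDerivativeOn.difference_apply _ _ hx hσ]
  have hsp := e.symmL_apply (R := ℝ) hx (mvfderiv (𝓡 n) (fun z => (e ⟨z, σ z⟩).2) x X)
  rw [← hsp]
  exact (add_sub_cancel (flatDeriv e σ x X) (cov σ x X)).symm

variable {e} in
lemma mvfderiv_symm_const (hx : x ∈ e.baseSet) (v : F) :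
    mvfderiv (𝓡 n) (fun z => (e ⟨z, e.symm z v⟩).2) x = 0 := by
  have hev : (fun z => (e ⟨z, e.symm z v⟩).2) =ᶠ[𝓝 x] fun _ => v := by
    filter_upwards [e.open_baseSet.mem_nhds hx] with z hz
    rw [e.apply_mk_symm hz]
  refine Eq.trans ?_ (mvfderiv_const (I := 𝓡 n) (x := x) v)
  unfold mvfderiv
  ext X
  exact congrArg (fun L : EuclideanSpace ℝ (Fin n) →L[ℝ] F => L X) hev.mfderiv_eq

/-- For constant sections the flat part vanishes and only the tensor remains, which is linear in the
value and in the direction. -/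
lemma exists_covDeriv_symm_const (hx : x ∈ e.baseSet) :
    ∃ A : F →ₗ[ℝ] TangentSpace (𝓡 n) x →L[ℝ] E x, ∀ v X,
      cov (fun z => e.symm z v) x X = A v X := by
  obtain ⟨A, hA⟩ := exists_connectionForm cov e hx
  refine ⟨(A : E x →ₗ[ℝ] _).comp (e.symmL ℝ x : F →ₗ[ℝ] E x), fun v X => ?_⟩
  rw [hA _ (mdifferentiableAt_symm_const hx v), mvfderiv_symm_const hx v, _root_.zero_apply,
    ← e.symmL_apply (R := ℝ) hx, map_zero, zero_add, ← e.symmL_apply (R := ℝ) hx]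
  rfl

variable {cov} in
/-- The covariant derivative along a curve depends only on the germ of the section. -/
lemma covDerivAlong_congr {s s' : ℝ → TotalSpace F E} {t : ℝ} (h : s =ᶠ[𝓝 t] s') :
    (⟨(s t).proj, covDerivAlong cov s t⟩ : TotalSpace F E) =
      ⟨(s' t).proj, covDerivAlong cov s' t⟩ := by
  -- The fiber and the trivialization depend on `s t`. Packing everything into a function of three
  -- arguments with fixed types lets congruence replace them one by one.
  let Φ (Z : TotalSpace F E) (D : F) (V : EuclideanSpace ℝ (Fin n)) : TotalSpace F E :=
    ⟨Z.proj, (trivializationAt F E Z.proj).symm Z.proj D +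
      cov (fun y => (trivializationAt F E Z.proj).symm y
        ((trivializationAt F E Z.proj) Z).2) Z.proj V⟩
  have hst : s t = s' t := h.eq_of_nhds
  have h1 : deriv (fun τ => ((trivializationAt F E (s t).proj) (s τ)).2) t =
      deriv (fun τ => ((trivializationAt F E (s' t).proj) (s' τ)).2) t := by
    rw [hst]
    refine Filter.EventuallyEq.deriv_eq ?_
    filter_upwards [h] with τ hτ
    rw [hτ]
  have h2 : (mfderiv 𝓘(ℝ, ℝ) (𝓡 n) (fun τ => (s τ).proj) t (1 : ℝ) : EuclideanSpace ℝ (Fin n)) =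
      mfderiv 𝓘(ℝ, ℝ) (𝓡 n) (fun τ => (s' τ).proj) t (1 : ℝ) := by
    have hp : (fun τ => (s τ).proj) =ᶠ[𝓝 t] fun τ => (s' τ).proj := by
      filter_upwards [h] with τ hτ
      rw [hτ]
    exact congrArg (fun L : ℝ →L[ℝ] EuclideanSpace ℝ (Fin n) => L 1) hp.mfderiv_eq
  change Φ (s t) _ (mfderiv 𝓘(ℝ, ℝ) (𝓡 n) (fun τ => (s τ).proj) t (1 : ℝ)) = Φ (s' t) _ _
  exact congr (congr (congrArg Φ hst) h1) h2

/-- The covariant derivative along a curve of a section given by its coefficients in a family of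
sections of the bundle. -/
theorem covDerivAlong_eq_sum {ι : Type*} [Fintype ι] {γ : ℝ → M} {t : ℝ} {g : ι → ℝ → ℝ}
    {g' : ι → ℝ} {σ : ι → ∀ y, E y} {s : ℝ → TotalSpace F E}
    (hγ : MDifferentiableAt 𝓘(ℝ, ℝ) (𝓡 n) γ t)
    (hs : s =ᶠ[𝓝 t] fun τ => ⟨γ τ, ∑ i, g i τ • σ i (γ τ)⟩)
    (hg : ∀ i, HasDerivAt (g i) (g' i) t)
    (hσ : ∀ i, MDifferentiableAt (𝓡 n) ((𝓡 n).prod 𝓘(ℝ, F))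
      (fun y => (⟨y, σ i y⟩ : TotalSpace F E)) (γ t)) :
    (⟨(s t).proj, covDerivAlong cov s t⟩ : TotalSpace F E) =
      ⟨γ t, ∑ i, (g' i • σ i (γ t) +
        g i t • cov (σ i) (γ t) (mfderiv 𝓘(ℝ, ℝ) (𝓡 n) γ t (1 : ℝ)))⟩ := by
  rw [covDerivAlong_congr hs]
  refine congrArg (TotalSpace.mk (γ t)) ?_
  set e := trivializationAt F E (γ t) with he
  have hb : γ t ∈ e.baseSet := FiberBundle.mem_baseSet_trivializationAt' (γ t)
  obtain ⟨A, hA⟩ := exists_connectionForm cov e hb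
  -- The flat part of the formula: product rule for the coefficients and chain rule for the sections
  -- along `γ`. The tensor part is `hc`; the two recombine summand by summand into `cov (σ i)`.
  have hd : HasDerivAt (fun τ => (e (⟨γ τ, ∑ i, g i τ • σ i (γ τ)⟩ : TotalSpace F E)).2)
      (∑ i, (g i t • mvfderiv (𝓡 n) (fun z => (e ⟨z, σ i z⟩).2) (γ t)
          (mfderiv 𝓘(ℝ, ℝ) (𝓡 n) γ t (1 : ℝ)) + g' i • (e ⟨γ t, σ i (γ t)⟩).2)) t := by
    have h1 : HasDerivAt (𝕜 := ℝ) (F := F) (fun τ => ∑ i, g i τ • (e (⟨γ τ, σ i (γ τ)⟩ : TotalSpace F E)).2)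
        (∑ i, (g i t • mvfderiv (𝓡 n) (fun z => (e ⟨z, σ i z⟩).2) (γ t)
          (mfderiv 𝓘(ℝ, ℝ) (𝓡 n) γ t (1 : ℝ)) + g' i • (e ⟨γ t, σ i (γ t)⟩).2)) t := by
      refine HasDerivAt.fun_sum fun i _ => ?_
      have h2 : HasDerivAt (fun τ => (e (⟨γ τ, σ i (γ τ)⟩ : TotalSpace F E)).2)
          (mvfderiv (𝓡 n) (fun z => (e ⟨z, σ i z⟩).2) (γ t)
            (mfderiv 𝓘(ℝ, ℝ) (𝓡 n) γ t (1 : ℝ))) t := by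
        have h3 := (mdifferentiableAt_trivialization_snd (e := e) hb (hσ i)).hasMFDerivAt.comp t
          hγ.hasMFDerivAt
        have h4 : HasFDerivAt (fun τ => (e (⟨γ τ, σ i (γ τ)⟩ : TotalSpace F E)).2)
            ((mvfderiv (𝓡 n) (fun z => (e ⟨z, σ i z⟩).2) (γ t) :
              EuclideanSpace ℝ (Fin n) →L[ℝ] F).comp (mfderiv 𝓘(ℝ, ℝ) (𝓡 n) γ t)) t :=
          hasMFDerivAt_iff_hasFDerivAt.1 h3
        exact h4.hasDerivAt
      exact (hg i).smul h2
    refine h1.congr_of_eventuallyEq ?_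
    filter_upwards [hγ.continuousAt.preimage_mem_nhds (e.open_baseSet.mem_nhds hb)] with τ hτ
    let L : E (γ τ) →ₗ[ℝ] F := (e.linear ℝ hτ).mk' _
    exact (map_sum L _ _).trans (Finset.sum_congr rfl fun i _ => map_smul L (g i τ) (σ i (γ τ)))
  have hc : cov (fun y => e.symm y (e (⟨γ t, ∑ i, g i t • σ i (γ t)⟩ : TotalSpace F E)).2) (γ t)
      (mfderiv 𝓘(ℝ, ℝ) (𝓡 n) γ t (1 : ℝ)) =
      A (∑ i, g i t • σ i (γ t)) (mfderiv 𝓘(ℝ, ℝ) (𝓡 n) γ t (1 : ℝ)) := by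
    rw [hA _ (mdifferentiableAt_symm_const hb _)]
    have h0 := mvfderiv_symm_const (n := n) hb (e (⟨γ t, ∑ i, g i t • σ i (γ t)⟩ : TotalSpace F E)).2
    have hsp : e.symm (γ t) (e (⟨γ t, ∑ i, g i t • σ i (γ t)⟩ : TotalSpace F E)).2 =
        ∑ i, g i t • σ i (γ t) := e.symm_proj_apply ⟨γ t, _⟩ hb
    rw [h0, hsp, ← e.symmL_apply (R := ℝ) hb, _root_.zero_apply, map_zero, zero_add]
  change e.symm (γ t) (deriv (fun τ => (e (⟨γ τ, ∑ i, g i τ • σ i (γ τ)⟩ : TotalSpace F E)).2) t)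
    + cov (fun y => e.symm y (e (⟨γ t, ∑ i, g i t • σ i (γ t)⟩ : TotalSpace F E)).2) (γ t)
      (mfderiv 𝓘(ℝ, ℝ) (𝓡 n) γ t (1 : ℝ)) = _
  rw [hd.deriv, hc, map_sum A, _root_.sum_apply, ← e.symmL_apply (R := ℝ) hb, map_sum,
    ← Finset.sum_add_distrib]
  refine Finset.sum_congr rfl fun i _ => ?_
  rw [hA (σ i) (hσ i), map_add, map_smul, map_smul, map_smul]
  have hsp : e.symmL ℝ (γ t) (e (⟨γ t, σ i (γ t)⟩ : TotalSpace F E)).2 = σ i (γ t) :=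
    (e.symmL_apply hb _).trans (e.symm_proj_apply ⟨γ t, _⟩ hb)
  rw [hsp, _root_.smul_apply, smul_add, e.symmL_apply hb]
  abel

end FrameFormula

/-! ### Smooth Christoffel symbols -/

section Christoffel

variable {n : ℕ} {M : Type*} [TopologicalSpace M] [ChartedSpace (EuclideanSpace ℝ (Fin n)) M]
  [IsManifold (𝓡 n) ∞ M]
  {F : Type*} [NormedAddCommGroup F] [NormedSpace ℝ F] [FiniteDimensional ℝ F]
  {E : M → Type*} [TopologicalSpace (TotalSpace F E)]
  [∀ x, AddCommGroup (E x)] [∀ x, Module ℝ (E x)] [∀ x, TopologicalSpace (E x)]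
  [∀ x, IsTopologicalAddGroup (E x)] [∀ x, ContinuousSMul ℝ (E x)] [FiberBundle F E]
  [VectorBundle ℝ F E] [ContMDiffVectorBundle ∞ F E (𝓡 n)]
  (cov : CovariantDerivative (𝓡 n) F E)

/-- The velocity of a curve in coordinates. -/
lemma continuousLinearMapAt_velocity {x₀ : M} {γ : ℝ → M} {t : ℝ}
    (hγ : MDifferentiableAt 𝓘(ℝ, ℝ) (𝓡 n) γ t) (ht : γ t ∈ (extChartAt (𝓡 n) x₀).source) :
    (trivializationAt (EuclideanSpace ℝ (Fin n)) (TangentSpace (𝓡 n) : M → Type _)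
        x₀).continuousLinearMapAt ℝ (γ t) (mfderiv 𝓘(ℝ, ℝ) (𝓡 n) γ t (1 : ℝ)) =
      deriv (fun τ => extChartAt (𝓡 n) x₀ (γ τ)) t := by
  have hs : γ t ∈ (chartAt (EuclideanSpace ℝ (Fin n)) x₀).source := by
    rwa [extChartAt_source] at ht
  rw [TangentBundle.continuousLinearMapAt_trivializationAt hs]
  have h1 := (mdifferentiableAt_extChartAt (I := 𝓡 n) hs).hasMFDerivAt.comp t hγ.hasMFDerivAt
  let L : ℝ →L[ℝ] EuclideanSpace ℝ (Fin n) := ContinuousLinearMap.comp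
    (mfderiv (𝓡 n) 𝓘(ℝ, EuclideanSpace ℝ (Fin n)) (extChartAt (𝓡 n) x₀) (γ t) :
        EuclideanSpace ℝ (Fin n) →L[ℝ] EuclideanSpace ℝ (Fin n))
    (mfderiv 𝓘(ℝ, ℝ) (𝓡 n) γ t : ℝ →L[ℝ] EuclideanSpace ℝ (Fin n))
  have h2 : HasFDerivAt (fun τ => extChartAt (𝓡 n) x₀ (γ τ)) L t :=
    hasMFDerivAt_iff_hasFDerivAt.1 h1
  exact h2.hasDerivAt.deriv.symm

lemma symmL_velocity {x₀ : M} {γ : ℝ → M} {t : ℝ}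
    (hγ : MDifferentiableAt 𝓘(ℝ, ℝ) (𝓡 n) γ t) (ht : γ t ∈ (extChartAt (𝓡 n) x₀).source) :
    (trivializationAt (EuclideanSpace ℝ (Fin n)) (TangentSpace (𝓡 n) : M → Type _)
        x₀).symmL ℝ (γ t) (deriv (fun τ => extChartAt (𝓡 n) x₀ (γ τ)) t) =
      mfderiv 𝓘(ℝ, ℝ) (𝓡 n) γ t (1 : ℝ) := by
  rw [← continuousLinearMapAt_velocity hγ ht]
  refine Trivialization.symmL_continuousLinearMapAt _ ?_ _
  rw [extChartAt_source] at ht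
  exact ht

/-- Near a given point, sections that are constant in a trivialization extend to global smooth
sections. -/
lemma exists_global_section_eq [T2Space M] (x₀ : M) : ∃ U : Set M, IsOpen U ∧ x₀ ∈ U ∧
    U ⊆ (trivializationAt F E x₀).baseSet ∧ ∀ v : F, ∃ σ : ∀ y, E y,
      ContMDiff (𝓡 n) ((𝓡 n).prod 𝓘(ℝ, F)) ∞ (fun y => (⟨y, σ y⟩ : TotalSpace F E)) ∧
      ∀ y ∈ U, σ y = (trivializationAt F E x₀).symm y v := by
  set e := trivializationAt F E x₀
  have hb : e.baseSet ∈ 𝓝 x₀ :=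
    e.open_baseSet.mem_nhds (FiberBundle.mem_baseSet_trivializationAt' x₀)
  obtain ⟨f, -, hf⟩ := (SmoothBumpFunction.nhds_basis_tsupport (I := 𝓡 n) x₀).mem_iff.1 hb
  obtain ⟨U, hU, hUo, hxU⟩ := mem_nhds_iff.1 (Filter.inter_mem f.eventuallyEq_one hb)
  refine ⟨U, hUo, hxU, fun y hy => (hU hy).2, fun v => ⟨fun y => f y • e.symm y v, ?_, ?_⟩⟩
  · exact ContMDiffOn.smul_section_of_tsupport f.contMDiff.contMDiffOn e.open_baseSet hf
      (contMDiffOn_symm_const v)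
  · intro y hy
    have : f y = 1 := (hU hy).1
    change f y • _ = _
    rw [this, one_smul]

/-- Smoothness of the connection says that the derivative of a smooth section is a smooth section of
the bundle of homomorphisms from `TM` to `E`; here it is read in the trivialization of that bundle
at `x₀`. -/
lemma contMDiffOn_covDeriv_coord [T2Space M]
    (hcov : CovariantDerivative.ContMDiffCovariantDerivative cov ∞) (x₀ : M) {σ : ∀ y, E y}
    (hσ : ContMDiff (𝓡 n) ((𝓡 n).prod 𝓘(ℝ, F)) ∞ (fun y => (⟨y, σ y⟩ : TotalSpace F E))) :
    ContMDiffOn (𝓡 n) 𝓘(ℝ, EuclideanSpace ℝ (Fin n) →L[ℝ] F) ∞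
      (fun y => ContinuousLinearMap.inCoordinates (EuclideanSpace ℝ (Fin n))
        (TangentSpace (𝓡 n) : M → Type _) F E x₀ y x₀ y (cov σ y))
      ((trivializationAt (EuclideanSpace ℝ (Fin n)) (TangentSpace (𝓡 n) : M → Type _) x₀).baseSet ∩
        (trivializationAt F E x₀).baseSet) := by
  have h := (hcov.contMDiff.contMDiff (σ := σ) (by simpa using hσ.contMDiffOn))
  have h' := ((trivializationAt (EuclideanSpace ℝ (Fin n) →L[ℝ] F)
    (fun x : M => TangentSpace (𝓡 n) x →L[ℝ] E x) x₀).contMDiffOn_section_baseSet_iff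
    (n := ∞) (IB := 𝓡 n)
      (s := fun y => cov σ y)).1 (h.mono (subset_univ _))
  exact h'

/-- `Ω` is the family of Christoffel symbols of `cov`, on the open set `U` around `x₀`, in the
coordinates given by the preferred charts at `x₀`. -/
structure IsChristoffel (x₀ : M) (U : Set M)
    (Ω : EuclideanSpace ℝ (Fin n) → EuclideanSpace ℝ (Fin n) →L[ℝ] F →L[ℝ] F) : Prop where
  isOpen : IsOpen U
  mem : x₀ ∈ U
  subset_source : U ⊆ (extChartAt (𝓡 n) x₀).source
  subset_baseSet : U ⊆ (trivializationAt F E x₀).baseSet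
  contDiffOn : ContDiffOn ℝ ∞ Ω
    ((extChartAt (𝓡 n) x₀).target ∩ (extChartAt (𝓡 n) x₀).symm ⁻¹' U)
  apply_eq : ∀ y ∈ U, ∀ X v, Ω (extChartAt (𝓡 n) x₀ y) X v =
    (trivializationAt F E x₀ ⟨y, cov (fun z => (trivializationAt F E x₀).symm z v) y
      ((trivializationAt (EuclideanSpace ℝ (Fin n)) (TangentSpace (𝓡 n) : M → Type _)
        x₀).symmL ℝ y X)⟩).2

/-- Constant sections exist only locally, so those of a basis of `F` are first extended by a bump
function to global smooth sections. Their derivatives have smooth coordinates near `x₀` and agree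
there with the derivatives of the constant sections. -/
theorem exists_isChristoffel [T2Space M]
    (hcov : CovariantDerivative.ContMDiffCovariantDerivative cov ∞) (x₀ : M) :
    ∃ U Ω, IsChristoffel cov x₀ U Ω := by
  obtain ⟨U₁, hU₁o, hx₁, hU₁, hσ⟩ := exists_global_section_eq (n := n) (F := F) (E := E) x₀
  choose σ hσ hσU using hσ
  set e := trivializationAt F E x₀ with he
  set eT := trivializationAt (EuclideanSpace ℝ (Fin n)) (TangentSpace (𝓡 n) : M → Type _) x₀
    with heT
  set φ := extChartAt (𝓡 n) x₀ with hφ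
  let b := Module.finBasis ℝ F
  let A (i) (y : M) : EuclideanSpace ℝ (Fin n) →L[ℝ] F :=
    ContinuousLinearMap.inCoordinates (EuclideanSpace ℝ (Fin n))
        (TangentSpace (𝓡 n) : M → Type _) F E x₀ y x₀ y (cov (σ (b i)) y)
  let U : Set M := U₁ ∩ φ.source
  have hUo : IsOpen U := hU₁o.inter (isOpen_extChartAt_source x₀)
  have hUT : U ⊆ eT.baseSet := by
    intro y hy
    have := hy.2
    rw [hφ, extChartAt_source] at this
    exact this
  -- In formulas, `Ω c X v = ∑ i, v_i • A_i X`, where `v_i` are the coordinates of `v` in the basis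
  -- `b`.
  refine ⟨U, fun c => ∑ i, (ContinuousLinearMap.smulRightL ℝ F F
    (LinearMap.toContinuousLinearMap (b.coord i))).comp (A i (φ.symm c)), ⟨hUo,
    ⟨hx₁, mem_extChartAt_source x₀⟩, inter_subset_right, fun y hy => hU₁ hy.1, ?_, ?_⟩⟩
  · refine ContDiffOn.sum fun i _ => contDiffOn_const.clm_comp ?_
    have h1 := contMDiffOn_covDeriv_coord cov hcov x₀ (hσ (b i))
    have h2 := h1.comp ((contMDiffOn_extChartAt_symm (I := 𝓡 n) (n := ∞) x₀).mono
      (inter_subset_left (t := φ.symm ⁻¹' U))) fun c hc => ⟨hUT hc.2, hU₁ hc.2.1⟩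
    exact contMDiffOn_iff_contDiffOn.1 h2
  · intro y hy X v
    have hye : y ∈ e.baseSet := hU₁ hy.1
    obtain ⟨C, hC⟩ := exists_covDeriv_symm_const cov e hye
    have hA (i) : A i y X = (e ⟨y, cov (fun z => e.symm z (b i)) y (eT.symmL ℝ y X)⟩).2 := by
      have h1 : cov (σ (b i)) y = cov (fun z => e.symm z (b i)) y := by
        refine (cov.isCovariantDerivativeOn (s := univ)).congr_of_eventuallyEq
          ((hσ (b i)).mdifferentiableAt (by simp)) (mdifferentiableAt_symm_const hye _)
          Filter.univ_mem ?_
        filter_upwards [hU₁o.mem_nhds hy.1] with z hz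
        exact hσU (b i) z hz
      change e.continuousLinearMapAt ℝ y (cov (σ (b i)) y (eT.symmL ℝ y X)) = _
      rw [h1, e.continuousLinearMapAt_apply ℝ, e.coe_linearMapAt_of_mem hye]
    let L : E y →ₗ[ℝ] F := (e.linear ℝ hye).mk' _
    have hsum : (∑ i, (ContinuousLinearMap.smulRightL ℝ F F
        (LinearMap.toContinuousLinearMap (b.coord i))).comp (A i (φ.symm (φ y)))) X v =
        ∑ i, b.repr v i • A i y X := by
      rw [φ.left_inv hy.2, _root_.sum_apply, _root_.sum_apply]
      rfl
    refine hsum.trans ?_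
    rw [hC]
    conv_rhs => rw [← b.sum_repr v, map_sum, _root_.sum_apply]
    refine ((map_sum L _ _).trans (Finset.sum_congr rfl fun i _ => ?_)).symm
    rw [hA, hC, map_smul, _root_.smul_apply]
    exact map_smul L _ _

namespace IsChristoffel

variable {cov} {x₀ : M} {U : Set M}
  {Ω : EuclideanSpace ℝ (Fin n) → EuclideanSpace ℝ (Fin n) →L[ℝ] F →L[ℝ] F}

/-- The covariant derivative along a curve in coordinates. -/
theorem covDerivAlong_snd (h : IsChristoffel cov x₀ U Ω) {s : ℝ → TotalSpace F E} {t : ℝ}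
    (hs : MDifferentiableAt 𝓘(ℝ, ℝ) ((𝓡 n).prod 𝓘(ℝ, F)) s t) (ht : (s t).proj ∈ U) :
    (trivializationAt F E x₀ ⟨(s t).proj, covDerivAlong cov s t⟩).2 =
      deriv (fun τ => (trivializationAt F E x₀ (s τ)).2) t +
        Ω (extChartAt (𝓡 n) x₀ (s t).proj)
          (deriv (fun τ => extChartAt (𝓡 n) x₀ (s τ).proj) t) (trivializationAt F E x₀ (s t)).2 := by
  set e := trivializationAt F E x₀ with he
  let b := Module.finBasis ℝ F
  have hb : (s t).proj ∈ e.baseSet := h.subset_baseSet ht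
  have hγ : MDifferentiableAt 𝓘(ℝ, ℝ) (𝓡 n) (fun τ => (s τ).proj) t :=
    ((contMDiff_proj E (n := 1)).mdifferentiable (by simp) (s t)).comp t hs
  have hes : DifferentiableAt ℝ (fun τ => (e (s τ)).2) t := by
    have h1 : MDifferentiableAt ((𝓡 n).prod 𝓘(ℝ, F)) ((𝓡 n).prod 𝓘(ℝ, F)) e (s t) :=
      ((e.contMDiffOn (n := ∞) (IB := 𝓡 n)).contMDiffAt
        (e.open_source.mem_nhds (e.mem_source.2 hb))).mdifferentiableAt (by simp)
    exact mdifferentiableAt_iff_differentiableAt.1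
      (mdifferentiableAt_snd.comp t (h1.comp t hs))
  -- Expand `s` in the constant frame; the coefficients are the coordinates of its trivialized
  -- value.
  have key := covDerivAlong_eq_sum cov (s := s) (σ := fun i y => e.symm y (b i))
    (g := fun i τ => b.repr (e (s τ)).2 i)
    (g' := fun i => b.repr (deriv (fun τ => (e (s τ)).2) t) i) hγ (by
      filter_upwards [hγ.continuousAt.preimage_mem_nhds (e.open_baseSet.mem_nhds hb)] with τ hτ
      have h1 : ∑ i, b.repr (e (s τ)).2 i • e.symm (s τ).proj (b i) =
          (s τ).2 := by
        simp_rw [← e.symmL_apply (R := ℝ) hτ]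
        rw [← e.symm_proj_apply (s τ) hτ, ← e.symmL_apply (R := ℝ) hτ]
        conv_rhs => rw [← b.sum_repr (e (s τ)).2, map_sum]
        exact Finset.sum_congr rfl fun i _ => (map_smul _ _ _).symm
      rw [h1])
    (fun i => (LinearMap.toContinuousLinearMap (b.coord i)).hasFDerivAt.comp_hasDerivAt t
      hes.hasDerivAt)
    (fun i => mdifferentiableAt_symm_const hb (b i))
  rw [key]
  let L : E (s t).proj →ₗ[ℝ] F := (e.linear ℝ hb).mk' _
  have hX : (trivializationAt (EuclideanSpace ℝ (Fin n)) (TangentSpace (𝓡 n) : M → Type _)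
        x₀).symmL ℝ (s t).proj (deriv (fun τ => extChartAt (𝓡 n) x₀ (s τ).proj) t) =
      mfderiv 𝓘(ℝ, ℝ) (𝓡 n) (fun τ => (s τ).proj) t (1 : ℝ) :=
    symmL_velocity hγ (h.subset_source ht)
  refine (map_sum L _ _).trans ?_
  have h2 (i) : L (b.repr (deriv (fun τ => (e (s τ)).2) t) i • e.symm (s t).proj (b i) +
      b.repr (e (s t)).2 i • cov (fun y => e.symm y (b i)) (s t).proj
        (mfderiv 𝓘(ℝ, ℝ) (𝓡 n) (fun τ => (s τ).proj) t (1 : ℝ))) =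
      b.repr (deriv (fun τ => (e (s τ)).2) t) i • b i + b.repr (e (s t)).2 i •
        Ω (extChartAt (𝓡 n) x₀ (s t).proj)
          (deriv (fun τ => extChartAt (𝓡 n) x₀ (s τ).proj) t) (b i) := by
    rw [map_add, map_smul, map_smul, h.apply_eq _ ht, hX]
    congr 2
    exact congrArg Prod.snd (e.apply_mk_symm hb (b i))
  refine (Finset.sum_congr rfl fun i _ => h2 i).trans ?_
  rw [Finset.sum_add_distrib, b.sum_repr]
  congr 1
  conv_rhs => rw [← b.sum_repr (e (s t)).2, map_sum]
  exact Finset.sum_congr rfl fun i _ => (map_smul _ _ _).symm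

/-- Trivializations are `𝕜`-linear, so near `y` the constant section of `k • v` is `k` times that of
`v`, and `hlin` applies. It makes complex-linear relations propagate along parallel sections. -/
lemma smul_right {𝕜 : Type*} [RCLike 𝕜] [NormedSpace 𝕜 F] [∀ x, Module 𝕜 (E x)]
    [VectorBundle 𝕜 F E] (h : IsChristoffel cov x₀ U Ω)
    (hlin : ∀ (k : 𝕜) (σ : ∀ x, E x) (x : M),
      MDifferentiableAt (𝓡 n) ((𝓡 n).prod 𝓘(ℝ, F)) (fun y => (⟨y, σ y⟩ : TotalSpace F E)) x →
      ∀ X : TangentSpace (𝓡 n) x, cov (fun y => k • σ y) x X = k • cov σ x X)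
    {y : M} (hy : y ∈ U) (X) (k : 𝕜) (v : F) :
    Ω (extChartAt (𝓡 n) x₀ y) X (k • v) = k • Ω (extChartAt (𝓡 n) x₀ y) X v := by
  have hb := h.subset_baseSet hy
  set e := trivializationAt F E x₀ with he
  rw [h.apply_eq y hy, h.apply_eq y hy]
  have h1 : cov (fun z => e.symm z (k • v)) y = cov (fun z => k • e.symm z v) y := by
    refine (cov.isCovariantDerivativeOn (s := univ)).congr_of_eventuallyEq
      (mdifferentiableAt_symm_const hb _) ?_ Filter.univ_mem ?_
    · refine (mdifferentiableAt_symm_const hb (k • v)).congr_of_eventuallyEq ?_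
      filter_upwards [e.open_baseSet.mem_nhds hb] with z hz
      rw [← e.symmL_apply (R := 𝕜) hz, ← e.symmL_apply (R := 𝕜) hz, map_smul]
    · filter_upwards [e.open_baseSet.mem_nhds hb] with z hz
      rw [← e.symmL_apply (R := 𝕜) hz, ← e.symmL_apply (R := 𝕜) hz, map_smul]
  rw [h1, hlin k _ y (mdifferentiableAt_symm_const hb _)]
  exact (e.linear 𝕜 hb).map_smul k _

end IsChristoffel

end Christoffel

/-! ### Uniqueness and linearity of parallel transport -/

section Parallel

variable {n : ℕ} {M : Type*} [TopologicalSpace M] [ChartedSpace (EuclideanSpace ℝ (Fin n)) M]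
  [IsManifold (𝓡 n) ∞ M] [T2Space M]
  {F : Type*} [NormedAddCommGroup F] [NormedSpace ℝ F] [FiniteDimensional ℝ F]
  {E : M → Type*} [TopologicalSpace (TotalSpace F E)]
  [∀ x, AddCommGroup (E x)] [∀ x, Module ℝ (E x)] [∀ x, TopologicalSpace (E x)]
  [∀ x, IsTopologicalAddGroup (E x)] [∀ x, ContinuousSMul ℝ (E x)] [FiberBundle F E]
  [VectorBundle ℝ F E] [ContMDiffVectorBundle ∞ F E (𝓡 n)]
  {cov : CovariantDerivative (𝓡 n) F E}

lemma IsParallelOn.mono {s : ℝ → TotalSpace F E} {J J' : Set ℝ} (h : IsParallelOn cov s J)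
    (hJ : J' ⊆ J) : IsParallelOn cov s J' :=
  ⟨h.1.mono hJ, fun t ht => h.2 t (hJ ht)⟩

lemma IsChristoffel.isOpen_domain {x₀ : M} {U : Set M}
    {Ω : EuclideanSpace ℝ (Fin n) → EuclideanSpace ℝ (Fin n) →L[ℝ] F →L[ℝ] F}
    (h : IsChristoffel cov x₀ U Ω) :
    IsOpen ((extChartAt (𝓡 n) x₀).target ∩ (extChartAt (𝓡 n) x₀).symm ⁻¹' U) :=
  (continuousOn_extChartAt_symm x₀).isOpen_inter_preimage (isOpen_extChartAt_target x₀) h.isOpen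

lemma IsChristoffel.mem_domain {x₀ : M} {U : Set M}
    {Ω : EuclideanSpace ℝ (Fin n) → EuclideanSpace ℝ (Fin n) →L[ℝ] F →L[ℝ] F}
    (h : IsChristoffel cov x₀ U Ω) {y : M} (hy : y ∈ U) : extChartAt (𝓡 n) x₀ y ∈
      (extChartAt (𝓡 n) x₀).target ∩ (extChartAt (𝓡 n) x₀).symm ⁻¹' U :=
  ⟨(extChartAt (𝓡 n) x₀).map_source (h.subset_source hy), by
    rwa [mem_preimage, (extChartAt (𝓡 n) x₀).left_inv (h.subset_source hy)]⟩

lemma IsChristoffel.covDerivAlong_eq_zero_iff {x₀ : M} {U : Set M}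
    {Ω : EuclideanSpace ℝ (Fin n) → EuclideanSpace ℝ (Fin n) →L[ℝ] F →L[ℝ] F}
    (h : IsChristoffel cov x₀ U Ω) {s : ℝ → TotalSpace F E} {t : ℝ}
    (hs : MDifferentiableAt 𝓘(ℝ, ℝ) ((𝓡 n).prod 𝓘(ℝ, F)) s t) (ht : (s t).proj ∈ U) :
    covDerivAlong cov s t = 0 ↔ deriv (fun τ => (trivializationAt F E x₀ (s τ)).2) t =
      -Ω (extChartAt (𝓡 n) x₀ (s t).proj)
          (deriv (fun τ => extChartAt (𝓡 n) x₀ (s τ).proj) t)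
          (trivializationAt F E x₀ (s t)).2 := by
  have hb := h.subset_baseSet ht
  have key := h.covDerivAlong_snd hs ht
  rw [eq_neg_iff_add_eq_zero, ← key]
  exact (map_eq_zero_iff ((trivializationAt F E x₀).linearEquivAt ℝ _ hb)
    (LinearEquiv.injective _)).symm

lemma differentiableAt_trivialization_snd {e : Trivialization F (TotalSpace.proj : TotalSpace F E → M)}
    [MemTrivializationAtlas e] {s : ℝ → TotalSpace F E} {t : ℝ}
    (hs : MDifferentiableAt 𝓘(ℝ, ℝ) ((𝓡 n).prod 𝓘(ℝ, F)) s t) (ht : (s t).proj ∈ e.baseSet) :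
    DifferentiableAt ℝ (fun τ => (e (s τ)).2) t := by
  have h1 : MDifferentiableAt ((𝓡 n).prod 𝓘(ℝ, F)) ((𝓡 n).prod 𝓘(ℝ, F)) e (s t) :=
    ((e.contMDiffOn (n := ∞) (IB := 𝓡 n)).contMDiffAt
      (e.open_source.mem_nhds (e.mem_source.2 ht))).mdifferentiableAt (by simp)
  exact mdifferentiableAt_iff_differentiableAt.1
    (mdifferentiableAt_snd.comp t (h1.comp t hs))

/-- `Z₃ = Z₁ + c • Z₂` in a common fiber. -/
def IsFiberCombination {𝕜 : Type*} [RCLike 𝕜] [∀ x, Module 𝕜 (E x)] (c : 𝕜)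
    (Z₁ Z₂ Z₃ : TotalSpace F E) : Prop :=
  ∃ (y : M) (v₁ v₂ : E y), Z₁ = ⟨y, v₁⟩ ∧ Z₂ = ⟨y, v₂⟩ ∧ Z₃ = ⟨y, v₁ + c • v₂⟩

section Linear

variable {𝕜 : Type*} [RCLike 𝕜] [NormedSpace 𝕜 F] [∀ x, Module 𝕜 (E x)] [VectorBundle 𝕜 F E]

/-- This turns a relation in varying fibers into the vanishing of one vector of `F`, to which
uniqueness for differential equations applies. -/
lemma isFiberCombination_iff {e : Trivialization F (TotalSpace.proj : TotalSpace F E → M)}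
    [MemTrivializationAtlas e] {c : 𝕜} {Z₁ Z₂ Z₃ : TotalSpace F E} (h₁ : Z₁.proj ∈ e.baseSet)
    (h₂ : Z₂.proj = Z₁.proj) (h₃ : Z₃.proj = Z₁.proj) :
    IsFiberCombination c Z₁ Z₂ Z₃ ↔ (e Z₃).2 - (e Z₁).2 - c • (e Z₂).2 = 0 := by
  obtain ⟨y, v₁⟩ := Z₁
  obtain ⟨y₂, v₂⟩ := Z₂
  obtain ⟨y₃, v₃⟩ := Z₃
  obtain rfl : y₂ = y := h₂
  obtain rfl : y₃ = y₂ := h₃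
  let L := e.linearEquivAt 𝕜 y₃ h₁
  change _ ↔ L v₃ - L v₁ - c • L v₂ = 0
  rw [← map_smul, ← map_sub, ← map_sub, map_eq_zero_iff L L.injective, sub_sub, sub_eq_zero]
  constructor
  · rintro ⟨y, w₁, w₂, ⟨⟩, ⟨⟩, ⟨⟩⟩
    rfl
  · rintro rfl
    exact ⟨_, v₁, v₂, rfl, rfl, rfl⟩

lemma hasDerivAt_smul_field {G : Type*} [NormedAddCommGroup G] [NormedSpace ℝ G] [NormedSpace 𝕜 G]
    [IsScalarTower ℝ 𝕜 G] (c : 𝕜) {f : ℝ → G} {f' : G} {t : ℝ} (hf : HasDerivAt f f' t) :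
    HasDerivAt (fun τ => c • f τ) (c • f') t := by
  have : SMulCommClass ℝ 𝕜 G := ⟨fun a b x => by
    rw [← algebraMap_smul 𝕜 a x, ← algebraMap_smul 𝕜 a (b • x), smul_smul, smul_smul, mul_comm]⟩
  exact hf.const_smul c

variable [IsScalarTower ℝ 𝕜 F]

/-- Linear relations between parallel sections along a curve propagate. -/
theorem IsParallelOn.eventually_isFiberCombination
    (hcov : CovariantDerivative.ContMDiffCovariantDerivative cov ∞)
    (hlin : ∀ (k : 𝕜) (σ : ∀ x, E x) (x : M),
      MDifferentiableAt (𝓡 n) ((𝓡 n).prod 𝓘(ℝ, F)) (fun y => (⟨y, σ y⟩ : TotalSpace F E)) x →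
      ∀ X : TangentSpace (𝓡 n) x, cov (fun y => k • σ y) x X = k • cov σ x X)
    {J : Set ℝ} (hJ : IsOpen J) {s₁ s₂ s₃ : ℝ → TotalSpace F E}
    (h₁ : IsParallelOn cov s₁ J) (h₂ : IsParallelOn cov s₂ J) (h₃ : IsParallelOn cov s₃ J)
    (hp₂ : ∀ t ∈ J, (s₂ t).proj = (s₁ t).proj) (hp₃ : ∀ t ∈ J, (s₃ t).proj = (s₁ t).proj)
    (c : 𝕜) {t₀ : ℝ} (ht₀ : t₀ ∈ J) :
    (IsFiberCombination c (s₁ t₀) (s₂ t₀) (s₃ t₀) →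
      ∀ᶠ t in 𝓝 t₀, IsFiberCombination c (s₁ t) (s₂ t) (s₃ t)) ∧
    (¬ IsFiberCombination c (s₁ t₀) (s₂ t₀) (s₃ t₀) →
      ∀ᶠ t in 𝓝 t₀, ¬ IsFiberCombination c (s₁ t) (s₂ t) (s₃ t)) := by
  obtain ⟨U, Ω, h⟩ := exists_isChristoffel cov hcov (s₁ t₀).proj
  set x₀ := (s₁ t₀).proj with hx₀
  set e := trivializationAt F E x₀ with he
  set φ := extChartAt (𝓡 n) x₀ with hφ
  have hs (i : Fin 3) : ∀ t ∈ J, MDifferentiableAt 𝓘(ℝ, ℝ) ((𝓡 n).prod 𝓘(ℝ, F))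
      (![s₁, s₂, s₃] i) t := by
    intro t ht
    fin_cases i
    · exact (h₁.1.contMDiffAt (hJ.mem_nhds ht)).mdifferentiableAt (by simp)
    · exact (h₂.1.contMDiffAt (hJ.mem_nhds ht)).mdifferentiableAt (by simp)
    · exact (h₃.1.contMDiffAt (hJ.mem_nhds ht)).mdifferentiableAt (by simp)
  have hproj : ContMDiffOn 𝓘(ℝ, ℝ) (𝓡 n) ∞ (fun t => (s₁ t).proj) J :=
    (contMDiff_proj E).comp_contMDiffOn h₁.1
  have hUt : ∀ᶠ t in 𝓝 t₀, t ∈ J ∧ (s₁ t).proj ∈ U :=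
    Filter.Eventually.and (hJ.mem_nhds ht₀) ((hproj.continuousOn.continuousAt (hJ.mem_nhds ht₀)).preimage_mem_nhds
      (h.isOpen.mem_nhds h.mem))
  have hφγ : ContDiffAt ℝ ∞ (fun τ => φ (s₁ τ).proj) t₀ := by
    have h1 : ContMDiffAt (𝓡 n) 𝓘(ℝ, EuclideanSpace ℝ (Fin n)) ∞ φ (s₁ t₀).proj :=
      contMDiffAt_extChartAt
    exact (h1.comp t₀ (hproj.contMDiffAt (hJ.mem_nhds ht₀))).contDiffAt
  let a (τ : ℝ) : F →L[ℝ] F := -Ω (φ (s₁ τ).proj) (deriv (fun τ => φ (s₁ τ).proj) τ)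
  have ha : ContinuousAt a t₀ := by
    have h1 : ContinuousAt (fun τ => Ω (φ (s₁ τ).proj)) t₀ :=
      ContinuousAt.comp (g := Ω) (f := fun τ => φ (s₁ τ).proj) (x := t₀)
        (h.contDiffOn.continuousOn.continuousAt
          (h.isOpen_domain.mem_nhds (h.mem_domain h.mem))) hφγ.continuousAt
    have h2 : ContinuousAt (deriv (fun τ => φ (s₁ τ).proj)) t₀ := by
      have := ((hφγ.fderiv_right (m := 0) (by simp)).continuousAt).clm_apply
        (continuousAt_const (y := (1 : ℝ)))
      exact this
    exact (h1.clm_apply h2).neg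
  -- The defect of the relation. In coordinates the three sections solve the same linear equation
  -- `u' = a u` and `a` commutes with `c`, so `d` solves it as well and vanishes near `t₀` if it
  -- vanishes at `t₀`; if it does not vanish there, continuity suffices.
  let d (τ : ℝ) : F := (e (s₃ τ)).2 - (e (s₁ τ)).2 - c • (e (s₂ τ)).2
  have hd : ∀ᶠ τ in 𝓝 t₀, HasDerivAt d (a τ (d τ)) τ := by
    filter_upwards [hUt, eventually_eventually_nhds.2 hUt] with τ hτ hτ'
    have hder (i : Fin 3) (hi : IsParallelOn cov (![s₁, s₂, s₃] i) J)
        (hpi : ∀ t ∈ J, (![s₁, s₂, s₃] i t).proj = (s₁ t).proj) :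
        HasDerivAt (fun τ => (e (![s₁, s₂, s₃] i τ)).2) (a τ (e (![s₁, s₂, s₃] i τ)).2) τ := by
      have hu : (![s₁, s₂, s₃] i τ).proj ∈ U := by rw [hpi τ hτ.1]; exact hτ.2
      have h1 := (h.covDerivAlong_eq_zero_iff (hs i τ hτ.1) hu).1 (hi.2 τ hτ.1)
      have h2 := (differentiableAt_trivialization_snd (e := e) (hs i τ hτ.1)
        (h.subset_baseSet hu)).hasDerivAt
      rw [h1] at h2
      have h3 : (fun τ => φ (![s₁, s₂, s₃] i τ).proj) =ᶠ[𝓝 τ] fun τ => φ (s₁ τ).proj := by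
        filter_upwards [hJ.mem_nhds hτ.1] with t ht
        rw [hpi t ht]
      rw [h3.deriv_eq, hpi τ hτ.1] at h2
      exact h2
    have hsub := ((hder 2 h₃ hp₃).sub (hder 0 h₁ fun _ _ => rfl)).sub
      (hasDerivAt_smul_field c (hder 1 h₂ hp₂))
    refine hsub.congr_deriv ?_
    change a τ (e (s₃ τ)).2 - a τ (e (s₁ τ)).2 - c • a τ (e (s₂ τ)).2 = a τ (d τ)
    have hak : a τ (c • (e (s₂ τ)).2) = c • a τ (e (s₂ τ)).2 := by
      exact (congrArg Neg.neg (h.smul_right hlin hτ.2 _ c _)).trans (smul_neg _ _).symm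
    rw [map_sub, map_sub, hak]
  have hiff : ∀ᶠ τ in 𝓝 t₀, IsFiberCombination c (s₁ τ) (s₂ τ) (s₃ τ) ↔ d τ = 0 := by
    filter_upwards [hUt] with τ hτ
    exact isFiberCombination_iff (h.subset_baseSet hτ.2) (hp₂ τ hτ.1) (hp₃ τ hτ.1)
  constructor
  · intro h0
    have hev : d =ᶠ[𝓝 t₀] fun _ => 0 := by
      refine ODE_solution_unique_of_eventually (v := fun τ x => a τ x) (s := fun _ => univ)
        (K := ‖a t₀‖₊ + 1) ?_ (hd.mono fun τ hτ => ⟨hτ, mem_univ _⟩)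
        (Filter.Eventually.of_forall fun τ => ⟨?_, mem_univ _⟩) (hiff.self_of_nhds.1 h0)
      · filter_upwards [ha.nnnorm.eventually_lt continuousAt_const
          (lt_add_one ‖a t₀‖₊)] with τ hτ
        exact ((a τ).lipschitz.weaken hτ.le).lipschitzOnWith
      · rw [map_zero]
        exact hasDerivAt_const τ 0
    filter_upwards [hev, hiff] with τ h1 h2 using h2.2 h1
  · intro h0
    have hne : ∀ᶠ τ in 𝓝 t₀, d τ ≠ 0 :=
      hd.self_of_nhds.continuousAt.eventually_ne fun h' => h0 (hiff.self_of_nhds.2 h')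
    filter_upwards [hne, hiff] with τ h1 h2 using fun h' => h1 (h2.1 h')

end Linear

/-- A property that is locally constant on an open set holds on preconnected subsets as soon as it
holds at one point. -/
lemma IsPreconnected.forall_of_locally_constant {S J : Set ℝ} (hS : IsPreconnected S)
    (hJ : IsOpen J) (hSJ : S ⊆ J) {P : ℝ → Prop}
    (hP : ∀ t ∈ J, (P t → ∀ᶠ τ in 𝓝 t, P τ) ∧ (¬ P t → ∀ᶠ τ in 𝓝 t, ¬ P τ))
    {t₀ : ℝ} (ht₀ : t₀ ∈ S) (h₀ : P t₀) : ∀ t ∈ S, P t := by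
  have hu : IsOpen {t | t ∈ J ∧ P t} := isOpen_iff_mem_nhds.2 fun t ht =>
    Filter.Eventually.and (hJ.mem_nhds ht.1) ((hP t ht.1).1 ht.2)
  have hv : IsOpen {t | t ∈ J ∧ ¬ P t} := isOpen_iff_mem_nhds.2 fun t ht =>
    Filter.Eventually.and (hJ.mem_nhds ht.1) ((hP t ht.1).2 ht.2)
  have := hS.subset_left_of_subset_union hu hv
    (disjoint_left.2 fun t h1 h2 => h2.2 h1.2)
    (fun t ht => (em (P t)).imp (fun h => ⟨hSJ ht, h⟩) fun h => ⟨hSJ ht, h⟩)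
    ⟨t₀, ht₀, hSJ ht₀, h₀⟩
  exact fun t ht => (this ht).2

section Transport

variable {𝕜 : Type*} [RCLike 𝕜] [NormedSpace 𝕜 F] [∀ x, Module 𝕜 (E x)] [VectorBundle 𝕜 F E]
  [IsScalarTower ℝ 𝕜 F]

/-- Linear relations are preserved by parallel transport, in both directions. -/
theorem IsParallelTransport.isFiberCombination_iff
    (hcov : CovariantDerivative.ContMDiffCovariantDerivative cov ∞)
    (hlin : ∀ (k : 𝕜) (σ : ∀ x, E x) (x : M),
      MDifferentiableAt (𝓡 n) ((𝓡 n).prod 𝓘(ℝ, F)) (fun y => (⟨y, σ y⟩ : TotalSpace F E)) x →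
      ∀ X : TangentSpace (𝓡 n) x, cov (fun y => k • σ y) x X = k • cov σ x X)
    {γ : ℝ → M} {Z₁ Z₂ Z₃ Z₁' Z₂' Z₃' : TotalSpace F E} (h₁ : IsParallelTransport cov γ Z₁ Z₁')
    (h₂ : IsParallelTransport cov γ Z₂ Z₂') (h₃ : IsParallelTransport cov γ Z₃ Z₃') (c : 𝕜) :
    IsFiberCombination c Z₁ Z₂ Z₃ ↔ IsFiberCombination c Z₁' Z₂' Z₃' := by
  obtain ⟨J₁, s₁, hJ₁, hI₁, hs₁, hp₁, rfl, rfl⟩ := h₁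
  obtain ⟨J₂, s₂, hJ₂, hI₂, hs₂, hp₂, rfl, rfl⟩ := h₂
  obtain ⟨J₃, s₃, hJ₃, hI₃, hs₃, hp₃, rfl, rfl⟩ := h₃
  -- Each transport comes with its own open time domain. The relation is locally constant on the
  -- intersection, which contains the connected interval `[0, 1]`.
  let J := J₁ ∩ (J₂ ∩ J₃)
  have hJ : IsOpen J := hJ₁.inter (hJ₂.inter hJ₃)
  have hI : Icc (0 : ℝ) 1 ⊆ J := fun t ht => ⟨hI₁ ht, hI₂ ht, hI₃ ht⟩
  have key : ∀ t ∈ J, _ := fun t ht => IsParallelOn.eventually_isFiberCombination hcov hlin hJ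
    (hs₁.mono fun t ht => ht.1) (hs₂.mono fun t ht => ht.2.1) (hs₃.mono fun t ht => ht.2.2)
    (fun t ht => (hp₂ t ht.2.1).trans (hp₁ t ht.1).symm)
    (fun t ht => (hp₃ t ht.2.2).trans (hp₁ t ht.1).symm) c ht
  exact ⟨fun h => isPreconnected_Icc.forall_of_locally_constant hJ hI key
      (left_mem_Icc.2 zero_le_one) h 1 (right_mem_Icc.2 zero_le_one),
    fun h => isPreconnected_Icc.forall_of_locally_constant hJ hI key
      (right_mem_Icc.2 zero_le_one) h 0 (left_mem_Icc.2 zero_le_one)⟩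

/-- Transport preserves and reflects the relations `w = u + c • v`. Taking `c = 1` gives additivity,
`u = 0` homogeneity, and `c = 0` injectivity; bijectivity follows since all fibers have the
dimension of `F`. -/
theorem IsParallelTransport.exists_linearEquiv
    (hcov : CovariantDerivative.ContMDiffCovariantDerivative cov ∞)
    (hlin : ∀ (k : 𝕜) (σ : ∀ x, E x) (x : M),
      MDifferentiableAt (𝓡 n) ((𝓡 n).prod 𝓘(ℝ, F)) (fun y => (⟨y, σ y⟩ : TotalSpace F E)) x →
      ∀ X : TangentSpace (𝓡 n) x, cov (fun y => k • σ y) x X = k • cov σ x X)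
    {γ : ℝ → M} {x : M} (κ : F ≃ₗ[𝕜] E x) {Z : F → TotalSpace F E}
    (hZ : ∀ v, IsParallelTransport cov γ ⟨x, κ v⟩ (Z v)) :
    ∃ L : F ≃ₗ[𝕜] E (γ 1), ∀ v, Z v = ⟨γ 1, L v⟩ := by
  have hp (v : F) : ∃ w : E (γ 1), Z v = ⟨γ 1, w⟩ := by
    obtain ⟨J, s, -, hI, -, hp, -, h1⟩ := hZ v
    have : (Z v).proj = γ 1 := h1 ▸ hp 1 (hI (right_mem_Icc.2 zero_le_one))
    rw [← this]
    exact ⟨(Z v).2, rfl⟩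
  choose L hL using hp
  have hrel (c : 𝕜) (u v w : F) : w = u + c • v ↔ L w = L u + c • L v := by
    have h1 := IsParallelTransport.isFiberCombination_iff hcov hlin (hZ u) (hZ v) (hZ w) c
    rw [hL, hL, hL] at h1
    have h2 (y : M) (a b d : E y) : IsFiberCombination c (⟨y, a⟩ : TotalSpace F E) ⟨y, b⟩ ⟨y, d⟩ ↔
        d = a + c • b :=
      ⟨by rintro ⟨y', v₁, v₂, ⟨⟩, ⟨⟩, ⟨⟩⟩; rfl, by rintro rfl; exact ⟨y, a, b, rfl, rfl, rfl⟩⟩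
    rw [h2, h2] at h1
    rw [← h1, ← map_smul, ← map_add]
    exact κ.injective.eq_iff.symm
  have hadd (u v : F) : L (u + v) = L u + L v := by
    simpa using (hrel 1 u v (u + v)).1 (by simp)
  have h0 : L 0 = 0 := by simpa using hadd 0 0
  have hsmul (c : 𝕜) (v : F) : L (c • v) = c • L v := by
    simpa [h0] using (hrel c 0 v (c • v)).1 (by simp)
  let L' : F →ₗ[𝕜] E (γ 1) := { toFun := L, map_add' := hadd, map_smul' := hsmul }
  have hinj : Function.Injective L' := fun u v (huv : L u = L v) => by
    simpa using (hrel 0 v v u).2 (by simpa using huv)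
  have : FiniteDimensional 𝕜 F := Module.Finite.of_restrictScalars_finite ℝ 𝕜 F
  let ε := (trivializationAt F E (γ 1)).linearEquivAt 𝕜 (γ 1)
    (FiberBundle.mem_baseSet_trivializationAt' _)
  have : FiniteDimensional 𝕜 (E (γ 1)) := Module.Finite.equiv ε.symm
  exact ⟨L'.linearEquivOfInjective hinj ε.symm.finrank_eq, hL⟩

end Transport

end Parallel

/-! ### Bundle automorphisms preserving a connection -/

section Invariance

variable {n : ℕ} {M : Type*} [TopologicalSpace M] [ChartedSpace (EuclideanSpace ℝ (Fin n)) M]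
  [IsManifold (𝓡 n) ∞ M] [T2Space M]
  {F : Type*} [NormedAddCommGroup F] [NormedSpace ℝ F] [FiniteDimensional ℝ F]
  {E : M → Type*} [TopologicalSpace (TotalSpace F E)]
  [∀ x, AddCommGroup (E x)] [∀ x, Module ℝ (E x)] [∀ x, TopologicalSpace (E x)]
  [∀ x, IsTopologicalAddGroup (E x)] [∀ x, ContinuousSMul ℝ (E x)] [FiberBundle F E]
  [VectorBundle ℝ F E] [ContMDiffVectorBundle ∞ F E (𝓡 n)]

/-- A section along a curve is locally a combination of sections of the bundle. -/
lemma exists_local_frame_expansion {s : ℝ → TotalSpace F E} {t : ℝ}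
    (hs : MDifferentiableAt 𝓘(ℝ, ℝ) ((𝓡 n).prod 𝓘(ℝ, F)) s t) :
    ∃ (k : ℕ) (g : Fin k → ℝ → ℝ) (g' : Fin k → ℝ) (σ : Fin k → ∀ y, E y),
      (∀ i, HasDerivAt (g i) (g' i) t) ∧
      (∀ i, MDifferentiableAt (𝓡 n) ((𝓡 n).prod 𝓘(ℝ, F))
        (fun y => (⟨y, σ i y⟩ : TotalSpace F E)) (s t).proj) ∧
      s =ᶠ[𝓝 t] fun τ => ⟨(s τ).proj, ∑ i, g i τ • σ i (s τ).proj⟩ := by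
  set e := trivializationAt F E (s t).proj with he
  let b := Module.finBasis ℝ F
  have hb : (s t).proj ∈ e.baseSet := FiberBundle.mem_baseSet_trivializationAt' _
  have hγ : MDifferentiableAt 𝓘(ℝ, ℝ) (𝓡 n) (fun τ => (s τ).proj) t :=
    ((contMDiff_proj E (n := 1)).mdifferentiable (by simp) (s t)).comp t hs
  refine ⟨_, fun i τ => b.repr (e (s τ)).2 i,
    fun i => b.repr (deriv (fun τ => (e (s τ)).2) t) i, fun i y => e.symm y (b i),
    fun i => (LinearMap.toContinuousLinearMap (b.coord i)).hasFDerivAt.comp_hasDerivAt t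
      (differentiableAt_trivialization_snd hs hb).hasDerivAt,
    fun i => mdifferentiableAt_symm_const hb (b i), ?_⟩
  filter_upwards [hγ.continuousAt.preimage_mem_nhds (e.open_baseSet.mem_nhds hb)] with τ hτ
  have h1 : ∑ i, b.repr (e (s τ)).2 i • e.symm (s τ).proj (b i) = (s τ).2 := by
    simp_rw [← e.symmL_apply (R := ℝ) hτ]
    rw [← e.symm_proj_apply (s τ) hτ, ← e.symmL_apply (R := ℝ) hτ]
    conv_rhs => rw [← b.sum_repr (e (s τ)).2, map_sum]
    exact Finset.sum_congr rfl fun i _ => (map_smul _ _ _).symm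
  rw [h1]

/-- The covariant derivative along curves commutes with the vector bundle automorphisms that
preserve the connection. -/
theorem covDerivAlong_comp_of_invariant {cov : CovariantDerivative (𝓡 n) F E}
    {T : TotalSpace F E → TotalSpace F E} {f g : M → M}
    (hT : ContMDiff ((𝓡 n).prod 𝓘(ℝ, F)) ((𝓡 n).prod 𝓘(ℝ, F)) ∞ T)
    (hf : ContMDiff (𝓡 n) (𝓡 n) ∞ f) (hg : ContMDiff (𝓡 n) (𝓡 n) ∞ g)
    (hgf : ∀ y, g (f y) = y) (hfg : ∀ y, f (g y) = y)
    (hlin : ∀ y, ∃ L : E y →ₗ[ℝ] E (f y), ∀ v, T ⟨y, v⟩ = ⟨f y, L v⟩)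
    (hinv : ∀ σ σ' : ∀ y, E y, (∀ y, T ⟨y, σ y⟩ = ⟨f y, σ' (f y)⟩) →
      ∀ (x : M) (X : TangentSpace (𝓡 n) x),
        MDifferentiableAt (𝓡 n) ((𝓡 n).prod 𝓘(ℝ, F)) (fun y => (⟨y, σ y⟩ : TotalSpace F E)) x →
        T ⟨x, cov σ x X⟩ = ⟨f x, cov σ' (f x) (mfderiv (𝓡 n) (𝓡 n) f x X)⟩)
    {s : ℝ → TotalSpace F E} {t : ℝ}
    (hs : MDifferentiableAt 𝓘(ℝ, ℝ) ((𝓡 n).prod 𝓘(ℝ, F)) s t) :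
    T ⟨(s t).proj, covDerivAlong cov s t⟩ =
      ⟨(T (s t)).proj, covDerivAlong cov (fun τ => T (s τ)) t⟩ := by
  obtain ⟨k, c, c', σ, hc, hσ, hsum⟩ := exists_local_frame_expansion hs
  have hγ : MDifferentiableAt 𝓘(ℝ, ℝ) (𝓡 n) (fun τ => (s τ).proj) t :=
    ((contMDiff_proj E (n := 1)).mdifferentiable (by simp) (s t)).comp t hs
  -- The transported section at `z` is the image under `T` of `σ i` at `g z`; it lies over `f (g
  -- z)`, which must be rewritten to `z`.
  have hex (i : Fin k) : ∃ σ' : ∀ y, E y, ∀ y, T ⟨y, σ i y⟩ = ⟨f y, σ' (f y)⟩ := by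
    have h1 (z : M) : ∃ v : E z, T ⟨g z, σ i (g z)⟩ = ⟨z, v⟩ := by
      obtain ⟨L, hL⟩ := hlin (g z)
      rw [hL]
      generalize L (σ i (g z)) = v
      revert v
      rw [hfg]
      exact fun v => ⟨v, rfl⟩
    choose σ' hσ' using h1
    refine ⟨σ', fun y => ?_⟩
    have := hσ' (f y)
    rwa [hgf] at this
  choose σ' hσ' using hex
  have hσ'd (i : Fin k) : MDifferentiableAt (𝓡 n) ((𝓡 n).prod 𝓘(ℝ, F))
      (fun y => (⟨y, σ' i y⟩ : TotalSpace F E)) (f (s t).proj) := by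
    have h1 : (fun y => (⟨y, σ' i y⟩ : TotalSpace F E)) = fun y => T ⟨g y, σ i (g y)⟩ := by
      funext y
      rw [hσ' i (g y), hfg]
    rw [h1]
    have h2 : MDifferentiableAt (𝓡 n) ((𝓡 n).prod 𝓘(ℝ, F))
      (fun y => (⟨y, σ i y⟩ : TotalSpace F E)) (g (f (s t).proj)) := by rw [hgf]; exact hσ i
    exact ((hT.mdifferentiable (by simp)) _).comp _
      (h2.comp _ ((hg.mdifferentiable (by simp)) _))
  have hTlin (y : M) (a b : Fin k → ℝ) (v : Fin k → E y) (w w' : Fin k → E y)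
      (w₁ w₁' : Fin k → E (f y)) (h : ∀ i, T ⟨y, w i⟩ = ⟨f y, w₁ i⟩)
      (h' : ∀ i, T ⟨y, w' i⟩ = ⟨f y, w₁' i⟩) :
      T ⟨y, ∑ i, (a i • w i + b i • w' i)⟩ = ⟨f y, ∑ i, (a i • w₁ i + b i • w₁' i)⟩ := by
    obtain ⟨L, hL⟩ := hlin y
    have h1 (i) : L (w i) = w₁ i := TotalSpace.mk_injective _ ((hL _).symm.trans (h i))
    have h2 (i) : L (w' i) = w₁' i := TotalSpace.mk_injective _ ((hL _).symm.trans (h' i))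
    rw [hL]
    simp only [map_sum, map_add, map_smul, h1, h2]
  rw [covDerivAlong_eq_sum cov hγ hsum hc hσ]
  rw [hTlin _ c' (fun i => c i t) (fun i => σ i _) _ _ (fun i => σ' i _) _ (fun i => hσ' i _)
    (fun i => hinv (σ i) (σ' i) (hσ' i) _ _ (hσ i))]
  have hfγ : MDifferentiableAt 𝓘(ℝ, ℝ) (𝓡 n) (fun τ => f (s τ).proj) t :=
    ((hf.mdifferentiable (by simp)) _).comp t hγ
  have hsum' : (fun τ => T (s τ)) =ᶠ[𝓝 t]
      fun τ => ⟨f (s τ).proj, ∑ i, c i τ • σ' i (f (s τ).proj)⟩ := by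
    filter_upwards [hsum] with τ hτ
    rw [hτ]
    obtain ⟨L, hL⟩ := hlin (s τ).proj
    rw [hL, map_sum]
    have h1 (i) : L (c i τ • σ i (s τ).proj) = c i τ • σ' i (f (s τ).proj) := by
      rw [map_smul]
      exact congrArg _ (TotalSpace.mk_injective _ ((hL _).symm.trans (hσ' i _)))
    simp only [h1]
  have hchain : (mfderiv 𝓘(ℝ, ℝ) (𝓡 n) (fun τ => f (s τ).proj) t (1 : ℝ)) =
      mfderiv (𝓡 n) (𝓡 n) f (s t).proj
        (mfderiv 𝓘(ℝ, ℝ) (𝓡 n) (fun τ => (s τ).proj) t (1 : ℝ)) := by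
    have := mfderiv_comp (I := 𝓘(ℝ, ℝ)) (I' := 𝓡 n) (I'' := 𝓡 n) t
      ((hf.mdifferentiable (by simp)) (s t).proj) hγ
    exact congrArg (fun L : ℝ →L[ℝ] EuclideanSpace ℝ (Fin n) => L 1) this
  rw [covDerivAlong_eq_sum cov hfγ hsum' hc hσ'd, hchain]

end Invariance

/-! ### Isometries and the Levi-Civita connection -/

section Isometry

variable {n : ℕ} {M : Type*} [TopologicalSpace M] [ChartedSpace (EuclideanSpace ℝ (Fin n)) M]
  [IsManifold (𝓡 n) ∞ M] [T2Space M]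
  {gm : ContMDiffRiemannianMetric (𝓡 n) ∞ (EuclideanSpace ℝ (Fin n))
    (TangentSpace (𝓡 n) : M → Type _)}
  {cov : CovariantDerivative (𝓡 n) (EuclideanSpace ℝ (Fin n))
    (TangentSpace (𝓡 n) : M → Type _)}
  {f g : M → M} {x : M}

lemma mfderiv_comp_mfderiv_of_inverse (hf : ContMDiff (𝓡 n) (𝓡 n) ∞ f)
    (hg : ContMDiff (𝓡 n) (𝓡 n) ∞ g) (hgf : ∀ y, g (f y) = y) (y : M)
    (v : TangentSpace (𝓡 n) y) :
    (mfderiv (𝓡 n) (𝓡 n) g (f y) (mfderiv (𝓡 n) (𝓡 n) f y v) : EuclideanSpace ℝ (Fin n)) = v := by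
  have h1 := mfderiv_comp (I := 𝓡 n) (I' := 𝓡 n) (I'' := 𝓡 n) y
    ((hg.mdifferentiable (by simp)) (f y)) ((hf.mdifferentiable (by simp)) y)
  have h2 : g ∘ f = id := funext hgf
  rw [h2, mfderiv_id] at h1
  exact (congrArg (fun L : EuclideanSpace ℝ (Fin n) →L[ℝ] EuclideanSpace ℝ (Fin n) => L v) h1).symm

/-- The vector field `X'` is the image of `X` under `f`. -/
def IsRelated (f : M → M) (X X' : ∀ y : M, TangentSpace (𝓡 n) y) : Prop :=
  ∀ y, X' (f y) = mfderiv (𝓡 n) (𝓡 n) f y (X y)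

lemma IsRelated.mdifferentiableAt (hf : ContMDiff (𝓡 n) (𝓡 n) ∞ f)
    (hg : ContMDiff (𝓡 n) (𝓡 n) ∞ g) (hgf : ∀ y, g (f y) = y) (hfg : ∀ y, f (g y) = y)
    {X X' : ∀ y : M, TangentSpace (𝓡 n) y} (h : IsRelated f X X')
    (hX : MDifferentiableAt (𝓡 n) (𝓡 n).tangent (fun y => (⟨y, X y⟩ : TangentBundle (𝓡 n) M)) x) :
    MDifferentiableAt (𝓡 n) (𝓡 n).tangent
      (fun y => (⟨y, X' y⟩ : TangentBundle (𝓡 n) M)) (f x) := by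
  have h1 : (fun y => (⟨y, X' y⟩ : TangentBundle (𝓡 n) M)) =
      fun y => tangentMap (𝓡 n) (𝓡 n) f ⟨g y, X (g y)⟩ := by
    funext y
    have := h (g y)
    rw [tangentMap, ← this, hfg]
  rw [h1]
  have h2 : MDifferentiableAt (𝓡 n) (𝓡 n).tangent
      (fun y => (⟨y, X y⟩ : TangentBundle (𝓡 n) M)) (g (f x)) := by rw [hgf]; exact hX
  have h3 : ContMDiff (𝓡 n).tangent (𝓡 n).tangent ∞ (tangentMap (𝓡 n) (𝓡 n) f) :=
    hf.contMDiff_tangentMap (by simp)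
  exact ((h3.mdifferentiable (by simp)) _).comp _ (h2.comp _ ((hg.mdifferentiable (by simp)) _))

lemma exists_isRelated (hgf : ∀ y, g (f y) = y)
    (X : ∀ y : M, TangentSpace (𝓡 n) y) : ∃ X' : ∀ y : M, TangentSpace (𝓡 n) y,
      IsRelated f X X' := by
  let X' : ∀ y : M, TangentSpace (𝓡 n) y := fun y =>
    (mfderiv (𝓡 n) (𝓡 n) f (g y) (X (g y)) : EuclideanSpace ℝ (Fin n))
  refine ⟨X', fun y => ?_⟩
  change (mfderiv (𝓡 n) (𝓡 n) f (g (f y)) (X (g (f y))) : EuclideanSpace ℝ (Fin n)) = _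
  rw [hgf]

lemma exists_vectorField_eq (x : M) (v : TangentSpace (𝓡 n) x) :
    ∃ X : ∀ y : M, TangentSpace (𝓡 n) y, X x = v ∧
      MDifferentiableAt (𝓡 n) (𝓡 n).tangent (fun y => (⟨y, X y⟩ : TangentBundle (𝓡 n) M)) x := by
  set e := trivializationAt (EuclideanSpace ℝ (Fin n)) (TangentSpace (𝓡 n) : M → Type _) x
  have hb : x ∈ e.baseSet := FiberBundle.mem_baseSet_trivializationAt' _
  exact ⟨fun y => e.symm y (e ⟨x, v⟩).2, e.symm_proj_apply ⟨x, v⟩ hb,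
    mdifferentiableAt_symm_const hb _⟩

/-- For a diffeomorphism, relatedness means that `X` is the pullback of `X'`, and pullback commutes
with the Lie bracket. -/
lemma IsRelated.mfderiv_mlieBracket (hf : ContMDiff (𝓡 n) (𝓡 n) ∞ f)
    (hg : ContMDiff (𝓡 n) (𝓡 n) ∞ g) (hgf : ∀ y, g (f y) = y) (hfg : ∀ y, f (g y) = y)
    {X X' Y Y' : ∀ y : M, TangentSpace (𝓡 n) y} (hXX' : IsRelated f X X')
    (hYY' : IsRelated f Y Y')
    (hX : MDifferentiableAt (𝓡 n) (𝓡 n).tangent (fun y => (⟨y, X y⟩ : TangentBundle (𝓡 n) M)) x)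
    (hY : MDifferentiableAt (𝓡 n) (𝓡 n).tangent (fun y => (⟨y, Y y⟩ : TangentBundle (𝓡 n) M)) x) :
    mfderiv (𝓡 n) (𝓡 n) f x (VectorField.mlieBracket (𝓡 n) X Y x) =
      VectorField.mlieBracket (𝓡 n) X' Y' (f x) := by
  have hinv (y : M) : (mfderiv (𝓡 n) (𝓡 n) f y).IsInvertible := by
    refine ⟨ContinuousLinearEquiv.equivOfInverse
      (mfderiv (𝓡 n) (𝓡 n) f y : EuclideanSpace ℝ (Fin n) →L[ℝ] EuclideanSpace ℝ (Fin n))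
      (mfderiv (𝓡 n) (𝓡 n) g (f y) : EuclideanSpace ℝ (Fin n) →L[ℝ] EuclideanSpace ℝ (Fin n))
      (mfderiv_comp_mfderiv_of_inverse hf hg hgf y) fun v => ?_, rfl⟩
    have := mfderiv_comp_mfderiv_of_inverse hg hf hfg (f y) v
    rwa [hgf] at this
  have hpull {Z Z' : ∀ y : M, TangentSpace (𝓡 n) y} (h : IsRelated f Z Z') :
      VectorField.mpullback (𝓡 n) (𝓡 n) f Z' = Z := by
    funext y
    rw [VectorField.mpullback_apply, h y]
    exact (hinv y).inverse_apply_eq.2 rfl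
  have hm := minSmoothness_of_isRCLikeNormedField (𝕜 := ℝ) (n := 2)
  have : IsManifold (𝓡 n) (minSmoothness ℝ 2) M :=
    IsManifold.of_le (n := ∞) (by rw [hm]; exact ENat.LEInfty.out)
  have h1 := VectorField.mpullback_mlieBracket (n := ∞)
    (hXX'.mdifferentiableAt hf hg hgf hfg hX) (hYY'.mdifferentiableAt hf hg hgf hfg hY)
    (hf x) (by rw [hm]; exact ENat.LEInfty.out)
  rw [hpull hXX', hpull hYY', VectorField.mpullback_apply] at h1
  exact ((hinv x).inverse_apply_eq.1 h1).symm

lemma mdifferentiableAt_inner {X Y : ∀ y : M, TangentSpace (𝓡 n) y}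
    (hX : MDifferentiableAt (𝓡 n) (𝓡 n).tangent (fun y => (⟨y, X y⟩ : TangentBundle (𝓡 n) M)) x)
    (hY : MDifferentiableAt (𝓡 n) (𝓡 n).tangent (fun y => (⟨y, Y y⟩ : TangentBundle (𝓡 n) M)) x) :
    MDifferentiableAt (𝓡 n) 𝓘(ℝ, ℝ) (fun y => gm.inner y (X y) (Y y)) x := by
  have h := MDifferentiableAt.clm_bundle_apply₂ (F₁ := EuclideanSpace ℝ (Fin n))
    (F₂ := EuclideanSpace ℝ (Fin n)) (F₃ := ℝ) (E₃ := Bundle.Trivial M ℝ) (b := fun y => y)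
    (ψ := fun y => gm.inner y) (v := X) (w := Y)
    ((gm.contMDiff.mdifferentiable (by simp)) x) hX hY
  have h2 := (mdifferentiableAt_totalSpace _ _).1 h
  exact h2.2

/-- Isometries preserve the Levi-Civita connection. -/
theorem IsLeviCivita.mfderiv_covDeriv (hlc : IsLeviCivita gm cov)
    (hf : ContMDiff (𝓡 n) (𝓡 n) ∞ f)
    (hg : ContMDiff (𝓡 n) (𝓡 n) ∞ g) (hgf : ∀ y, g (f y) = y) (hfg : ∀ y, f (g y) = y)
    (hiso : ∀ (x : M) (v w : TangentSpace (𝓡 n) x),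
      gm.inner (f x) (mfderiv (𝓡 n) (𝓡 n) f x v) (mfderiv (𝓡 n) (𝓡 n) f x w) = gm.inner x v w)
    {Y Y' : ∀ y : M, TangentSpace (𝓡 n) y} (hYY' : IsRelated f Y Y')
    (hY : MDifferentiableAt (𝓡 n) (𝓡 n).tangent (fun y => (⟨y, Y y⟩ : TangentBundle (𝓡 n) M)) x)
    (v : TangentSpace (𝓡 n) x) :
    mfderiv (𝓡 n) (𝓡 n) f x (cov Y x v) = cov Y' (f x) (mfderiv (𝓡 n) (𝓡 n) f x v) := by
  let MD (X : ∀ y : M, TangentSpace (𝓡 n) y) : Prop :=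
    MDifferentiableAt (𝓡 n) (𝓡 n).tangent (fun y => (⟨y, X y⟩ : TangentBundle (𝓡 n) M)) x
  let df : TangentSpace (𝓡 n) x →L[ℝ] TangentSpace (𝓡 n) (f x) := mfderiv (𝓡 n) (𝓡 n) f x
  -- The difference between the connection and its transport by `f`. Both are torsion-free, so it is
  -- symmetric in `X` and `Y`; both are metric, so its pairing with `Z` is skew in `Y` and `Z`.
  let S (X Y Y' : ∀ y : M, TangentSpace (𝓡 n) y) : TangentSpace (𝓡 n) (f x) :=
    cov Y' (f x) (df (X x)) - df (cov Y x (X x))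
  have hmd {X X'} (h : IsRelated f X X') (hX : MD X) := h.mdifferentiableAt hf hg hgf hfg hX
  have hsymm {X X' Y Y'} (h : IsRelated f X X') (h' : IsRelated f Y Y') (hX : MD X) (hY : MD Y) :
      S X Y Y' = S Y X X' := by
    have h1 := (CovariantDerivative.torsion_eq_zero_iff cov).1 hlc.torsion_eq_zero (hmd h hX) (hmd h' hY)
    have h2 := (CovariantDerivative.torsion_eq_zero_iff cov).1 hlc.torsion_eq_zero hX hY
    rw [← IsRelated.mfderiv_mlieBracket hf hg hgf hfg h h' hX hY, ← h2, map_sub, h x, h' x] at h1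
    change cov Y' (f x) (df (X x)) - cov X' (f x) (df (Y x)) =
      df (cov Y x (X x)) - df (cov X x (Y x)) at h1
    change cov Y' (f x) (df (X x)) - df (cov Y x (X x)) =
      cov X' (f x) (df (Y x)) - df (cov X x (Y x))
    rw [sub_eq_sub_iff_add_eq_add] at h1 ⊢
    rw [h1, add_comm]
  have hskew {X X' Y Y' Z Z'} (h : IsRelated f X X') (h' : IsRelated f Y Y')
      (h'' : IsRelated f Z Z') (hX : MD X) (hY : MD Y) (hZ : MD Z) :
      gm.inner (f x) (S X Y Y') (df (Z x)) = - gm.inner (f x) (S X Z Z') (df (Y x)) := by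
    have h1 := hlc.metric Y' Z' (f x) (hmd h' hY) (hmd h'' hZ) (df (X x))
    have h2 := hlc.metric Y Z x hY hZ (X x)
    have h3 : mfderiv (𝓡 n) 𝓘(ℝ, ℝ) (fun y => gm.inner y (Y' y) (Z' y)) (f x) (df (X x)) =
        mfderiv (𝓡 n) 𝓘(ℝ, ℝ) (fun y => gm.inner y (Y y) (Z y)) x (X x) := by
      have h4 : (fun y => gm.inner y (Y y) (Z y)) =
          (fun y => gm.inner y (Y' y) (Z' y)) ∘ f := by
        funext y
        change _ = gm.inner (f y) (Y' (f y)) (Z' (f y))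
        rw [h' y, h'' y, hiso]
      rw [h4, mfderiv_comp x (mdifferentiableAt_inner (hmd h' hY) (hmd h'' hZ))
        ((hf.mdifferentiable (by simp)) x)]
      rfl
    have h5 : gm.inner (f x) (cov Y' (f x) (df (X x))) (df (Z x)) +
        gm.inner (f x) (df (Y x)) (cov Z' (f x) (df (X x))) =
        gm.inner (f x) (df (cov Y x (X x))) (df (Z x)) +
        gm.inner (f x) (df (Y x)) (df (cov Z x (X x))) := by
      have e1 : gm.inner (f x) (df (cov Y x (X x))) (df (Z x)) =
        gm.inner x (cov Y x (X x)) (Z x) := hiso _ _ _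
      have e2 : gm.inner (f x) (df (Y x)) (df (cov Z x (X x))) =
        gm.inner x (Y x) (cov Z x (X x)) := hiso _ _ _
      rw [e1, e2, ← h2, ← h3, h1, h' x, h'' x]
    change gm.inner (f x) (cov Y' (f x) (df (X x)) - df (cov Y x (X x))) (df (Z x)) =
      - gm.inner (f x) (cov Z' (f x) (df (X x)) - df (cov Z x (X x))) (df (Y x))
    rw [gm.symm (f x) (_ - _) (df (Y x)), map_sub, map_sub, _root_.sub_apply]
    linarith
  obtain ⟨X, hXv, hX⟩ := exists_vectorField_eq x v
  obtain ⟨X', hXX'⟩ := exists_isRelated hgf X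
  -- Chosen so that `df` maps `Z x` to the difference itself; positivity of the metric then finishes
  -- the proof.
  let w : TangentSpace (𝓡 n) x :=
    (mfderiv (𝓡 n) (𝓡 n) g (f x) (S X Y Y') : EuclideanSpace ℝ (Fin n))
  obtain ⟨Z, hZw, hZ⟩ := exists_vectorField_eq x w
  obtain ⟨Z', hZZ'⟩ := exists_isRelated hgf Z
  have hdZ : df (Z x) = S X Y Y' := by
    rw [hZw]
    have := mfderiv_comp_mfderiv_of_inverse hg hf hfg (f x) (S X Y Y')
    rwa [hgf] at this
  have hzero : gm.inner (f x) (S X Y Y') (df (Z x)) = 0 := by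
    -- Alternating symmetry and skewness three times returns the same pairing with the opposite
    -- sign.
    have e1 := hskew hXX' hYY' hZZ' hX hY hZ
    have e2 := hskew hZZ' hXX' hYY' hZ hX hY
    have e3 := hskew hYY' hZZ' hXX' hY hZ hX
    rw [hsymm hXX' hZZ' hX hZ] at e1
    rw [hsymm hZZ' hYY' hZ hY] at e2
    rw [hsymm hYY' hXX' hY hX] at e3
    linarith
  have hS : S X Y Y' = 0 := by
    by_contra hne
    rw [hdZ] at hzero
    exact (gm.pos _ _ hne).ne' hzero
  have h6 : cov Y' (f x) (df (X x)) - df (cov Y x (X x)) = 0 := hS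
  rw [sub_eq_zero, hXv] at h6
  exact h6.symm

end Isometry

/-! ### Geodesics: invariance under isometries and uniqueness -/

section Geodesic

variable {n : ℕ} {M : Type*} [TopologicalSpace M] [ChartedSpace (EuclideanSpace ℝ (Fin n)) M]

/-- The total space of a fiber bundle over a Hausdorff base with Hausdorff fibers is Hausdorff. -/
lemma t2Space_totalSpace {B : Type*} [TopologicalSpace B] [T2Space B] (F : Type*)
    [TopologicalSpace F] [T2Space F] (E : B → Type*) [TopologicalSpace (TotalSpace F E)]
    [∀ b, TopologicalSpace (E b)] [FiberBundle F E] : T2Space (TotalSpace F E) := by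
  refine ⟨fun Z Z' hne => ?_⟩
  by_cases hp : Z.proj = Z'.proj
  · set e := trivializationAt F E Z.proj
    have hZ : Z ∈ e.source := e.mem_source.2 (FiberBundle.mem_baseSet_trivializationAt' _)
    have hZ' : Z' ∈ e.source := by
      rw [e.mem_source, ← hp]
      exact FiberBundle.mem_baseSet_trivializationAt' _
    have hne' : e Z ≠ e Z' := fun h => hne (e.injOn hZ hZ' h)
    obtain ⟨u, v, hu, hv, hZu, hZv, huv⟩ := t2_separation hne'
    exact ⟨e.source ∩ e ⁻¹' u, e.source ∩ e ⁻¹' v,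
      e.continuousOn.isOpen_inter_preimage e.open_source hu,
      e.continuousOn.isOpen_inter_preimage e.open_source hv, ⟨hZ, hZu⟩, ⟨hZ', hZv⟩,
      (huv.preimage e).mono inter_subset_right inter_subset_right⟩
  · obtain ⟨u, v, hu, hv, hZu, hZv, huv⟩ := t2_separation hp
    exact ⟨_, _, hu.preimage (FiberBundle.continuous_proj F E),
      hv.preimage (FiberBundle.continuous_proj F E), hZu, hZv, huv.preimage _⟩

variable [IsManifold (𝓡 n) ∞ M] [T2Space M]
  {cov : CovariantDerivative (𝓡 n) (EuclideanSpace ℝ (Fin n)) (TangentSpace (𝓡 n) : M → Type _)}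

/-- `γ` is a geodesic for times in `J`. -/
def IsGeodesicOn (cov : CovariantDerivative (𝓡 n) (EuclideanSpace ℝ (Fin n))
    (TangentSpace (𝓡 n) : M → Type _)) (γ : ℝ → M) (J : Set ℝ) : Prop :=
  ContMDiffOn 𝓘(ℝ, ℝ) (𝓡 n) ∞ γ J ∧ IsParallelOn cov (velocity γ) J

lemma velocity_congr {γ γ' : ℝ → M} {t : ℝ} (h : γ =ᶠ[𝓝 t] γ') : velocity (n := n) γ t = velocity γ' t := by
  let Φ (y : M) (v : EuclideanSpace ℝ (Fin n)) : TangentBundle (𝓡 n) M := ⟨y, v⟩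
  change Φ (γ t) _ = Φ (γ' t) _
  exact congr (congrArg Φ h.eq_of_nhds)
    (congrArg (fun L : ℝ →L[ℝ] EuclideanSpace ℝ (Fin n) => L 1) h.mfderiv_eq)

lemma trivializationAt_velocity_snd {x₀ : M} {γ : ℝ → M} {t : ℝ}
    (hγ : MDifferentiableAt 𝓘(ℝ, ℝ) (𝓡 n) γ t) (ht : γ t ∈ (extChartAt (𝓡 n) x₀).source) :
    (trivializationAt (EuclideanSpace ℝ (Fin n)) (TangentSpace (𝓡 n) : M → Type _) x₀
        (velocity γ t)).2 = deriv (fun τ => extChartAt (𝓡 n) x₀ (γ τ)) t := by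
  rw [← continuousLinearMapAt_velocity hγ ht]
  rw [extChartAt_source] at ht
  rw [Trivialization.continuousLinearMapAt_apply ℝ, Trivialization.coe_linearMapAt_of_mem _ ht]
  rfl

lemma velocity_comp {f : M → M} (hf : ContMDiff (𝓡 n) (𝓡 n) ∞ f) {γ : ℝ → M} {t : ℝ}
    (hγ : MDifferentiableAt 𝓘(ℝ, ℝ) (𝓡 n) γ t) :
    velocity (fun τ => f (γ τ)) t = tangentMap (𝓡 n) (𝓡 n) f (velocity γ t) := by
  have := mfderiv_comp (I := 𝓘(ℝ, ℝ)) (I' := 𝓡 n) (I'' := 𝓡 n) t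
    ((hf.mdifferentiable (by simp)) (γ t)) hγ
  exact congrArg (TotalSpace.mk (f (γ t)))
    (congrArg (fun L : ℝ →L[ℝ] EuclideanSpace ℝ (Fin n) => L 1) this)

/-- Isometries map geodesics to geodesics. -/
theorem IsGeodesicOn.comp_isometry
    {gm : ContMDiffRiemannianMetric (𝓡 n) ∞ (EuclideanSpace ℝ (Fin n))
      (TangentSpace (𝓡 n) : M → Type _)} (hlc : IsLeviCivita gm cov) {f g : M → M}
    (hf : ContMDiff (𝓡 n) (𝓡 n) ∞ f)
    (hg : ContMDiff (𝓡 n) (𝓡 n) ∞ g) (hgf : ∀ y, g (f y) = y) (hfg : ∀ y, f (g y) = y)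
    (hiso : ∀ (x : M) (v w : TangentSpace (𝓡 n) x),
      gm.inner (f x) (mfderiv (𝓡 n) (𝓡 n) f x v) (mfderiv (𝓡 n) (𝓡 n) f x w) = gm.inner x v w)
    {γ : ℝ → M} {J : Set ℝ} (hJ : IsOpen J) (hγ : IsGeodesicOn cov γ J) :
    IsGeodesicOn cov (fun t => f (γ t)) J := by
  have hγd : ∀ t ∈ J, MDifferentiableAt 𝓘(ℝ, ℝ) (𝓡 n) γ t := fun t ht =>
    (hγ.1.contMDiffAt (hJ.mem_nhds ht)).mdifferentiableAt (by simp)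
  have hT : ContMDiff (𝓡 n).tangent (𝓡 n).tangent ∞ (tangentMap (𝓡 n) (𝓡 n) f) :=
    hf.contMDiff_tangentMap (by simp)
  refine ⟨hf.comp_contMDiffOn hγ.1, (hT.comp_contMDiffOn hγ.2.1).congr fun t ht =>
    velocity_comp hf (hγd t ht), fun t ht => ?_⟩
  -- The velocity of `f ∘ γ` is the image of the velocity of `γ` under the tangent map, an
  -- automorphism that preserves the Levi-Civita connection.
  have key := covDerivAlong_comp_of_invariant (cov := cov) (T := tangentMap (𝓡 n) (𝓡 n) f) hT
    hf hg hgf hfg (fun y => ⟨(mfderiv (𝓡 n) (𝓡 n) f y).toLinearMap, fun v => rfl⟩)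
    (fun Y Y' h x X hY => congrArg (TotalSpace.mk (f x))
      (hlc.mfderiv_covDeriv hf hg hgf hfg hiso
        (fun y => (TotalSpace.mk_injective _ (h y)).symm) hY X))
    ((hγ.2.1.contMDiffAt (hJ.mem_nhds ht)).mdifferentiableAt (by simp))
  have h1 : velocity (fun τ => f (γ τ)) =ᶠ[𝓝 t]
      fun τ => tangentMap (𝓡 n) (𝓡 n) f (velocity γ τ) := by
    filter_upwards [hJ.mem_nhds ht] with τ hτ using velocity_comp hf (hγd τ hτ)
  have h2 := (covDerivAlong_congr (cov := cov) h1).trans key.symm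
  rw [hγ.2.2 t ht] at h2
  have h3 : tangentMap (𝓡 n) (𝓡 n) f ⟨(velocity (n := n) γ t).proj, 0⟩ = ⟨f (γ t), 0⟩ :=
    congrArg (TotalSpace.mk (f (γ t))) (map_zero (mfderiv (𝓡 n) (𝓡 n) f (γ t)))
  exact TotalSpace.mk_injective _ (h2.trans h3)

/-- Geodesics are determined locally by their velocity. -/
theorem IsGeodesicOn.eventually_velocity_eq
    (hcov : CovariantDerivative.ContMDiffCovariantDerivative cov ∞) {γ₁ γ₂ : ℝ → M} {J : Set ℝ}
    (hJ : IsOpen J) (h₁ : IsGeodesicOn cov γ₁ J) (h₂ : IsGeodesicOn cov γ₂ J) {t₀ : ℝ}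
    (ht₀ : t₀ ∈ J) (heq : velocity (n := n) γ₁ t₀ = velocity γ₂ t₀) :
    ∀ᶠ t in 𝓝 t₀, velocity (n := n) γ₁ t = velocity γ₂ t := by
  obtain ⟨U, Ω, h⟩ := exists_isChristoffel cov hcov (γ₁ t₀)
  set x₀ := γ₁ t₀ with hx₀
  set e := trivializationAt (EuclideanSpace ℝ (Fin n)) (TangentSpace (𝓡 n) : M → Type _) x₀ with he
  set φ := extChartAt (𝓡 n) x₀ with hφ
  have h0 : γ₁ t₀ = γ₂ t₀ := congrArg TotalSpace.proj heq
  -- The geodesic equation as a first-order system for position and velocity in coordinates.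
  let v (z : EuclideanSpace ℝ (Fin n) × EuclideanSpace ℝ (Fin n)) :
      EuclideanSpace ℝ (Fin n) × EuclideanSpace ℝ (Fin n) := (z.2, -Ω z.1 z.2 z.2)
  let z (γ : ℝ → M) (τ : ℝ) : EuclideanSpace ℝ (Fin n) × EuclideanSpace ℝ (Fin n) :=
    (φ (γ τ), deriv (fun τ => φ (γ τ)) τ)
  have hU {γ : ℝ → M} (hγ : IsGeodesicOn cov γ J) (hγ0 : γ t₀ = x₀) :
      ∀ᶠ τ in 𝓝 t₀, τ ∈ J ∧ γ τ ∈ U :=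
    Filter.Eventually.and (hJ.mem_nhds ht₀)
      ((hγ.1.continuousOn.continuousAt (hJ.mem_nhds ht₀)).preimage_mem_nhds
        (h.isOpen.mem_nhds (by rw [hγ0]; exact h.mem)))
  have hz {γ : ℝ → M} (hγ : IsGeodesicOn cov γ J) (hγ0 : γ t₀ = x₀) :
      ∀ᶠ τ in 𝓝 t₀, HasDerivAt (z γ) (v (z γ τ)) τ := by
    have hγd : ∀ t ∈ J, MDifferentiableAt 𝓘(ℝ, ℝ) (𝓡 n) γ t := fun t ht =>
      (hγ.1.contMDiffAt (hJ.mem_nhds ht)).mdifferentiableAt (by simp)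
    filter_upwards [hU hγ hγ0, eventually_eventually_nhds.2 (hU hγ hγ0)] with τ hτ hτ'
    have hd : DifferentiableAt ℝ (fun τ => φ (γ τ)) τ := by
      have hs : γ τ ∈ (chartAt (EuclideanSpace ℝ (Fin n)) x₀).source := by
        have := h.subset_source hτ.2
        rwa [extChartAt_source] at this
      exact mdifferentiableAt_iff_differentiableAt.1
        ((mdifferentiableAt_extChartAt (I := 𝓡 n) hs).comp τ (hγd τ hτ.1))
    have hsd : MDifferentiableAt 𝓘(ℝ, ℝ) (𝓡 n).tangent (velocity γ) τ :=
      (hγ.2.1.contMDiffAt (hJ.mem_nhds hτ.1)).mdifferentiableAt (by simp)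
    have h1 := (h.covDerivAlong_eq_zero_iff hsd hτ.2).1 (hγ.2.2 τ hτ.1)
    have h2 := (differentiableAt_trivialization_snd (e := e) hsd
      (h.subset_baseSet hτ.2)).hasDerivAt
    have h3 : (fun τ => (e (velocity γ τ)).2) =ᶠ[𝓝 τ] deriv (fun τ => φ (γ τ)) := by
      filter_upwards [hτ'] with t ht
      exact trivializationAt_velocity_snd (hγd t ht.1) (h.subset_source ht.2)
    rw [h1] at h2
    have h4 := h2.congr_of_eventuallyEq h3.symm
    rw [trivializationAt_velocity_snd (hγd τ hτ.1) (h.subset_source hτ.2)] at h4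
    exact hd.hasDerivAt.prodMk h4
  have hv : ContDiffAt ℝ 1 v (z γ₁ t₀) := by
    have h1 : ContDiffAt ℝ 1 Ω (φ (γ₁ t₀)) :=
      (h.contDiffOn.contDiffAt (h.isOpen_domain.mem_nhds (h.mem_domain h.mem))).of_le (by simp)
    have h2 : ContDiffAt ℝ 1 (fun z : EuclideanSpace ℝ (Fin n) × EuclideanSpace ℝ (Fin n) =>
      Ω z.1) (z γ₁ t₀) := ContDiffAt.comp (z γ₁ t₀) (g := Ω) (f := Prod.fst) h1 contDiffAt_fst
    exact contDiffAt_snd.prodMk ((h2.clm_apply contDiffAt_snd).clm_apply contDiffAt_snd).neg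
  obtain ⟨K, s, hs, hLip⟩ := hv.exists_lipschitzOnWith
  have hz0 : z γ₁ t₀ = z γ₂ t₀ := by
    refine Prod.ext (congrArg φ h0) ?_
    have e1 := trivializationAt_velocity_snd (x₀ := x₀)
      ((h₁.1.contMDiffAt (hJ.mem_nhds ht₀)).mdifferentiableAt (by simp)) (h.subset_source h.mem)
    have e2 := trivializationAt_velocity_snd (x₀ := x₀)
      ((h₂.1.contMDiffAt (hJ.mem_nhds ht₀)).mdifferentiableAt (by simp))
      (by rw [← h0]; exact h.subset_source h.mem)
    rw [heq] at e1
    exact e1.symm.trans e2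
  have hzs {γ : ℝ → M} (hγ : IsGeodesicOn cov γ J) (hγ0 : γ t₀ = x₀) (hzγ : z γ t₀ = z γ₁ t₀) :
      ∀ᶠ τ in 𝓝 t₀, HasDerivAt (z γ) (v (z γ τ)) τ ∧ z γ τ ∈ s :=
    (hz hγ hγ0).and ((hz hγ hγ0).self_of_nhds.continuousAt.preimage_mem_nhds (by rwa [hzγ]))
  have huniq := ODE_solution_unique_of_eventually (v := fun _ => v) (s := fun _ => s)
    (Filter.Eventually.of_forall fun _ => hLip) (hzs h₁ rfl rfl) (hzs h₂ h0.symm hz0.symm) hz0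
  have hγeq : ∀ᶠ τ in 𝓝 t₀, γ₁ τ = γ₂ τ := by
    filter_upwards [huniq, hU h₁ rfl, hU h₂ h0.symm] with τ e1 e2 e3
    exact φ.injOn (h.subset_source e2.2) (h.subset_source e3.2) (congrArg Prod.fst e1)
  filter_upwards [eventually_eventually_nhds.2 hγeq] with τ hτ using velocity_congr hτ

/-- Agreement of velocities is open by local uniqueness and closed because the tangent bundle is
Hausdorff. -/
theorem IsGeodesicOn.velocity_eqOn
    (hcov : CovariantDerivative.ContMDiffCovariantDerivative cov ∞) {γ₁ γ₂ : ℝ → M} {J : Set ℝ}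
    (hJ : IsOpen J) (hJ' : IsPreconnected J) (h₁ : IsGeodesicOn cov γ₁ J)
    (h₂ : IsGeodesicOn cov γ₂ J) {t₀ : ℝ}
    (ht₀ : t₀ ∈ J) (heq : velocity (n := n) γ₁ t₀ = velocity γ₂ t₀) :
    ∀ t ∈ J, velocity (n := n) γ₁ t = velocity γ₂ t := by
  have : T2Space (TangentBundle (𝓡 n) M) :=
    t2Space_totalSpace (EuclideanSpace ℝ (Fin n)) (TangentSpace (𝓡 n) : M → Type _)
  refine hJ'.forall_of_locally_constant hJ Subset.rfl (fun t ht =>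
    ⟨h₁.eventually_velocity_eq hcov hJ h₂ ht, fun hne => ?_⟩) ht₀ heq
  exact ((h₁.2.1.continuousOn.continuousAt (hJ.mem_nhds ht)).prodMk
    (h₂.2.1.continuousOn.continuousAt (hJ.mem_nhds ht))).eventually_mem
    (isClosed_diagonal.isOpen_compl.mem_nhds hne)

end Geodesic

/-! ### The joint system for geodesics and parallel transport -/

section ODE

variable {Z : Type*} [NormedAddCommGroup Z] [NormedSpace ℝ Z]

/-- Solutions of smooth autonomous differential equations are smooth. -/
lemma contDiffOn_of_hasDerivAt {f : Z → Z} {O : Set Z} (hf : ContDiffOn ℝ ∞ f O) {y : ℝ → Z}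
    {J : Set ℝ} (hJ : IsOpen J) (hy : ∀ t ∈ J, y t ∈ O ∧ HasDerivAt y (f (y t)) t) :
    ContDiffOn ℝ ∞ y J := by
  rw [contDiffOn_infty]
  intro k
  -- If `y` is of class `C^k`, so is `y' = f ∘ y`, and then `y` is of class `C^(k+1)`.
  induction k with
  | zero =>
    exact contDiffOn_zero.2 fun t ht => (hy t ht).2.continuousAt.continuousWithinAt
  | succ k ih =>
    have h1 : ContDiffOn ℝ k (deriv y) J :=
      ((hf.of_le (by exact_mod_cast le_top)).comp ih fun t ht => (hy t ht).1).congr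
        fun t ht => (hy t ht).2.deriv
    refine (contDiffOn_succ_iff_deriv_of_isOpen hJ).2
      ⟨fun t ht => (hy t ht).2.differentiableAt.differentiableWithinAt, by simp, h1⟩

variable {C F : Type*} [NormedAddCommGroup C] [NormedSpace ℝ C]
  [NormedAddCommGroup F] [NormedSpace ℝ F]

/-- The vector field of the equations of geodesics and parallel transport in coordinates. -/
noncomputable def transportField (Ω : C → C →L[ℝ] C →L[ℝ] C) (A : C → C →L[ℝ] F →L[ℝ] F)
    (z : C × C × (F →L[ℝ] F)) : C × C × (F →L[ℝ] F) :=
  (z.2.1, -Ω z.1 z.2.1 z.2.1, -(A z.1 z.2.1).comp z.2.2)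

variable {Ω : C → C →L[ℝ] C →L[ℝ] C} {A : C → C →L[ℝ] F →L[ℝ] F} {O : Set C}

lemma contDiffOn_transportField (hΩ : ContDiffOn ℝ ∞ Ω O) (hA : ContDiffOn ℝ ∞ A O) :
    ContDiffOn ℝ ∞ (transportField Ω A) (Prod.fst ⁻¹' O) := by
  have hfst : ContDiffOn ℝ ∞ (Prod.fst : C × C × (F →L[ℝ] F) → C) (Prod.fst ⁻¹' O) :=
    contDiff_fst.contDiffOn
  have hp : ContDiffOn ℝ ∞ (fun z : C × C × (F →L[ℝ] F) => z.2.1) (Prod.fst ⁻¹' O) :=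
    (contDiff_fst.comp contDiff_snd).contDiffOn
  have hU : ContDiffOn ℝ ∞ (fun z : C × C × (F →L[ℝ] F) => z.2.2) (Prod.fst ⁻¹' O) :=
    (contDiff_snd.comp contDiff_snd).contDiffOn
  have hΩ' := hΩ.comp hfst fun z hz => hz
  have hA' := hA.comp hfst fun z hz => hz
  exact hp.prodMk (((hΩ'.clm_apply hp).clm_apply hp).neg.prodMk
    ((hA'.clm_apply hp).clm_comp hU).neg)

/-- Every term of the product rule keeps a factor `p z = 0`. -/
lemma hasFDerivAt_quadratic_of_eq_zero {P : Type*} [NormedAddCommGroup P] [NormedSpace ℝ P]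
    {g : Z → P →L[ℝ] P →L[ℝ] P} {p : Z → P} {p' : Z →L[ℝ] P} {z : Z}
    (hg : DifferentiableAt ℝ g z) (hp : HasFDerivAt p p' z) (hp0 : p z = 0) :
    HasFDerivAt (fun y => g y (p y) (p y)) (0 : Z →L[ℝ] P) z := by
  refine ((hg.hasFDerivAt.clm_apply hp).clm_apply hp).congr_fderiv ?_
  refine ContinuousLinearMap.ext fun w => ?_
  change g z (p z) (p' w) + (g z (p' w) (p z) + fderiv ℝ g z w (p z) (p z)) = 0
  simp only [hp0, map_zero, _root_.zero_apply, add_zero]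

/-- Only the term that differentiates `p` survives, since `p z = 0`. -/
lemma hasFDerivAt_comp_of_eq_zero {P : Type*} [NormedAddCommGroup P] [NormedSpace ℝ P]
    {g : Z → P →L[ℝ] F →L[ℝ] F} {p : Z → P} {p' : Z →L[ℝ] P} {u : Z → F →L[ℝ] F} {z : Z}
    (hg : DifferentiableAt ℝ g z) (hp : HasFDerivAt p p' z) (hp0 : p z = 0)
    (hu : DifferentiableAt ℝ u z) (hu0 : u z = ContinuousLinearMap.id ℝ F) :
    HasFDerivAt (fun y => (g y (p y)).comp (u y)) ((g z).comp p') z := by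
  refine ((hg.hasFDerivAt.clm_apply hp).clm_comp hu.hasFDerivAt).congr_fderiv ?_
  refine ContinuousLinearMap.ext fun w => ContinuousLinearMap.ext fun v => ?_
  change g z (p z) (fderiv ℝ u z w v) + (g z (p' w) (u z v) + fderiv ℝ g z w (p z) (u z v)) =
    g z (p' w) v
  simp only [hp0, hu0, map_zero, _root_.zero_apply, add_zero, zero_add,
    ContinuousLinearMap.id_apply]

lemma differentiableAt_comp_fst {P Q : Type*} [NormedAddCommGroup P] [NormedSpace ℝ P]
    [NormedAddCommGroup Q] [NormedSpace ℝ Q] {g : Z → Q} {z : Z} (hg : DifferentiableAt ℝ g z)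
    (y : P) : DifferentiableAt ℝ (fun w : Z × P => g w.1) (z, y) :=
  DifferentiableAt.comp (z, y) (g := g) (f := Prod.fst) hg differentiableAt_fst

set_option synthInstance.maxHeartbeats 200000 in
-- At zero velocity the linearization sends `(δc, δp, δU)` to `(δp, 0, -A c δp)`. Its output depends
-- on `δp` alone and has zero velocity component, so it squares to zero, as `exists_smooth_flow`
-- requires.
lemma hasFDerivAt_transportField {c : C} (hΩ : DifferentiableAt ℝ Ω c)
    (hA : DifferentiableAt ℝ A c) :
    ∃ f' : C × C × (F →L[ℝ] F) →L[ℝ] C × C × (F →L[ℝ] F),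
      HasFDerivAt (transportField Ω A) f' (c, 0, ContinuousLinearMap.id ℝ F) ∧
      f'.comp f' = 0 ∧ ∀ z, (f' z).1 = z.2.1 := by
  let p' : C × C × (F →L[ℝ] F) →L[ℝ] C := (ContinuousLinearMap.fst ℝ C (F →L[ℝ] F)).comp
    (ContinuousLinearMap.snd ℝ C (C × (F →L[ℝ] F)))
  have hp : HasFDerivAt (fun z : C × C × (F →L[ℝ] F) => z.2.1) p'
      (c, 0, ContinuousLinearMap.id ℝ F) := p'.hasFDerivAt
  have hU : DifferentiableAt ℝ (fun z : C × C × (F →L[ℝ] F) => z.2.2)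
      (c, 0, ContinuousLinearMap.id ℝ F) := differentiableAt_snd.snd
  have hΩ' : DifferentiableAt ℝ (fun z : C × C × (F →L[ℝ] F) => Ω z.1)
      (c, 0, ContinuousLinearMap.id ℝ F) := differentiableAt_comp_fst (Z := C) (P := C × (F →L[ℝ] F))
      (Q := C →L[ℝ] C →L[ℝ] C) (g := Ω) (z := c) hΩ _
  have hA' : DifferentiableAt ℝ (fun z : C × C × (F →L[ℝ] F) => A z.1)
      (c, 0, ContinuousLinearMap.id ℝ F) := differentiableAt_comp_fst (Z := C) (P := C × (F →L[ℝ] F))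
      (Q := C →L[ℝ] F →L[ℝ] F) (g := A) (z := c) hA _
  have h1 := (hasFDerivAt_quadratic_of_eq_zero hΩ' hp rfl).neg
  have h2 := (hasFDerivAt_comp_of_eq_zero hA' hp rfl hU rfl).neg
  refine ⟨_, hp.prodMk (h1.prodMk h2), ?_, fun z => rfl⟩
  refine ContinuousLinearMap.ext fun z => ?_
  refine Prod.ext ?_ (Prod.ext ?_ ?_)
  · exact neg_zero
  · exact neg_zero
  · change -(A c (-0)) = 0
    rw [neg_zero, map_zero, neg_zero]

end ODE

/-! ### From solutions in coordinates back to curves and sections -/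

section CoordinateSections

variable {n : ℕ} {M : Type*} [TopologicalSpace M] [ChartedSpace (EuclideanSpace ℝ (Fin n)) M]
  [IsManifold (𝓡 n) ∞ M] [T2Space M]
  {F : Type*} [NormedAddCommGroup F] [NormedSpace ℝ F] [FiniteDimensional ℝ F]
  {E : M → Type*} [TopologicalSpace (TotalSpace F E)]
  [∀ x, AddCommGroup (E x)] [∀ x, Module ℝ (E x)] [∀ x, TopologicalSpace (E x)]
  [∀ x, IsTopologicalAddGroup (E x)] [∀ x, ContinuousSMul ℝ (E x)] [FiberBundle F E]
  [VectorBundle ℝ F E] [ContMDiffVectorBundle ∞ F E (𝓡 n)]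
  {cov : CovariantDerivative (𝓡 n) F E}

lemma contMDiffOn_trivialization_symm {P H EP : Type*} [NormedAddCommGroup EP] [NormedSpace ℝ EP]
    [TopologicalSpace H] {I : ModelWithCorners ℝ EP H} [TopologicalSpace P] [ChartedSpace H P]
    {e : Trivialization F (TotalSpace.proj : TotalSpace F E → M)} [MemTrivializationAtlas e]
    {γ : P → M} {u : P → F} {J : Set P} (hγ : ContMDiffOn I (𝓡 n) ∞ γ J)
    (hu : ContMDiffOn I 𝓘(ℝ, F) ∞ u J) (hb : ∀ t ∈ J, γ t ∈ e.baseSet) :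
    ContMDiffOn I ((𝓡 n).prod 𝓘(ℝ, F)) ∞
      (fun t => (⟨γ t, e.symm (γ t) (u t)⟩ : TotalSpace F E)) J := by
  refine ((e.contMDiffOn_symm (n := ∞) (IB := 𝓡 n)).comp (hγ.prodMk hu)
    fun t ht => e.mem_target.2 (hb t ht)).congr fun t ht => ?_
  exact e.mk_symm (hb t ht) (u t)

/-- The equation of parallel sections in coordinates. -/
lemma IsChristoffel.isParallelOn {x₀ : M} {U : Set M}
    {Ω : EuclideanSpace ℝ (Fin n) → EuclideanSpace ℝ (Fin n) →L[ℝ] F →L[ℝ] F}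
    (h : IsChristoffel cov x₀ U Ω) {J : Set ℝ} (hJ : IsOpen J)
    {c c' : ℝ → EuclideanSpace ℝ (Fin n)} {u : ℝ → F} (hc : ContDiffOn ℝ ∞ c J)
    (hcU : ∀ t ∈ J, c t ∈ (extChartAt (𝓡 n) x₀).target ∩ (extChartAt (𝓡 n) x₀).symm ⁻¹' U)
    (hc' : ∀ t ∈ J, HasDerivAt c (c' t) t) (hu : ContDiffOn ℝ ∞ u J)
    (hu' : ∀ t ∈ J, HasDerivAt u (-Ω (c t) (c' t) (u t)) t)
    {s : ℝ → TotalSpace F E} (hs : ∀ t ∈ J, s t = ⟨(extChartAt (𝓡 n) x₀).symm (c t),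
      (trivializationAt F E x₀).symm ((extChartAt (𝓡 n) x₀).symm (c t)) (u t)⟩) :
    IsParallelOn cov s J := by
  set e := trivializationAt F E x₀ with he
  set φ := extChartAt (𝓡 n) x₀ with hφ
  have hγ : ContMDiffOn 𝓘(ℝ, ℝ) (𝓡 n) ∞ (fun t => φ.symm (c t)) J :=
    (contMDiffOn_extChartAt_symm x₀).comp hc.contMDiffOn fun t ht => (hcU t ht).1
  have hsm : ContMDiffOn 𝓘(ℝ, ℝ) ((𝓡 n).prod 𝓘(ℝ, F)) ∞ s J :=
    (contMDiffOn_trivialization_symm hγ hu.contMDiffOn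
      fun t ht => h.subset_baseSet (hcU t ht).2).congr hs
  refine ⟨hsm, fun t ht => ?_⟩
  have hp : ∀ t ∈ J, (s t).proj = φ.symm (c t) := fun t ht => congrArg TotalSpace.proj (hs t ht)
  have hes : ∀ t ∈ J, (e (s t)).2 = u t := fun t ht => by
    rw [hs t ht, e.apply_mk_symm (h.subset_baseSet (hcU t ht).2)]
  have hφs : ∀ t ∈ J, φ (s t).proj = c t := fun t ht => by rw [hp t ht, φ.right_inv (hcU t ht).1]
  have hU : (s t).proj ∈ U := by rw [hp t ht]; exact (hcU t ht).2
  rw [h.covDerivAlong_eq_zero_iff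
    ((hsm.contMDiffAt (hJ.mem_nhds ht)).mdifferentiableAt (by simp)) hU]
  have h1 : deriv (fun τ => (e (s τ)).2) t = deriv u t :=
    Filter.EventuallyEq.deriv_eq (Filter.eventually_of_mem (hJ.mem_nhds ht) hes)
  have h2 : deriv (fun τ => φ (s τ).proj) t = deriv c t :=
    Filter.EventuallyEq.deriv_eq (Filter.eventually_of_mem (hJ.mem_nhds ht) hφs)
  rw [h1, h2, (hu' t ht).deriv, (hc' t ht).deriv, hφs t ht, hes t ht]

/-- The equation of geodesics in coordinates. -/
lemma IsChristoffel.isGeodesicOn {cov : CovariantDerivative (𝓡 n) (EuclideanSpace ℝ (Fin n))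
      (TangentSpace (𝓡 n) : M → Type _)} {x₀ : M} {U : Set M}
    {Ω : EuclideanSpace ℝ (Fin n) → EuclideanSpace ℝ (Fin n) →L[ℝ] EuclideanSpace ℝ (Fin n) →L[ℝ]
      EuclideanSpace ℝ (Fin n)}
    (h : IsChristoffel cov x₀ U Ω) {J : Set ℝ} (hJ : IsOpen J)
    {c c' : ℝ → EuclideanSpace ℝ (Fin n)} (hc : ContDiffOn ℝ ∞ c J)
    (hcU : ∀ t ∈ J, c t ∈ (extChartAt (𝓡 n) x₀).target ∩ (extChartAt (𝓡 n) x₀).symm ⁻¹' U)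
    (hc' : ∀ t ∈ J, HasDerivAt c (c' t) t) (hc's : ContDiffOn ℝ ∞ c' J)
    (hc'' : ∀ t ∈ J, HasDerivAt c' (-Ω (c t) (c' t) (c' t)) t) :
    IsGeodesicOn cov (fun t => (extChartAt (𝓡 n) x₀).symm (c t)) J ∧
    ∀ t ∈ J, velocity (n := n) (fun t => (extChartAt (𝓡 n) x₀).symm (c t)) t =
      ⟨(extChartAt (𝓡 n) x₀).symm (c t),
        (trivializationAt (EuclideanSpace ℝ (Fin n)) (TangentSpace (𝓡 n) : M → Type _) x₀).symm
          ((extChartAt (𝓡 n) x₀).symm (c t)) (c' t)⟩ := by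
  set e := trivializationAt (EuclideanSpace ℝ (Fin n)) (TangentSpace (𝓡 n) : M → Type _) x₀ with he
  set φ := extChartAt (𝓡 n) x₀ with hφ
  have hγ : ContMDiffOn 𝓘(ℝ, ℝ) (𝓡 n) ∞ (fun t => φ.symm (c t)) J :=
    (contMDiffOn_extChartAt_symm x₀).comp hc.contMDiffOn fun t ht => (hcU t ht).1
  have hv : ∀ t ∈ J, velocity (n := n) (fun t => φ.symm (c t)) t =
      ⟨φ.symm (c t), e.symm (φ.symm (c t)) (c' t)⟩ := by
    intro t ht
    have hsrc : φ.symm (c t) ∈ φ.source := φ.map_target (hcU t ht).1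
    have hb := h.subset_baseSet (hcU t ht).2
    have h1 := trivializationAt_velocity_snd
      ((hγ.contMDiffAt (hJ.mem_nhds ht)).mdifferentiableAt (by simp)) hsrc
    have h2 : deriv (fun τ => φ (φ.symm (c τ))) t = c' t := by
      rw [← (hc' t ht).deriv]
      exact Filter.EventuallyEq.deriv_eq (Filter.eventually_of_mem (hJ.mem_nhds ht)
        fun τ hτ => φ.right_inv (hcU τ hτ).1)
    rw [h2] at h1
    refine e.injOn (e.mem_source.2 hb) (e.mem_source.2 hb) ?_
    exact (Prod.ext (e.coe_fst (e.mem_source.2 hb)) h1 : e _ = (φ.symm (c t), c' t)).trans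
      (e.apply_mk_symm hb _).symm
  exact ⟨⟨hγ, h.isParallelOn hJ hc hcU hc' hc's hc'' hv⟩, hv⟩

end CoordinateSections

/-! ### Smooth exponential map and radial parallel transport -/

section ExponentialData

variable {n : ℕ} {M : Type*} [TopologicalSpace M] [ChartedSpace (EuclideanSpace ℝ (Fin n)) M]
  [IsManifold (𝓡 n) ∞ M] [T2Space M]
  {F : Type*} [NormedAddCommGroup F] [NormedSpace ℝ F] [FiniteDimensional ℝ F]
  {E : M → Type*} [TopologicalSpace (TotalSpace F E)]
  [∀ x, AddCommGroup (E x)] [∀ x, Module ℝ (E x)] [∀ x, TopologicalSpace (E x)]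
  [∀ x, IsTopologicalAddGroup (E x)] [∀ x, ContinuousSMul ℝ (E x)] [FiberBundle F E]
  [VectorBundle ℝ F E] [ContMDiffVectorBundle ∞ F E (𝓡 n)]

/-- The derivative at the base point of the inverse of the preferred chart is the identity. -/
lemma hasMFDerivAt_extChartAt_symm_self (x : M) :
    HasMFDerivAt (𝓡 n) (𝓡 n) (extChartAt (𝓡 n) x).symm (extChartAt (𝓡 n) x x)
      (ContinuousLinearMap.id ℝ (EuclideanSpace ℝ (Fin n))) := by
  have := IsManifold.of_le (I := 𝓡 n) (M := M) (m := 1) (n := ∞) (by simp)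
  have h1 : MDifferentiableAt (𝓡 n) (𝓡 n) (extChartAt (𝓡 n) x).symm (extChartAt (𝓡 n) x x) :=
    ((contMDiffOn_extChartAt_symm (n := ∞) x).contMDiffAt
      (extChartAt_target_mem_nhds x)).mdifferentiableAt (by simp)
  have h2 := mfderivWithin_range_extChartAt_symm (I := 𝓡 n) (x := x)
  rw [modelWithCornersSelf_coe, range_id, mfderivWithin_univ] at h2
  exact h1.hasMFDerivAt.congr_mfderiv h2

/-- Geodesics issuing from `x` and parallel transport along them, as smooth functions of the
initial data. -/
theorem exists_exponential_data
    {lc : CovariantDerivative (𝓡 n) (EuclideanSpace ℝ (Fin n)) (TangentSpace (𝓡 n) : M → Type _)}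
    (hlc : CovariantDerivative.ContMDiffCovariantDerivative lc ∞)
    {cov : CovariantDerivative (𝓡 n) F E}
    (hcov : CovariantDerivative.ContMDiffCovariantDerivative cov ∞) (x : M) {m : ℕ}
    (ν : EuclideanSpace ℝ (Fin m) →L[ℝ] EuclideanSpace ℝ (Fin n)) (κ : F →ₗ[ℝ] E x) :
    ∃ (N : Set (EuclideanSpace ℝ (Fin m))) (γ : EuclideanSpace ℝ (Fin m) → ℝ → M)
      (s : EuclideanSpace ℝ (Fin m) → F → ℝ → TotalSpace F E),
      IsOpen N ∧ 0 ∈ N ∧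
      (∀ w ∈ N, IsGeodesicOn lc (γ w) (Ioo (-1) 2) ∧
        velocity (n := n) (γ w) 0 = ⟨x, ν w⟩ ∧ ∀ v, IsParallelOn cov (s w v) (Ioo (-1) 2) ∧
          (∀ t, (s w v t).proj = γ w t) ∧ s w v 0 = ⟨x, κ v⟩) ∧
      ContMDiffOn (𝓡 m) (𝓡 n) ∞ (fun w => γ w 1) N ∧ γ 0 1 = x ∧
      HasMFDerivAt (𝓡 m) (𝓡 n) (fun w => γ w 1) 0 ν ∧
      ContMDiffOn ((𝓡 m).prod 𝓘(ℝ, F)) ((𝓡 n).prod 𝓘(ℝ, F)) ∞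
        (fun y : EuclideanSpace ℝ (Fin m) × F => s y.1 y.2 1) (N ×ˢ univ) := by
  obtain ⟨U₁, Ω, h₁⟩ := exists_isChristoffel lc hlc x
  obtain ⟨U₂, A, h₂⟩ := exists_isChristoffel cov hcov x
  set φ := extChartAt (𝓡 n) x with hφ
  set e := trivializationAt F E x with he
  let O := (φ.target ∩ φ.symm ⁻¹' U₁) ∩ (φ.target ∩ φ.symm ⁻¹' U₂)
  have hO : IsOpen O := h₁.isOpen_domain.inter h₂.isOpen_domain
  have hxO : φ x ∈ O := ⟨h₁.mem_domain h₁.mem, h₂.mem_domain h₂.mem⟩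
  have hΩ : ContDiffOn ℝ ∞ Ω O := h₁.contDiffOn.mono inter_subset_left
  have hA : ContDiffOn ℝ ∞ A O := h₂.contDiffOn.mono inter_subset_right
  have hf := contDiffOn_transportField hΩ hA
  obtain ⟨f', hf', hsq, hf'1⟩ := hasFDerivAt_transportField
    ((hΩ.contDiffAt (hO.mem_nhds hxO)).differentiableAt (by simp))
    ((hA.contDiffAt (hO.mem_nhds hxO)).differentiableAt (by simp))
  -- The system is stationary at zero velocity and identity transport operator, so nearby solutions
  -- of the field multiplied by `ε` live beyond the whole interval `[0, 1]`.
  obtain ⟨ε, hε, V, α, hV, hzV, hα, hα1, hα10, hα1'⟩ := exists_smooth_flow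
    ((hO.preimage continuous_fst).mem_nhds hxO) hf
    (by simp [transportField] : transportField Ω A (φ x, 0, ContinuousLinearMap.id ℝ F) = 0)
    hf' hsq
  have hb : x ∈ e.baseSet := h₂.subset_baseSet h₂.mem
  let κ₀ : F →L[ℝ] F :=
    LinearMap.toContinuousLinearMap ((e.linearEquivAt ℝ x hb).toLinearMap.comp κ)
  have hκ₀ (v : F) : e.symm x (κ₀ v) = κ v := e.symm_proj_apply ⟨x, κ v⟩ hb
  -- The flow runs at speed `ε`: the actual velocity of the curve is `ε` times the second component,
  -- whose initial value is therefore `ε⁻¹ • ν w`.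
  let z' : EuclideanSpace ℝ (Fin m) →L[ℝ]
      EuclideanSpace ℝ (Fin n) × EuclideanSpace ℝ (Fin n) × (F →L[ℝ] F) :=
    (0 : EuclideanSpace ℝ (Fin m) →L[ℝ] EuclideanSpace ℝ (Fin n)).prod ((ε⁻¹ • ν).prod 0)
  let z₀ : EuclideanSpace ℝ (Fin n) × EuclideanSpace ℝ (Fin n) × (F →L[ℝ] F) :=
    (φ x, 0, ContinuousLinearMap.id ℝ F)
  let z : EuclideanSpace ℝ (Fin m) →
      EuclideanSpace ℝ (Fin n) × EuclideanSpace ℝ (Fin n) × (F →L[ℝ] F) := fun w => z₀ + z' w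
  have hz1 (w) : (z w).1 = φ x := add_zero _
  have hz2 (w) : (z w).2.1 = ε⁻¹ • ν w := zero_add _
  have hz3 (w) : (z w).2.2 = ContinuousLinearMap.id ℝ F := add_zero _
  have hz0 : z 0 = z₀ := by simp only [z, map_zero, add_zero]
  have hzs : ContDiff ℝ ∞ z := contDiff_const.add z'.contDiff
  have hzd : HasFDerivAt z z' 0 := z'.hasFDerivAt.const_add z₀
  let γ (w : EuclideanSpace ℝ (Fin m)) (t : ℝ) : M := φ.symm (α (z w) t).1
  let s (w : EuclideanSpace ℝ (Fin m)) (v : F) (t : ℝ) : TotalSpace F E :=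
    ⟨γ w t, e.symm (γ w t) ((α (z w) t).2.2 (κ₀ v))⟩
  have hN : IsOpen (z ⁻¹' V) := hV.preimage hzs.continuous
  have h0N : (0 : EuclideanSpace ℝ (Fin m)) ∈ z ⁻¹' V := by rw [mem_preimage, hz0]; exact hzV
  have h1J : (1 : ℝ) ∈ Ioo (-1 : ℝ) 2 := by norm_num
  have hcdom : ∀ w ∈ z ⁻¹' V, (α (z w) 1).1 ∈ O := fun w hw => ((hα _ hw).2 1 h1J).1
  have hα1z : ContDiffOn ℝ ∞ (fun w => α (z w) 1) (z ⁻¹' V) :=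
    hα1.comp hzs.contDiffOn fun w hw => hw
  have hγ1 : ContMDiffOn (𝓡 m) (𝓡 n) ∞ (fun w => γ w 1) (z ⁻¹' V) :=
    (contMDiffOn_extChartAt_symm x).comp (contDiff_fst.comp_contDiffOn hα1z).contMDiffOn
      fun w hw => (hcdom w hw).1.1
  refine ⟨z ⁻¹' V, γ, s, hN, h0N, fun w hw => ?_, hγ1, ?_, ?_, ?_⟩
  · obtain ⟨hy0, hy⟩ := hα (z w) hw
    set y := α (z w) with hydef
    have hys : ContDiffOn ℝ ∞ y (Ioo (-1) 2) :=
      contDiffOn_of_hasDerivAt (hf.const_smul ε) isOpen_Ioo hy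
    have hc : ContDiffOn ℝ ∞ (fun t => (y t).1) (Ioo (-1) 2) := contDiff_fst.comp_contDiffOn hys
    have hp : ContDiffOn ℝ ∞ (fun t => (y t).2.1) (Ioo (-1) 2) :=
      (contDiff_fst.comp contDiff_snd).comp_contDiffOn hys
    have hu : ContDiffOn ℝ ∞ (fun t => (y t).2.2) (Ioo (-1) 2) :=
      (contDiff_snd.comp contDiff_snd).comp_contDiffOn hys
    have hcd : ∀ t ∈ Ioo (-1 : ℝ) 2, HasDerivAt (fun t => (y t).1) (ε • (y t).2.1) t :=
      fun t ht => (hy t ht).2.fst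
    have hpd : ∀ t ∈ Ioo (-1 : ℝ) 2, HasDerivAt (fun t => ε • (y t).2.1)
        (-Ω (y t).1 (ε • (y t).2.1) (ε • (y t).2.1)) t := fun t ht => by
      have h1 : HasDerivAt (fun t => (y t).2.1) (ε • (-Ω (y t).1 (y t).2.1 (y t).2.1)) t :=
        (hy t ht).2.snd.fst
      refine (h1.const_smul ε).congr_deriv ?_
      rw [map_smul, map_smul, _root_.smul_apply, smul_neg, smul_neg]
    have hud (v : F) : ∀ t ∈ Ioo (-1 : ℝ) 2, HasDerivAt (fun t => (y t).2.2 (κ₀ v))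
        (-A (y t).1 (ε • (y t).2.1) ((y t).2.2 (κ₀ v))) t := fun t ht => by
      have h1 : HasDerivAt (fun t => (y t).2.2)
          (ε • (-(A (y t).1 (y t).2.1).comp (y t).2.2)) t := (hy t ht).2.snd.snd
      refine (h1.clm_apply (hasDerivAt_const t (κ₀ v))).congr_deriv ?_
      change ε • (-A (y t).1 (y t).2.1 ((y t).2.2 (κ₀ v))) + (y t).2.2 0 = _
      rw [map_zero, add_zero, map_smul, _root_.smul_apply, smul_neg]
    have hγx : φ.symm (y 0).1 = x := by
      rw [hy0, hz1, φ.left_inv (mem_extChartAt_source x)]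
    obtain ⟨hgeo, hvel⟩ := h₁.isGeodesicOn isOpen_Ioo hc (fun t ht => (hy t ht).1.1) hcd
      (hp.const_smul ε) hpd
    refine ⟨hgeo, ?_, fun v => ⟨?_, fun t => rfl, ?_⟩⟩
    · have h0 := hvel 0 (by norm_num)
      refine h0.trans ?_
      rw [← hφ, hγx, hy0, hz2, smul_smul, mul_inv_cancel₀ hε.ne', one_smul]
      refine congrArg (TotalSpace.mk x) ?_
      have hbT : x ∈ (trivializationAt (EuclideanSpace ℝ (Fin n))
        (TangentSpace (𝓡 n) : M → Type _) x).baseSet := FiberBundle.mem_baseSet_trivializationAt' x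
      have h2 := TangentBundle.continuousLinearMapAt_trivializationAt (I := 𝓡 n)
        (mem_chart_source (EuclideanSpace ℝ (Fin n)) x)
      rw [mfderiv_extChartAt_self] at h2
      have h3 := Trivialization.symmL_continuousLinearMapAt (R := ℝ) _ hbT (ν w)
      rw [h2, Trivialization.symmL_apply _ hbT] at h3
      exact h3
    · exact h₂.isParallelOn isOpen_Ioo hc (fun t ht => (hy t ht).1.2) hcd
        (hu.clm_apply contDiffOn_const) (hud v) fun t ht => rfl
    · change (⟨φ.symm (y 0).1, e.symm (φ.symm (y 0).1) ((y 0).2.2 (κ₀ v))⟩ : TotalSpace F E) = _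
      rw [hγx, hy0, hz3, ContinuousLinearMap.id_apply, hκ₀]
  · change φ.symm (α (z 0) 1).1 = x
    rw [hz0, hα10, φ.left_inv (mem_extChartAt_source x)]
  -- The initial position does not depend on `w`, so the position at time 1 has derivative `ε • ε⁻¹
  -- • ν = ν`.
  · have h1 : HasFDerivAt (fun z => α z 1) (ContinuousLinearMap.id ℝ _ + ε • f') (z 0) := by
      rw [hz0]; exact hα1'
    have h2 : HasFDerivAt (fun w => (α (z w) 1).1) ν 0 := by
      refine ((h1.comp 0 hzd).fst).congr_fderiv ?_
      refine ContinuousLinearMap.ext fun w => ?_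
      change (z' w).1 + ε • (f' (z' w)).1 = ν w
      rw [hf'1]
      change 0 + ε • ε⁻¹ • ν w = ν w
      rw [zero_add, smul_smul, mul_inv_cancel₀ hε.ne', one_smul]
    have h3 : HasMFDerivAt (𝓡 n) (𝓡 n) φ.symm (α (z 0) 1).1
        (ContinuousLinearMap.id ℝ (EuclideanSpace ℝ (Fin n))) := by
      rw [hz0, hα10]
      exact hasMFDerivAt_extChartAt_symm_self x
    exact h3.comp 0 (hasMFDerivAt_iff_hasFDerivAt.2 h2)
  · refine contMDiffOn_trivialization_symm
      (hγ1.comp contMDiffOn_fst fun y hy => hy.1) ?_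
      fun y hy => h₂.subset_baseSet (hcdom y.1 hy.1).2.2
    rw [← modelWithCornersSelf_prod, chartedSpaceSelf_prod, contMDiffOn_iff_contDiffOn]
    exact ((contDiff_snd.comp contDiff_snd).comp_contDiffOn
      (hα1z.comp contDiff_fst.contDiffOn fun y hy => hy.1)).clm_apply
        (κ₀.contDiff.comp contDiff_snd).contDiffOn

end ExponentialData

/-! ### Exponential charts: existence, and lifting to slices -/

section Exponential

variable {𝕜 : Type*} [RCLike 𝕜] {q n : ℕ}
  {G : Type u} [Group G] [TopologicalSpace G] [ChartedSpace (EuclideanSpace ℝ (Fin q)) G]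
  [LieGroup (𝓡 q) ∞ G] [CompactSpace G] [T2Space G]
  {M : Type*} [TopologicalSpace M] [ChartedSpace (EuclideanSpace ℝ (Fin n)) M]
  [IsManifold (𝓡 n) ∞ M] [T2Space M]
  {F : Type*} [NormedAddCommGroup F] [NormedSpace ℝ F] [NormedSpace 𝕜 F] [IsScalarTower ℝ 𝕜 F]
  [FiniteDimensional ℝ F]
  {E : M → Type*} [TopologicalSpace (TotalSpace F E)]
  [∀ x, AddCommGroup (E x)] [∀ x, Module ℝ (E x)] [∀ x, Module 𝕜 (E x)]
  [∀ x, IsScalarTower ℝ 𝕜 (E x)]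
  [∀ x, TopologicalSpace (E x)] [∀ x, IsTopologicalAddGroup (E x)]
  [∀ x, ContinuousSMul ℝ (E x)]
  [FiberBundle F E] [VectorBundle ℝ F E] [VectorBundle 𝕜 F E]
  [ContMDiffVectorBundle ∞ F E (𝓡 n)]
  [MulAction G M] [ContMDiffSMul (𝓡 q) (𝓡 n) ∞ G M]
  [MulAction G (TotalSpace F E)]
  [ContMDiffSMul (𝓡 q) ((𝓡 n).prod 𝓘(ℝ, F)) ∞ G (TotalSpace F E)]
  [IsVectorBundleAction (F := F) (E := E) 𝕜 G]

lemma tangentMap_smul_mk {x : M} (k : MulAction.stabilizer G x)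
    {u v : EuclideanSpace ℝ (Fin n)} (h : isotropyRep q n G x k u = v) :
    tangentMap (𝓡 n) (𝓡 n) (fun y : M => (k : G) • y) ⟨x, u⟩ = ⟨x, v⟩ := by
  let Φ (y : M) (v : EuclideanSpace ℝ (Fin n)) : TangentBundle (𝓡 n) M := ⟨y, v⟩
  have hk : (k : G) • x = x := k.2
  change Φ ((k : G) • x) _ = Φ x v
  exact congr (congrArg Φ hk) h

/-- The translates of parallel sections along curves are parallel. -/
lemma IsParallelOn.smul (q : ℕ) [ChartedSpace (EuclideanSpace ℝ (Fin q)) G]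
    [ContMDiffSMul (𝓡 q) (𝓡 n) ∞ G M]
    [ContMDiffSMul (𝓡 q) ((𝓡 n).prod 𝓘(ℝ, F)) ∞ G (TotalSpace F E)]
    (A : InvariantGeometry (n := n) (F := F) (E := E) G 𝕜) (a : G)
    {s : ℝ → TotalSpace F E} {J : Set ℝ} (hJ : IsOpen J) (hs : IsParallelOn A.conn s J) :
    IsParallelOn A.conn (fun t => a • s t) J := by
  have hT : ContMDiff ((𝓡 n).prod 𝓘(ℝ, F)) ((𝓡 n).prod 𝓘(ℝ, F)) ∞
      (fun Z : TotalSpace F E => a • Z) := ContMDiffSMul.contMDiff_const_smul (I := 𝓡 q) a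
  have hlin (y : M) : ∃ L : E y →ₗ[ℝ] E (a • y), ∀ v, a • (⟨y, v⟩ : TotalSpace F E) =
      ⟨a • y, L v⟩ := by
    obtain ⟨L, hL⟩ := IsVectorBundleAction.exists_linear (F := F) (E := E) (𝕜 := 𝕜) a y
    exact ⟨L.toLinearMap.restrictScalars ℝ, hL⟩
  refine ⟨hT.comp_contMDiffOn hs.1, fun t ht => ?_⟩
  have h := covDerivAlong_comp_of_invariant (cov := A.conn) (T := fun Z => a • Z)
    (f := fun y => a • y) (g := fun y => a⁻¹ • y) hT (contMDiff_const_smul' q n a)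
    (contMDiff_const_smul' q n a⁻¹) (fun y => inv_smul_smul a y) (fun y => smul_inv_smul a y) hlin
    (A.conn_invariant a) ((hs.1.contMDiffAt (hJ.mem_nhds ht)).mdifferentiableAt (by simp))
  obtain ⟨L, hL⟩ := hlin (s t).proj
  rw [hs.2 t ht, hL, map_zero] at h
  have h0 : ∀ {y z : M} {c : E z}, (⟨y, 0⟩ : TotalSpace F E) = ⟨z, c⟩ → c = 0 := by
    intro y z c h
    obtain rfl : y = z := congrArg TotalSpace.proj h
    exact (TotalSpace.mk_injective y h).symm
  exact h0 h

/-- The inner product of `T_x M` on the model space. -/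
def InvariantGeometry.innerAt (A : InvariantGeometry (n := n) (F := F) (E := E) G 𝕜) (x : M) :
    EuclideanSpace ℝ (Fin n) →L[ℝ] EuclideanSpace ℝ (Fin n) →L[ℝ] ℝ := A.g.inner x

variable (q) in
/-- The orthogonal complement of `T_x(G x)` as a subspace of the model space. -/
def InvariantGeometry.normalAt (A : InvariantGeometry (n := n) (F := F) (E := E) G 𝕜) (x : M) :
    Submodule ℝ (EuclideanSpace ℝ (Fin n)) := normalSpace q G A.g x

lemma InvariantGeometry.mem_normalAt (A : InvariantGeometry (n := n) (F := F) (E := E) G 𝕜)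
    (x : M) (v : EuclideanSpace ℝ (Fin n)) :
    v ∈ A.normalAt q x ↔ ∀ ξ, A.innerAt x v (orbitDeriv q n G x ξ) = 0 := Iff.rfl

lemma InvariantGeometry.innerAt_pos (A : InvariantGeometry (n := n) (F := F) (E := E) G 𝕜)
    (x : M) (v : EuclideanSpace ℝ (Fin n)) (hv : v ≠ 0) : 0 < A.innerAt x v v :=
  A.g.pos x v hv

lemma InvariantGeometry.innerAt_isotropyRep
    (A : InvariantGeometry (n := n) (F := F) (E := E) G 𝕜) (x : M) (k : MulAction.stabilizer G x)
    (v w : EuclideanSpace ℝ (Fin n)) :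
    A.innerAt x (isotropyRep q n G x k v) (isotropyRep q n G x k w) = A.innerAt x v w := by
  have hk : (k : G) • x = x := k.2
  have h : A.innerAt ((k : G) • x) (isotropyRep q n G x k v) (isotropyRep q n G x k w) =
    A.innerAt x v w := A.g_invariant k x v w
  rwa [hk] at h

lemma InvariantGeometry.finrank_normalAt
    (A : InvariantGeometry (n := n) (F := F) (E := E) G 𝕜) (x : M)
    [Finite (MulAction.stabilizer G x)] :
    Module.finrank ℝ (A.normalAt q x) = n - q := by
  have := finrank_forall_eq_zero (b := A.innerAt x)
    (fun v w => A.g.symm x v w) (A.innerAt_pos x)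
    (orbitDeriv_injective (q := q) (n := n) (G := G) (x := x)) (A.mem_normalAt x)
  simpa using this

/-- Exponential charts exist at every point. -/
theorem exists_isExponentialChart
    (effective : Dense {y : M | ∀ a : G, a • y = y →
      ∀ v : E y, a • (⟨y, v⟩ : TotalSpace F E) = ⟨y, v⟩})
    (A : InvariantGeometry (n := n) (F := F) (E := E) G 𝕜) (x : M)
    [Finite (MulAction.stabilizer G x)]
    (ν : EuclideanSpace ℝ (Fin (n - q)) ≃ₗ[ℝ] normalSpace q G A.g x) (κ : F ≃ₗ[𝕜] E x)
    {W : Set (EuclideanSpace ℝ (Fin (n - q)))} (hW : W ∈ 𝓝 0) :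
    ∃ (Γ : Type u) (_ : Group Γ) (_ : Finite Γ)
      (c : VectorOrbibundleChart 𝕜 Γ (EuclideanSpace ℝ (Fin (n - q))) F
        (orbitProj (F := F) (E := E) 𝕜 G)),
      IsExponentialChart G A x ν κ c ∧ c.base.source ⊆ W ∧ Quotient.mk _ x ∈ c.base.target := by
  let ν₁ : EuclideanSpace ℝ (Fin (n - q)) ≃ₗ[ℝ] A.normalAt q x := ν
  obtain ⟨ρ, hρ⟩ := exists_restrict_representation (isotropyRep q n G x)
    (fun k v hv => isotropyRep_mem (A.innerAt_isotropyRep x) (A.mem_normalAt x) k hv) ν₁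
  obtain ⟨σ, hσ⟩ := exists_fiber_representation (G := G) (F := F) x κ
  let ν' : EuclideanSpace ℝ (Fin (n - q)) →L[ℝ] EuclideanSpace ℝ (Fin n) :=
    LinearMap.toContinuousLinearMap ((A.normalAt q x).subtype ∘ₗ ν₁.toLinearMap)
  have hν' (k w) : isotropyRep q n G x k (ν' w) = ν' (ρ k w) := (hρ k w).symm
  obtain ⟨N, γ, s, hN, h0N, hγs, hψ, hψ0, hψd, hΨ⟩ := exists_exponential_data
    A.lc_isLeviCivita.smooth A.conn_smooth x ν' (κ.toLinearMap.restrictScalars ℝ)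
  have hI : Icc (0 : ℝ) 1 ⊆ Ioo (-1) 2 := Icc_subset_Ioo (by norm_num) (by norm_num)
  have hpt (w) (hw : w ∈ N) (v : F) : IsParallelTransport A.conn (γ w) ⟨x, κ v⟩ (s w v 1) :=
    ⟨_, s w v, isOpen_Ioo, hI, ((hγs w hw).2.2 v).1, fun t _ => ((hγs w hw).2.2 v).2.1 t,
      ((hγs w hw).2.2 v).2.2, rfl⟩
  have hL (w) (hw : w ∈ N) := IsParallelTransport.exists_linearEquiv (𝕜 := 𝕜) A.conn_smooth
    A.conn_linear κ (hpt w hw)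
  -- Both sides are geodesics, because `k` acts by an isometry, and they have the same initial
  -- velocity by the choice of `ρ`.
  have hγeq (k : MulAction.stabilizer G x) (w) (hw : w ∈ N) (hkw : ρ k w ∈ N) (t : ℝ)
      (ht : t ∈ Ioo (-1 : ℝ) 2) : γ (ρ k w) t = (k : G) • γ w t := by
    have h1 : IsGeodesicOn A.lc (fun t => (k : G) • γ w t) (Ioo (-1) 2) :=
      IsGeodesicOn.comp_isometry A.lc_isLeviCivita (contMDiff_const_smul' q n (k : G))
        (contMDiff_const_smul' q n (k : G)⁻¹) (fun y => inv_smul_smul _ y)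
        (fun y => smul_inv_smul _ y) (A.g_invariant k) isOpen_Ioo (hγs w hw).1
    have h2 : velocity (n := n) (γ (ρ k w)) 0 = velocity (fun t => (k : G) • γ w t) 0 := by
      rw [velocity_comp (contMDiff_const_smul' q n (k : G))
        (((hγs w hw).1.1.contMDiffAt (isOpen_Ioo.mem_nhds (by norm_num))).mdifferentiableAt
          (by simp)), (hγs w hw).2.1, tangentMap_smul_mk k (hν' k w)]
      exact (hγs _ hkw).2.1
    exact congrArg TotalSpace.proj (IsGeodesicOn.velocity_eqOn A.lc_isLeviCivita.smooth isOpen_Ioo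
      isPreconnected_Ioo (hγs _ hkw).1 h1 (t₀ := 0) (by norm_num) h2 t ht)
  -- Both sides are parallel transports of the same vector along the same curve. Uniqueness is the
  -- propagation of the relation `Z₃ = Z₁ + 0 • Z₂`.
  have hΨeq (k : MulAction.stabilizer G x) (w) (hw : w ∈ N) (hkw : ρ k w ∈ N) (v : F) :
      s (ρ k w) (σ k v) 1 = (k : G) • s w v 1 := by
    have h1 : IsParallelTransport A.conn (γ (ρ k w)) ⟨x, κ (σ k v)⟩ ((k : G) • s w v 1) := by
      refine ⟨_, fun t => (k : G) • s w v t, isOpen_Ioo, hI,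
        ((hγs w hw).2.2 v).1.smul q A _ isOpen_Ioo, fun t ht => ?_, ?_, rfl⟩
      · rw [proj_smul 𝕜, ((hγs w hw).2.2 v).2.1, hγeq k w hw hkw t ht]
      · exact (congrArg _ ((hγs w hw).2.2 v).2.2).trans (hσ k v)
    have h2 := hpt _ hkw (σ k v)
    obtain ⟨y, v₁, v₂, e₁, -, e₃⟩ := (IsParallelTransport.isFiberCombination_iff (𝕜 := 𝕜)
      A.conn_smooth A.conn_linear h2 h2 h1 0).1 ⟨x, _, _, rfl, rfl, by simp⟩
    rw [e₁, e₃, zero_smul, add_zero]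
  have hF := isLocalDiffeomorphAt_smul_of_disjoint (q := q) (G := G) (by simp) hN hψ h0N hψ0 hψd
    (fun w ξ hw => by
      have h1 : A.innerAt x (ν' w) (orbitDeriv q n G x ξ) = 0 := (ν₁ w).2 ξ
      rw [← hw] at h1
      by_contra hne
      refine (A.innerAt_pos x _ ?_).ne' h1
      intro h2
      exact hne (ν₁.injective (Subtype.ext (h2.trans (by simp)))))
  obtain ⟨Γ, i1, i2, c, θ, h0c, hsub, hθ, hact, hactT, hslice, hinj, hp, hP⟩ :=
    exists_tubeChart (𝕜 := 𝕜) (F := F) (E := E) effective ρ σ hN h0N hψ hψ0 hΨ hL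
      (fun k w hw hkw => hγeq k w hw hkw 1 (by norm_num)) hΨeq hF hW
  refine ⟨Γ, i1, i2, c, ⟨h0c, θ, _, _, hθ, fun k w hw => ?_, fun k w hw v => ?_, fun w hw => ?_,
    hslice.isLocalDiffeomorphOn, fun a a' w hw w' hw' => ?_,
    hΨ.mono (prod_mono (fun w hw => (hsub hw).2) subset_rfl), fun w _ => hp w, fun w _ v => hP _⟩,
    fun w hw => (hsub hw).1, ?_⟩
  · rw [hact]
    exact tangentMap_smul_mk k (hν' k w)
  · rw [hactT]
    exact hσ k v
  · have h := hγs w (hsub hw).2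
    exact ⟨γ w, ⟨_, isOpen_Ioo, hI, h.1.1, h.1.2, h.2.1⟩, rfl, hpt w (hsub hw).2⟩
  · simp only [hact]
    exact hinj a a' w hw w' hw'
  · have := c.base.proj_mapsTo h0c
    rwa [hp, hψ0] at this

/-- Exponential charts are locally induced. -/
theorem IsExponentialChart.isLocallyInduced
    {A : InvariantGeometry (n := n) (F := F) (E := E) G 𝕜} {x : M}
    {ν : EuclideanSpace ℝ (Fin (n - q)) ≃ₗ[ℝ] normalSpace q G A.g x} {κ : F ≃ₗ[𝕜] E x}
    {Γ : Type u} [Group Γ] [Finite Γ]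
    {c : VectorOrbibundleChart 𝕜 Γ (EuclideanSpace ℝ (Fin (n - q))) F
      (orbitProj (F := F) (E := E) 𝕜 G)} (hc : IsExponentialChart G A x ν κ c) :
    c.IsLocallyInduced G := by
  obtain ⟨-, θ, ψ, Ψ, -, -, -, hex, hdiff, -, hΨ, hp, hP⟩ := hc
  have hL (w) (hw : w ∈ c.base.source) : ∃ L : F ≃ₗ[𝕜] E (ψ w), ∀ v, Ψ (w, v) = ⟨ψ w, L v⟩ := by
    obtain ⟨γ, -, h1, hpt⟩ := hex w hw
    rw [← h1]
    exact IsParallelTransport.exists_linearEquiv A.conn_smooth A.conn_linear κ hpt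
  -- Smoothness of `ψ` is inherited from `Ψ`: it is the base point of `Ψ (w, 0)`.
  have hψ : ContMDiffOn (𝓡 (n - q)) (𝓡 n) ∞ ψ c.base.source := by
    have h1 : ContMDiffOn (𝓡 (n - q)) ((𝓡 n).prod 𝓘(ℝ, F)) ∞ (fun w => Ψ (w, 0))
        c.base.source :=
      hΨ.comp (contMDiff_id.prodMk contMDiff_const).contMDiffOn fun w hw => ⟨hw, trivial⟩
    refine ((contMDiff_proj E).comp_contMDiffOn h1).congr fun w hw => ?_
    obtain ⟨L, hL⟩ := hL w hw
    simp [hL]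
  exact fun w hw => ⟨c.base.source, ψ, Ψ, c.base.isOpen_source, hw, subset_rfl, hψ, hΨ, hL, hdiff,
    hp, hP⟩

end Exponential

/-! ### The canonical vector orbibundle structure -/

theorem mainTheorem12 {𝕜 : Type*} [RCLike 𝕜] {q n : ℕ}
    {G : Type u} [Group G] [TopologicalSpace G] [ChartedSpace (EuclideanSpace ℝ (Fin q)) G]
    [LieGroup (𝓡 q) ∞ G] [CompactSpace G] [T2Space G]
    {M : Type*} [TopologicalSpace M] [ChartedSpace (EuclideanSpace ℝ (Fin n)) M]
    [IsManifold (𝓡 n) ∞ M] [T2Space M]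
    {F : Type*} [NormedAddCommGroup F] [NormedSpace ℝ F] [NormedSpace 𝕜 F] [IsScalarTower ℝ 𝕜 F]
    [FiniteDimensional ℝ F]
    {E : M → Type*} [TopologicalSpace (TotalSpace F E)]
    [∀ x, AddCommGroup (E x)] [∀ x, Module ℝ (E x)] [∀ x, Module 𝕜 (E x)]
    [∀ x, IsScalarTower ℝ 𝕜 (E x)]
    [∀ x, TopologicalSpace (E x)] [∀ x, IsTopologicalAddGroup (E x)]
    [∀ x, ContinuousSMul ℝ (E x)]
    [FiberBundle F E] [VectorBundle ℝ F E] [VectorBundle 𝕜 F E]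
    [ContMDiffVectorBundle ∞ F E (𝓡 n)]
    [MulAction G M] [ContMDiffSMul (𝓡 q) (𝓡 n) ∞ G M]
    [MulAction G (TotalSpace F E)]
    [ContMDiffSMul (𝓡 q) ((𝓡 n).prod 𝓘(ℝ, F)) ∞ G (TotalSpace F E)]
    [IsVectorBundleAction (F := F) (E := E) 𝕜 G]
    (finite_isotropy : ∀ x : M, Finite (MulAction.stabilizer G x))
    (effective : Dense {y : M | ∀ a : G, a • y = y →
      ∀ v : E y, a • (⟨y, v⟩ : TotalSpace F E) = ⟨y, v⟩}) :
    ∃ S : VectorOrbibundleStructure.{u} 𝕜 (EuclideanSpace ℝ (Fin (n - q))) F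
        (orbitProj (F := F) (E := E) 𝕜 G),
      -- the charts of `S` are exactly the charts that are locally induced by `E → M`
      (∀ (Γ : Type u) [Group Γ] [Finite Γ] (c : VectorOrbibundleChart 𝕜 Γ
          (EuclideanSpace ℝ (Fin (n - q))) F (orbitProj (F := F) (E := E) 𝕜 G)),
        S.IsChart Γ c ↔ c.IsLocallyInduced G) ∧
      -- for all choices of an invariant metric and an invariant connection
      ∀ A : InvariantGeometry (n := n) (F := F) (E := E) G 𝕜,
        -- there are arbitrarily small exponential charts at every orbit
        (∀ (x : M) (ν : EuclideanSpace ℝ (Fin (n - q)) ≃ₗ[ℝ] normalSpace q G A.g x)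
          (κ : F ≃ₗ[𝕜] E x), ∀ W ∈ 𝓝 (0 : EuclideanSpace ℝ (Fin (n - q))),
          ∃ (Γ : Type u) (_ : Group Γ) (_ : Finite Γ) (c : VectorOrbibundleChart 𝕜 Γ
            (EuclideanSpace ℝ (Fin (n - q))) F (orbitProj (F := F) (E := E) 𝕜 G)),
            IsExponentialChart G A x ν κ c ∧ c.base.source ⊆ W) ∧
        -- `S` is the only vector orbibundle structure that contains all exponential charts
        ∀ S' : VectorOrbibundleStructure.{u} 𝕜 (EuclideanSpace ℝ (Fin (n - q))) F
            (orbitProj (F := F) (E := E) 𝕜 G),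
          (∀ (x : M) (ν : EuclideanSpace ℝ (Fin (n - q)) ≃ₗ[ℝ] normalSpace q G A.g x)
            (κ : F ≃ₗ[𝕜] E x) (Γ : Type u) [Group Γ] [Finite Γ] (c : VectorOrbibundleChart 𝕜 Γ
              (EuclideanSpace ℝ (Fin (n - q))) F (orbitProj (F := F) (E := E) 𝕜 G)),
            IsExponentialChart G A x ν κ c → S'.IsChart Γ c) ↔ S' = S := by
  have := topologicalGroup_of_lieGroup (𝓡 q) ∞ (G := G)
  have := ContMDiffSMul.continuousSMul (I := 𝓡 q) (I' := 𝓡 n) (G := G) (M := M) ∞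
  have := ContMDiffSMul.continuousSMul (I := 𝓡 q) (I' := (𝓡 n).prod 𝓘(ℝ, F)) (G := G)
    (M := TotalSpace F E) ∞
  have := t2Space_totalSpace F E
  have hcov (y : MulAction.orbitRel.Quotient G M) : ∃ (Γ : Type u) (_ : Group Γ) (_ : Finite Γ)
      (c : VectorOrbibundleChart 𝕜 Γ (EuclideanSpace ℝ (Fin (n - q))) F
        (orbitProj (F := F) (E := E) 𝕜 G)), c.IsLocallyInduced G ∧ y ∈ c.base.target := by
    induction y using Quotient.ind with | _ x
    have := finite_isotropy x
    exact exists_isLocallyInduced F E x effective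
  refine ⟨inducedOrbibundleStructure 𝕜 q n F E t2Space_orbitRel_quotient t2Space_orbitRel_quotient hcov,
    fun Γ _ _ c => Iff.rfl, fun A => ⟨fun x ν κ W hW => ?_, fun S' => ⟨fun h => ?_, ?_⟩⟩⟩
  · have := finite_isotropy x
    obtain ⟨Γ, i₁, i₂, c, hc, hcW, -⟩ := exists_isExponentialChart effective A x ν κ hW
    exact ⟨Γ, i₁, i₂, c, hc, hcW⟩
  -- One exponential chart per orbit already determines the structure; the identifications `ν` and
  -- `κ` used for it exist by a dimension count and by a local trivialization.
  · refine eq_inducedOrbibundleStructure S' fun y => ?_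
    induction y using Quotient.ind with | _ x
    have := finite_isotropy x
    have ν : EuclideanSpace ℝ (Fin (n - q)) ≃ₗ[ℝ] A.normalAt q x :=
      LinearEquiv.ofFinrankEq _ _ (by rw [A.finrank_normalAt x]; simp)
    have κ : F ≃ₗ[𝕜] E x := ((trivializationAt F E x).linearEquivAt 𝕜 x
      (FiberBundle.mem_baseSet_trivializationAt' x)).symm
    obtain ⟨Γ, i₁, i₂, c, hc, -, hx⟩ := exists_isExponentialChart effective A x ν κ
      Filter.univ_mem
    exact ⟨Γ, i₁, i₂, c, h x ν κ Γ c hc, hc.isLocallyInduced, hx⟩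
  · rintro rfl x ν κ Γ _ _ c hc
    exact hc.isLocallyInduced
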